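/- Let $\Gamma$ be a finitely generated discrete group with word length $\|\cdot\|$ (for some finite generating set), and let $$\mathfrak B^\omega=\{b:\Gamma\to\mathbb C:\ \sup_{g}e^{r\|g\|}|b(g)|<\infty\ \text{for all } r\in\mathbb Z\},$$ a Fréchet algebra under convolution. Let $\Omega_*(\mathfrak B^\omega)$ be its completed universal differential graded algebra, $\Omega_q(\mathfrak B^\omega)=\mathfrak B^\omega\hat\otimes(\mathfrak B^\omega/\mathbb C)^{\hat\otimes q}$ (projective tensor products, spanned topologically by the $b_0\,db_1\cdots db_q$), and let $\overline\Omega_*(\mathfrak B^\omega)$ be its quotient by the closure of the graded commutators $[\Omega_*,\Omega_*]$. Let $M$ be a closed connected smooth manifold and $\pi:M'\to M$ a connected normal covering with covering group $\Gamma$, where $g\in\Gamma$ acts on the left of $M'$ by $L_g$. Let $\mathcal D^\omega=\mathfrak B^\omega\times_\Gamma M'$, the associated flat bundle of left $\mathfrak B^\omega$-modules of rank one on $M$; its sections $s$ are identified with rapidly decreasing smooth functions on $M'$, on which $b=\sum_g b_g\,g$ acts by $b\cdot s=\sum_g b_g L_{g^{-1}}^*s$. Let $h\in C_c^\infty(M')$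 be real-valued with $\sum_{g\in\Gamma}L_g^*h=1$, and let $\nabla=\nabla^{1,0}+\nabla^{0,1}$ be the connection on $\mathcal D^\omega$ whose part $\nabla^{1,0}$ is the flat connection and whose part $\nabla^{0,1}$ is $$\nabla^{0,1}s=\sum_{g\in\Gamma}dg\otimes h\cdot L_g^*s ,$$ extended to $\Omega^*(M;\Omega_*(\mathfrak B^\omega)\otimes_{\mathfrak B^\omega}\mathcal D^\omega)$ by the graded Leibniz rule. Its Chern character is $\mathrm{ch}(\nabla)=\mathrm{Tr}\,(e^{-\nabla^2})$, with components $\mathrm{ch}^{p,q}\in\Omega^p(M;\overline\Omega_q(\mathfrak B^\omega))$. Let $x\in\Gamma$, $k\ge 0$, and let $\tau\in Z^k_x$, i.e. $\tau:\Gamma^{k+1}\to\mathbb C$ is skew-symmetric, satisfies $\sum_{j=0}^{k+1}(-1)^j\tau(\gamma_0,\dots,\widehat{\gamma_j},\dots,\gamma_{k+1})=0$, satisfies $\tau(\gamma_0z,\dots,\gamma_kz)=\tau(\gamma_0,\dots,\gamma_k)$ for all $z$ in the centralizer of $x$, and satisfies $\tau(\gamma_0x,\gamma_1,\dots,\gamma_k)=\tau(\gamma_0,\dots,\gamma_k)$.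 Let $Z_\tau$ be the corresponding cyclic cocycle, $$Z_\tau(\gamma_0,\dots,\gamma_k)=\begin{cases}\tau(\gamma_0\gamma_1\cdots\gamma_k\,g,\ \gamma_1\cdots\gamma_k\,g,\ \dots,\ \gamma_k\,g)&\text{if }\gamma_0\gamma_1\cdots\gamma_k=gxg^{-1}\text{ for some } g\in\Gamma,\\0&\text{if }\gamma_0\cdots\gamma_k\text{ is not conjugate to }x,\end{cases}$$ and suppose that there are $C,D>0$ with $|Z_\tau(\gamma_0,\dots,\gamma_k)|\le Ce^{D(\|\gamma_0\|+\dots+\|\gamma_k\|)}$ for all $\gamma_0,\dots,\gamma_k$. Then $b_0\,db_1\cdots db_k\mapsto Z_\tau(b_0,\dots,b_k)$ defines a functional on $\overline\Omega_k(\mathfrak B^\omega)$; for every $p$ the form $\langle Z_\tau,\mathrm{ch}^{p,k}(\nabla)\rangle\in\Omega^p(M;\mathbb C)$ is smooth and closed; and the class $\langle Z_\tau,\mathrm{ch}(\nabla)\rangle\in H^*(M;\mathbb C)$ of the sum of these forms is $$\langle Z_\tau,\mathrm{ch}(\nabla)\rangle=\begin{cases}0&\text{if }x\neq e,\\ c_k\,\nu^*[\tau]\in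 H^k(M;\mathbb C)&\text{if }x=e,\end{cases}$$ where $c_k\ne0$ is a constant that depends only on $k$, $\nu:M\to B\Gamma$ is a map classifying the covering $M'\to M$, and $[\tau]$ is regarded as an element of $H^k(\Gamma;\mathbb C)\cong H^k(B\Gamma;\mathbb C)$. -/

import Mathlib

open scoped Manifold ContDiff

noncomputable section

namespace NCChern

/-! ### Noncommutative differential forms over `𝔅^ω`

`𝔅^ω ⊗̂ ⋯ ⊗̂ 𝔅^ω` (`q + 1` factors) is the Fréchet space of rapidly decreasing functions on
`Γ^(q+1)`, the function being the family of coefficients of `γ₀ ⊗ ⋯ ⊗ γ_q`.  The universal forms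
`Ω_q(𝔅^ω) = 𝔅^ω ⊗̂ (𝔅^ω/ℂ)^{⊗̂ q}` are realised, as usual, inside it through
`d b = 1 ⊗ b - b ⊗ 1` and
`(a₀ ⊗ ⋯ ⊗ a_p)(b₀ ⊗ ⋯ ⊗ b_q) = a₀ ⊗ ⋯ ⊗ a_p b₀ ⊗ ⋯ ⊗ b_q`: they are the tensors
killed by every multiplication of two neighbouring factors (`Ω_1 = ker (𝔅 ⊗̂ 𝔅 → 𝔅)`,
`Ω_q = Ω_1 ⊗_𝔅 ⋯ ⊗_𝔅 Ω_1`). -/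

section Algebra

variable {Γ : Type*} [Group Γ] {V : Type*}

/-- Word length of `g` with respect to the generating set `S`. -/
def wordLength (S : Set Γ) (g : Γ) : ℕ :=
  sInf {n | ∃ l : List Γ, l.length = n ∧ (∀ a ∈ l, a ∈ S ∨ a⁻¹ ∈ S) ∧ l.prod = g}

/-- `‖γ₀‖ + ⋯ + ‖γ_q‖`. -/
def totalLength (S : Set Γ) {q : ℕ} (γ : Fin (q + 1) → Γ) : ℝ :=
  ∑ i, (wordLength S (γ i) : ℝ)

/-- Families of coefficients in `V` of the tensors `γ₀ ⊗ ⋯ ⊗ γ_q`. -/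
abbrev Chain (Γ : Type*) (V : Type*) (q : ℕ) := (Fin (q + 1) → Γ) → V

/-- Membership in `𝔅^ω ⊗̂ ⋯ ⊗̂ 𝔅^ω`; for `q = 0` this is `𝔅^ω` itself. -/
def RapidDecay (S : Set Γ) {q : ℕ} (w : Chain Γ ℂ q) : Prop :=
  ∀ r : ℕ, ∃ C : ℝ, ∀ γ, Real.exp (r * totalLength S γ) * ‖w γ‖ ≤ C

/-- The group element `g`, as an element of `𝔅^ω`. -/
def grp (g : Γ) : Chain Γ ℂ 0 :=
  open Classical in fun γ => if γ 0 = g then 1 else 0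

/-- `(a₀ ⊗ ⋯ ⊗ a_p)(b₀ ⊗ ⋯ ⊗ b_q) = a₀ ⊗ ⋯ ⊗ a_p b₀ ⊗ ⋯ ⊗ b_q`. -/
def mul [AddCommMonoid V] [Module ℂ V] [TopologicalSpace V] {p q k : ℕ} (h : p + q = k)
    (w : Chain Γ V p) (v : Chain Γ ℂ q) : Chain Γ V k := fun γ =>
  ∑' u : Γ,
    v (fun j => if j = 0 then u⁻¹ * γ ⟨p, by omega⟩
      else γ ⟨p + j, by have := j.2; omega⟩) •
    w (fun i => if i = Fin.last p then u else γ ⟨i, by have := i.2; omega⟩)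

/-- `d (b₀ ⊗ ⋯ ⊗ b_q) = ∑ i, (-1)^i b₀ ⊗ ⋯ ⊗ b_{i-1} ⊗ 1 ⊗ b_i ⊗ ⋯ ⊗ b_q`; in particular
`d b = 1 ⊗ b - b ⊗ 1`, and `d` is a graded derivation for `mul`. -/
def diff [AddCommMonoid V] [Module ℂ V] {q : ℕ} (w : Chain Γ V q) : Chain Γ V (q + 1) :=
  open Classical in fun γ =>
  ∑ i : Fin (q + 2), if γ i = 1 then (-1 : ℂ) ^ (i : ℕ) • w (fun j => γ (i.succAbove j)) else 0

/-- Membership in `Ω_q(𝔅^ω)`. -/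
def IsForm (S : Set Γ) {q : ℕ} (w : Chain Γ ℂ q) : Prop :=
  RapidDecay S w ∧ ∀ (i : Fin q) (γ : Fin (q + 1) → Γ),
    ∑' u : Γ, w (Function.update (Function.update γ i.castSucc (γ i.castSucc * u))
      i.succ (u⁻¹ * γ i.succ)) = 0

/-- The Fréchet space `Ω_q(𝔅^ω)`. -/
abbrev Omega (S : Set Γ) (q : ℕ) := {w : Chain Γ ℂ q // IsForm S w}

/-- The span of the graded commutators `[Ω_p(𝔅^ω), Ω_q(𝔅^ω)]`, `p + q = k`. -/
def commutators (S : Set Γ) (k : ℕ) : Submodule ℂ (Chain Γ ℂ k) :=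
  Submodule.span ℂ {z | ∃ (p q : ℕ) (h : p + q = k) (w : Chain Γ ℂ p) (v : Chain Γ ℂ q),
    IsForm S w ∧ IsForm S v ∧
    z = mul h w v - (-1 : ℂ) ^ (p * q) • mul ((add_comm q p).trans h) v w}

/-- Membership in the closure of the commutators, for the Fréchet topology given by the seminorms
`sup_γ exp (r (‖γ₀‖ + ⋯ + ‖γ_k‖)) |z γ|`. -/
def InCommutatorClosure (S : Set Γ) {k : ℕ} (z : Chain Γ ℂ k) : Prop :=
  ∀ r : ℕ, ∀ ε > (0 : ℝ), ∃ c ∈ commutators S k, ∀ γ,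
    Real.exp (r * totalLength S γ) * ‖z γ - c γ‖ ≤ ε

/-- `Ω̄_q(𝔅^ω)`, the quotient of `Ω_q(𝔅^ω)` by the closure of the graded commutators. -/
def OmegaBar (S : Set Γ) (q : ℕ) :=
  Quot fun w w' : Omega S q => InCommutatorClosure S (w.1 - w'.1)

/-- `τ ∈ Z^k_x`. -/
structure IsCocycle (x : Γ) {k : ℕ} (τ : Chain Γ ℂ k) : Prop where
  skew : ∀ (s : Equiv.Perm (Fin (k + 1))) (γ : Fin (k + 1) → Γ),
    τ (γ ∘ s) = ((Equiv.Perm.sign s : ℤ) : ℂ) * τ γ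
  right_invariant : ∀ z : Γ, z * x = x * z → ∀ γ, τ (fun i => γ i * z) = τ γ
  x_invariant : ∀ γ, τ (Function.update γ 0 (γ 0 * x)) = τ γ
  closed : ∀ γ : Fin (k + 2) → Γ,
    ∑ j : Fin (k + 2), (-1 : ℂ) ^ (j : ℕ) * τ (fun i => γ (j.succAbove i)) = 0

/-- The cyclic cocycle of `τ ∈ Z^k_x`: it vanishes unless `γ₀ γ₁ ⋯ γ_k = g x g⁻¹` for some `g`, and
then it is `τ(γ₀ ⋯ γ_k g, γ₁ ⋯ γ_k g, …, γ_k g)`, which does not depend on `g`. -/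
def cyclicCocycle (x : Γ) {k : ℕ} (τ : Chain Γ ℂ k) : Chain Γ ℂ k :=
  open Classical in fun γ =>
  if h : ∃ g : Γ, (List.ofFn γ).prod = g * x * g⁻¹ then
    τ (fun i => ((List.ofFn γ).drop i).prod * h.choose)
  else 0

/-- `Z(b₀ db₁ ⋯ db_k) = Z(b₀, b₁, …, b_k)` for a reduced cochain `Z`: inside the tensors,
`b₀ db₁ ⋯ db_k` is `b₀ ⊗ b₁ ⊗ ⋯ ⊗ b_k` plus tensors with a factor `1` in a positive place. -/
def evalCochain {k : ℕ} (Z : Chain Γ ℂ k) (w : Chain Γ ℂ k) : ℂ := ∑' γ, Z γ * w γ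

/-- `Z` passes to the quotient `Ω̄_k(𝔅^ω)`. -/
def Descends (S : Set Γ) {k : ℕ} (Z : Chain Γ ℂ k) : Prop :=
  ∀ w w' : Omega S k, InCommutatorClosure S (w.1 - w'.1) → evalCochain Z w.1 = evalCochain Z w'.1

/-- The pairing `⟨Z, ·⟩ : Ω̄_k(𝔅^ω) → ℂ`. -/
def pair {S : Set Γ} {k : ℕ} {Z : Chain Γ ℂ k} (hZ : Descends S Z) : OmegaBar S k → ℂ :=
  Quot.lift (fun w => evalCochain Z w.1) hZ

end Algebra

/-! ### Differential forms on manifolds -/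

section Forms

variable {n : ℕ} {M : Type*} [TopologicalSpace M] [ChartedSpace (EuclideanSpace ℝ (Fin n)) M]

/-- Not necessarily smooth complex `p`-forms; the model space is the tangent space at each point. -/
abbrev DForm (n : ℕ) (M : Type*) (p : ℕ) := M → (EuclideanSpace ℝ (Fin n)) [⋀^Fin p]→L[ℝ] ℂ

/-- The form `α` read in the chart around `x₀`, i.e. pulled back by the inverse of that chart. -/
def chartRep {p : ℕ} (α : DForm n M p) (x₀ : M) : DForm n (EuclideanSpace ℝ (Fin n)) p := fun y =>
  (α ((extChartAt (𝓡 n) x₀).symm y)).compContinuousLinearMap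
    (mfderiv 𝓘(ℝ, EuclideanSpace ℝ (Fin n)) (𝓡 n) (extChartAt (𝓡 n) x₀).symm y)

def IsSmoothForm {p : ℕ} (α : DForm n M p) : Prop :=
  ∀ x₀ : M, ContDiffOn ℝ ∞ (chartRep α x₀) (extChartAt (𝓡 n) x₀).target

/-- Exterior derivative, computed at `x` in the preferred chart at `x`, which is the chart that
identifies the tangent space at `x` with the model space. -/
def extd {p : ℕ} (α : DForm n M p) : DForm n M (p + 1) := fun x =>
  extDeriv (chartRep α x) (extChartAt (𝓡 n) x x)

end Forms

/-! ### Normal coverings -/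

/-- `π : X' → X` is a normal covering with covering group `Γ`, acting on the left of `X'`. -/
structure IsNormalCovering (Γ : Type*) [Group Γ] {X' X : Type*} [TopologicalSpace X']
    [TopologicalSpace X] [MulAction Γ X'] (π : X' → X) : Prop where
  covering : IsCoveringMap π
  surjective : Function.Surjective π
  continuous_smul : ∀ g : Γ, Continuous fun m : X' => g • m
  fiber : ∀ m m' : X', π m = π m' ↔ ∃ g : Γ, g • m = m'
  free : ∀ (g : Γ) (m : X'), g • m = m → g = 1

/-! ### The bundle `𝒟^ω = 𝔅^ω ×_Γ M'` and its connection

The pull-back of `𝒟^ω` to `M'` is the trivial bundle with fibre `𝔅^ω`, and the flat structure is the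
trivial one.  The function `s` on `M'` which stands for a section of `𝒟^ω` corresponds to the
`𝔅^ω`-valued function `m ↦ ∑_g s(g m) g` on `M'`.  All forms with values in
`Ω_*(𝔅^ω) ⊗_𝔅 𝒟^ω` are written in this trivialisation on `M'`. -/

section Bundle

variable {Γ : Type*} [Group Γ] {n : ℕ} {M' : Type*} [TopologicalSpace M']
  [ChartedSpace (EuclideanSpace ℝ (Fin n)) M'] [MulAction Γ M']

/-- Forms on `M'` with values in the noncommutative forms: the component of bidegree `(p, q)` is the
sum of the `γ₀ ⊗ ⋯ ⊗ γ_q ⊗ S p q γ`. Noncommutative forms stand to the left of the forms on `M'`,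
and signs follow the Koszul rule. -/
abbrev BForm (Γ : Type*) (n : ℕ) (M' : Type*) := ∀ p q : ℕ, Chain Γ (DForm n M' p) q

/-- The connection form `∑_g h(g m) d(g⁻¹) g ∈ Ω_1(𝔅^ω)` at `m`, the value of `∇^{0,1}` on the flat
frame `1`; see `nabla01_sectionForm`. -/
def connForm (h : M' → ℝ) (m : M') : Chain Γ ℂ 1 := fun γ =>
  ∑' g : Γ, (h (g • m) : ℂ) * mul (add_zero 1) (diff (grp g⁻¹)) (grp g) γ

/-- `∇^{1,0} (w ⊗ α) = (-1)^q w ⊗ dα` for `w ∈ Ω_q(𝔅^ω)`. -/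
def nabla10 (S : BForm Γ n M') : BForm Γ n M' := fun p q =>
  match p with
  | 0 => 0
  | p + 1 => fun γ => (-1 : ℂ) ^ q • extd (S p q γ)

/-- `∇^{0,1} (w ⊗ α) = (dw + (-1)^q w A) ⊗ α` for `w ∈ Ω_q(𝔅^ω)`, where `A` is the connection
form: the Leibniz extension of `∇^{0,1}` from sections to forms. -/
def nabla01 (h : M' → ℝ) (S : BForm Γ n M') : BForm Γ n M' := fun p q =>
  match q with
  | 0 => 0
  | q + 1 => fun γ m => diff (fun γ' => S p q γ' m) γ +
      (-1 : ℂ) ^ q • mul rfl (fun γ' => S p q γ' m) (connForm h m) γ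

/-- The connection `∇ = ∇^{1,0} + ∇^{0,1}` extended to forms. -/
def nabla (h : M' → ℝ) (S : BForm Γ n M') : BForm Γ n M' := nabla10 S + nabla01 h S

/-- The flat frame `1` of the pull-back of `𝒟^ω` to `M'`. -/
def frame : BForm Γ n M' := fun p q =>
  match p, q with
  | 0, 0 => fun γ _ =>
      ContinuousAlternatingMap.constOfIsEmpty ℝ (EuclideanSpace ℝ (Fin n)) (Fin 0) (grp (1 : Γ) γ)
  | _, _ => 0

/-- `ch(∇) = Tr (exp (-∇²))`, where `∇²` is `Ω_*(𝔅^ω)`-linear and the trace of an endomorphism `T`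
of the free left module of rank one with frame `1` is the class of `T(1)`. This is a representative
of the component of bidegree `(p, q)`; as `(∇²)^j` has total degree `2 j`, only finitely many
terms of the exponential series contribute to it. -/
def chern (h : M' → ℝ) (p q : ℕ) : Chain Γ (DForm n M' p) q :=
  ∑ j ∈ Finset.range (p + q + 1),
    ((-1 : ℂ) ^ j / (j.factorial : ℂ)) • ((fun S => nabla h (nabla h S))^[j] frame) p q

/-- The value of `chern h p q` at a point and on tangent vectors. -/
def chernAt (h : M' → ℝ) (p q : ℕ) (m : M') (v : Fin p → EuclideanSpace ℝ (Fin n)) :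
    Chain Γ ℂ q :=
  fun γ => chern h p q γ m v

/-- The section of `𝒟^ω` given by the function `s` on `M'`, in the trivialisation on `M'`. -/
def sectionForm (s : M' → ℂ) : BForm Γ n M' := fun p q =>
  match p, q with
  | 0, 0 => fun γ m =>
      ContinuousAlternatingMap.constOfIsEmpty ℝ (EuclideanSpace ℝ (Fin n)) (Fin 0) (s (γ 0 • m))
  | _, _ => 0

/-- `∇_g s = h · L_g^* s`. -/
def nablaG (h : M' → ℝ) (g : Γ) (s : M' → ℂ) (m : M') : ℂ := h m * s (g • m)

end Bundle

section Check

variable {Γ : Type*} [Group Γ] {n : ℕ} {M' : Type*} [MulAction Γ M']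

open Classical in
theorem diff_zero_apply {V : Type*} [AddCommGroup V] [Module ℂ V] (w : Chain Γ V 0)
    (γ : Fin 2 → Γ) :
    diff w γ = (if γ 0 = 1 then w (fun _ => γ 1) else 0) -
      if γ 1 = 1 then w (fun _ => γ 0) else 0 := by
  have e0 : (fun j : Fin 1 => γ ((0 : Fin 2).succAbove j)) = fun _ => γ 1 := by
    funext j; fin_cases j; rfl
  have e1 : (fun j : Fin 1 => γ ((1 : Fin 2).succAbove j)) = fun _ => γ 0 := by
    funext j; fin_cases j; rfl
  rw [diff, Fin.sum_univ_two, e0, e1]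
  split_ifs <;> simp [sub_eq_add_neg]

theorem hasSum_translates (h : M' → ℝ) (hh : ∀ m, ∑ᶠ g : Γ, h (g • m) = 1) (m : M') :
    HasSum (fun g : Γ => (h (g • m) : ℂ)) 1 := by
  have hs : (Function.support fun g : Γ => h (g • m)).Finite := by
    by_contra hc
    have := finsum_of_infinite_support (f := fun g : Γ => h (g • m)) hc
    rw [hh m] at this
    exact one_ne_zero this
  have h1 : HasSum (fun g : Γ => h (g • m)) 1 := by
    rw [← hh m, finsum_eq_sum _ hs]
    exact hasSum_sum_of_ne_finset_zero (fun g hg => by simpa using hg)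
  have h2 := (Complex.hasSum_ofReal (f := fun g : Γ => h (g • m)) (x := 1)).2 h1
  simpa using h2

/-- `A(m) = 1 ⊗ 1 - ∑_g h(g m) g⁻¹ ⊗ g`. -/
theorem connForm_apply (h : M' → ℝ) (hh : ∀ m, ∑ᶠ g : Γ, h (g • m) = 1) (m : M')
    (γ : Fin 2 → Γ) :
    open Classical in connForm h m γ = (if γ 0 = 1 ∧ γ 1 = 1 then 1 else 0) -
      if γ 0 * γ 1 = 1 then (h (γ 1 • m) : ℂ) else 0 := by
  classical
  have hsum := hasSum_translates h hh m
  have hmul : ∀ g : Γ, mul (add_zero 1) (diff (grp g⁻¹)) (grp g) γ =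
      (if γ 0 = 1 ∧ γ 1 = 1 then 1 else 0) - if g = γ 1 then
        (if γ 0 * γ 1 = 1 then (1 : ℂ) else 0) else 0 := by
    intro g
    rw [mul, tsum_eq_single (γ 1 * g⁻¹)]
    · rw [diff_zero_apply]
      simp only [grp]
      have a1 : (1 : Fin 2) = Fin.last 1 := rfl
      simp only [← a1, if_true]
      by_cases c0 : γ 0 = 1
      · by_cases c1 : γ 1 = 1
        · by_cases c2 : g = 1 <;> simp [c0, c1, c2]
        · by_cases c2 : g = γ 1
          · subst c2; simp [c0, c1]
          · have : γ 1 * g⁻¹ ≠ 1 := fun hh => c2 (mul_inv_eq_one.1 hh).symm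
            simp [c0, c1, c2, this]
      · by_cases c2 : g = γ 1
        · subst c2; simp [c0, mul_eq_one_iff_eq_inv]
        · have : γ 1 * g⁻¹ ≠ 1 := fun hh => c2 (mul_inv_eq_one.1 hh).symm
          simp [c0, c2, this]
    · intro u hu
      have : grp g (fun j : Fin 1 => if j = 0 then u⁻¹ * γ ⟨1, by omega⟩
          else γ ⟨1 + j, by have := j.2; omega⟩) = 0 := by
        simp only [grp, if_true]
        refine if_neg fun hg => hu ?_
        rw [← hg]
        simp
      rw [this, zero_smul]
  have key : HasSum (fun g : Γ => (h (g • m) : ℂ) *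
      mul (add_zero 1) (diff (grp g⁻¹)) (grp g) γ)
      (1 * (if γ 0 = 1 ∧ γ 1 = 1 then 1 else 0) -
        if γ 0 * γ 1 = 1 then (h (γ 1 • m) : ℂ) else 0) := by
    simp only [hmul, mul_sub]
    refine (hsum.mul_right _).sub ?_
    have := hasSum_ite_eq (γ 1) (if γ 0 * γ 1 = 1 then (h (γ 1 • m) : ℂ) else 0)
    refine this.congr_fun ?_
    intro g
    by_cases c : g = γ 1
    · rw [if_pos c, if_pos c, c]; simp
    · rw [if_neg c, if_neg c, mul_zero]
  rw [connForm, key.tsum_eq, one_mul]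

/-- On sections, the connection is `∇^{0,1} s = ∑_g dg ⊗ ∇_g s`. -/
theorem nabla01_sectionForm (h : M' → ℝ) (hh : ∀ m, ∑ᶠ g : Γ, h (g • m) = 1) (s : M' → ℂ)
    (γ : Fin 2 → Γ) (m : M') :
    nabla01 (n := n) h (sectionForm s) 0 1 γ m =
      ContinuousAlternatingMap.constOfIsEmpty ℝ (EuclideanSpace ℝ (Fin n)) (Fin 0)
        (∑' g : Γ, mul (add_zero 1) (diff (grp g)) (fun a => nablaG h g s (a 0 • m)) γ) := by
  classical
  set c := ContinuousAlternatingMap.constOfIsEmpty ℝ (EuclideanSpace ℝ (Fin n)) (Fin 0) (N := ℂ)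
    with hc
  have c_smul : ∀ (z w : ℂ), z • c w = c (z * w) := fun z w => by ext; rfl
  have c_sub : ∀ (z w : ℂ), c z - c w = c (z - w) := fun z w => by ext; rfl
  have c_zero : c 0 = 0 := by ext; rfl
  have lhs : mul rfl (fun γ' : Fin 1 → Γ => c (s (γ' 0 • m))) (connForm h m) γ =
      (if γ 1 = 1 then c (s (γ 0 • m)) else 0) -
        (h (γ 1 • m) : ℂ) • c (s ((γ 0 * γ 1) • m)) := by
    have hs : HasSum (fun u : Γ =>
        (if u = γ 0 then (if γ 1 = 1 then c (s (γ 0 • m)) else 0) else 0) -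
        if u = γ 0 * γ 1 then (h (γ 1 • m) : ℂ) • c (s ((γ 0 * γ 1) • m)) else 0)
        ((if γ 1 = 1 then c (s (γ 0 • m)) else 0) -
          (h (γ 1 • m) : ℂ) • c (s ((γ 0 * γ 1) • m))) :=
      (hasSum_ite_eq _ _).sub (hasSum_ite_eq _ _)
    refine Eq.trans ?_ hs.tsum_eq
    rw [mul]
    refine tsum_congr fun u => ?_
    rw [connForm_apply h hh]
    have e1 : (u⁻¹ * γ 0 = 1) ↔ u = γ 0 := inv_mul_eq_one
    have e2 : (u⁻¹ * γ 0 * γ 1 = 1) ↔ u = γ 0 * γ 1 := by rw [mul_assoc]; exact inv_mul_eq_one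
    have f1 : (⟨0 + ((1 : Fin 2) : ℕ), by decide⟩ : Fin 2) = 1 := rfl
    have f0 : (⟨0, by decide⟩ : Fin 2) = 0 := rfl
    simp only [f1, f0, if_true, one_ne_zero, if_false, e1, e2]
    have l0 : ((0 : Fin 1) = Fin.last 0) := rfl
    simp only [← l0, if_true]
    rw [c_smul, c_smul, sub_mul, ← c_sub]
    congr 1
    · by_cases a : u = γ 0 <;> by_cases b : γ 1 = 1 <;> simp [a, b, c_zero]
    · by_cases a : u = γ 0 * γ 1 <;> simp [a, c_zero]
  have rhs : ∀ g : Γ,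
      mul (add_zero 1) (diff (grp g)) (fun a => nablaG h g s (a 0 • m)) γ =
      (h (g⁻¹ • γ 1 • m) : ℂ) * (if γ 0 = 1 then s (γ 1 • m) else 0) -
        if g = γ 0 then (h (γ 1 • m) : ℂ) * s ((γ 0 * γ 1) • m) else 0 := by
    intro g
    have hs : HasSum (fun u : Γ =>
        (if u = g then (h (g⁻¹ • γ 1 • m) : ℂ) * (if γ 0 = 1 then s (γ 1 • m) else 0) else 0) -
        if u = 1 then (if g = γ 0 then (h (γ 1 • m) : ℂ) * s ((γ 0 * γ 1) • m) else 0) else 0)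
        ((h (g⁻¹ • γ 1 • m) : ℂ) * (if γ 0 = 1 then s (γ 1 • m) else 0) -
        if g = γ 0 then (h (γ 1 • m) : ℂ) * s ((γ 0 * γ 1) • m) else 0) :=
      (hasSum_ite_eq _ _).sub (hasSum_ite_eq _ _)
    refine Eq.trans ?_ hs.tsum_eq
    rw [mul]
    refine tsum_congr fun u => ?_
    rw [diff_zero_apply]
    have l0 : ¬ ((0 : Fin 2) = Fin.last 1) := by decide
    have l1 : ((1 : Fin 2) = Fin.last 1) := rfl
    have f1 : (⟨1, by decide⟩ : Fin 2) = 1 := rfl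
    have f0 : (⟨((0 : Fin 2) : ℕ), by decide⟩ : Fin 2) = 0 := rfl
    simp only [← l1, if_true, f1, grp, nablaG, smul_eq_mul, mul_sub]
    simp only [l1, l0, if_false, f0]
    congr 1
    · by_cases a : u = g <;> by_cases b : γ 0 = 1 <;> simp [a, b, mul_smul]
    · by_cases a : u = 1 <;> by_cases b : g = γ 0 <;> simp [a, b, mul_smul, eq_comm]
  have rsum : (∑' g : Γ, mul (add_zero 1) (diff (grp g)) (fun a => nablaG h g s (a 0 • m)) γ) =
      (if γ 0 = 1 then s (γ 1 • m) else 0) - (h (γ 1 • m) : ℂ) * s ((γ 0 * γ 1) • m) := by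
    have h1 : HasSum (fun g : Γ => (h (g⁻¹ • γ 1 • m) : ℂ)) 1 :=
      (Equiv.inv Γ).hasSum_iff.2 (hasSum_translates h hh (γ 1 • m))
    have h2 := (h1.mul_right (if γ 0 = 1 then s (γ 1 • m) else 0)).sub
      (hasSum_ite_eq (γ 0) ((h (γ 1 • m) : ℂ) * s ((γ 0 * γ 1) • m)))
    rw [one_mul] at h2
    rw [← h2.tsum_eq]
    exact tsum_congr rhs
  rw [rsum]
  change diff (fun γ' : Fin 1 → Γ => c (s (γ' 0 • m))) γ + (-1 : ℂ) ^ 0 •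
    mul rfl (fun γ' : Fin 1 → Γ => c (s (γ' 0 • m))) (connForm h m) γ = _
  rw [lhs, diff_zero_apply, pow_zero, one_smul, c_smul, ← c_sub]
  rw [sub_add_sub_cancel]
  by_cases a : γ 0 = 1 <;> simp [a, c_zero]

end Check

/-! ### Singular cohomology and integration of forms -/

section Singular

/-- The standard simplex with `k + 1` vertices. -/
abbrev Simplex (k : ℕ) := stdSimplex ℝ (Fin (k + 1))

def vertex {k : ℕ} (i : Fin (k + 1)) : Simplex k := ⟨Pi.single i 1, single_mem_stdSimplex ℝ i⟩

/-- The inclusion of the `i`-th face. -/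
def face {k : ℕ} (i : Fin (k + 2)) : Simplex k → Simplex (k + 1) := stdSimplex.map i.succAbove

def coboundary {X : Type*} {k : ℕ} (β : (Simplex k → X) → ℂ) (σ : Simplex (k + 1) → X) : ℂ :=
  ∑ i : Fin (k + 2), (-1 : ℂ) ^ (i : ℕ) * β (σ ∘ face i)

variable {n : ℕ} {M : Type*} [TopologicalSpace M] [ChartedSpace (EuclideanSpace ℝ (Fin n)) M]

/-- Smooth singular simplices: those which extend smoothly to a neighbourhood of the simplex. -/
def IsSmoothSimplex (n : ℕ) [ChartedSpace (EuclideanSpace ℝ (Fin n)) M] {k : ℕ}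
    (σ : Simplex k → M) : Prop :=
  ∃ (U : Set (Fin (k + 1) → ℝ)) (F : (Fin (k + 1) → ℝ) → M), IsOpen U ∧
    stdSimplex ℝ (Fin (k + 1)) ⊆ U ∧ ContMDiffOn 𝓘(ℝ, Fin (k + 1) → ℝ) (𝓡 n) ∞ F U ∧
    ∀ t : Simplex k, F t = σ t

/-- Two cochains restrict to the same class in the smooth singular cohomology
`H^k(M; ℂ)`: on smooth simplices they differ by a coboundary (for `k = 0`, not at all). -/
def SameClass (n : ℕ) [ChartedSpace (EuclideanSpace ℝ (Fin n)) M] :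
    ∀ {k : ℕ}, ((Simplex k → M) → ℂ) → ((Simplex k → M) → ℂ) → Prop
  | 0, a, b => ∀ σ, IsSmoothSimplex n σ → a σ = b σ
  | _ + 1, a, b => ∃ β, ∀ σ, IsSmoothSimplex n σ → a σ - b σ = coboundary β σ

/-- The simplex `σ` in the coordinates `t₁, …, t_k` (barycentric coordinates other than the first),
with a junk value outside the simplex. -/
def simplexCoord {k : ℕ} (σ : Simplex k → M) (t : Fin k → ℝ) : M :=
  open Classical in
  if h : (Fin.cons (1 - ∑ i, t i) t : Fin (k + 1) → ℝ) ∈ stdSimplex ℝ (Fin (k + 1)) then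
    σ ⟨_, h⟩ else σ (vertex 0)

/-- The integral of a `k`-form over a smooth singular simplex. -/
def integrate {k : ℕ} (α : DForm n M k) (σ : Simplex k → M) : ℂ :=
  ∫ t in {t : Fin k → ℝ | (∀ i, 0 ≤ t i) ∧ ∑ i, t i ≤ 1},
    α (simplexCoord σ t) (fun i =>
      mfderiv 𝓘(ℝ, Fin k → ℝ) (𝓡 n) (simplexCoord σ) t (Pi.single i (1 : ℝ) : Fin k → ℝ))

/-- The singular cocycle on `B` which represents the image of `[τ]` under
`H^k(Γ; ℂ) ≅ H^k(B; ℂ)`, for a normal covering `p : E → B` with group `Γ` and contractible total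
space and for a map `φ : E → Γ` with `φ (g e) = φ(e) g⁻¹`: its value on `p ∘ σ'` is
`τ(φ(σ'(v₀)), …, φ(σ'(v_k)))`, where the `v_i` are the vertices of the simplex. -/
def groupCochain {Γ E B : Type*} [TopologicalSpace E] (p : E → B) (φ : E → Γ) {k : ℕ}
    (τ : Chain Γ ℂ k) (σ : Simplex k → B) : ℂ :=
  open Classical in
  if h : ∃ σ' : Simplex k → E, Continuous σ' ∧ p ∘ σ' = σ then
    τ (fun i => φ (h.choose (vertex i)))
  else 0

end Singular

end NCChern

open NCChern

open scoped Topology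

namespace NCChern

set_option linter.unusedSectionVars false

/-! ### Word length -/

section WordLength

variable {Γ : Type*} [Group Γ] {S : Finset Γ}

/-! Everything becomes simplicial in the coordinates yᵢ = γᵢ ⋯ γ_q, the suffix products. Multiplying
two neighbouring factors is summing over one coordinate yᵢ with i ≥ 1 (`isForm_iff`), and Z_τ is
τ(y₀ g, …, y_k g), supported where y₀ = g x g⁻¹ (`cyclicCocycle_eq`).

Z_τ passes to the quotient because the two products in a graded commutator of w and v, with suffix
products A and B, are two faces of the one tuple (1, B₀, A₁B₀, …, A_pB₀, B₁, …, B_q) g. Every other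
face forgets an entry over which w or v sums to zero, so the cocycle identity of τ, summed over A
and B, kills the commutator (`hasSum_commutator`). Exponential growth against rapid decay makes all
sums converge absolutely and the functional continuous, so it also vanishes on the closure
(`descends_cyclicCocycle`).

Write h_g = L_g^* h. In suffix coordinates ∇^{0,1} repeats an entry or appends an entry g with
weight h_g (`suffixConn_eq`). Its square with ∇^{1,0} appends either one entry g with weight dh_g,
or two entries u, z with weight h_z (δ_{uz} - h_u) (`suffixNabla_suffixNabla`). The frame is the
group element 1, so every nonzero coefficient of every power has y₀ = 1, that is, total product 1.
Hence the pairing vanishes pointwise when x ≠ e (`evalCochain_of_ne_one`). When x = e, skew-symmetry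
of τ kills the second kind of term (`sum_mul_curvH`), only bidegree (k, k) and the k-th term of the
exponential survive, and on M' the pairing is (-1)^k / k! times the sum of τ(1, y₁, …, y_k) dh_{y_k}
∧ ⋯ ∧ dh_{y₁} (`evalCochain_one_self`). This form is closed, and it is invariant because ∑ dh_g = 0
makes the first entry of τ irrelevant (`dhSum_cons`); so it descends to M (`exists_pairing_form`).

The class is found by a Čech–de Rham zigzag on smooth simplices of M'. An equivariant map Φ : M' → Γ
labels vertices. For a + b = k one integrates the sum of τ(g₀, …, g_a, y₁, …, y_b) dh_y over the
face spanned by the last b + 1 vertices, the gᵢ being the labels of the first a + 1. For a = 0 this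
is the integral of the form, for b = 0 it is the value of the group cocycle at the labels. Passing
from (a, b + 1) to (a + 1, b) changes it by a sign and an invariant coboundary: Stokes' theorem for
the primitive with one factor h in place of dh, together with the cocycle identity
(`dhIntegral_eq`). Smooth simplices of M lift to M', and invariant cochains come from M, which gives
`sameClass_groupCochain`. -/

theorem exists_list_wordLength (hS : Subgroup.closure (S : Set Γ) = ⊤) (g : Γ) :
    ∃ l : List Γ, l.length = wordLength (S : Set Γ) g ∧
      (∀ a ∈ l, a ∈ (S : Set Γ) ∨ a⁻¹ ∈ (S : Set Γ)) ∧ l.prod = g := by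
  have hg : g ∈ Subgroup.closure (S : Set Γ) := by rw [hS]; trivial
  rw [← Subgroup.mem_toSubmonoid, Subgroup.closure_toSubmonoid] at hg
  obtain ⟨l, hl, hp⟩ := Submonoid.exists_list_of_mem_closure hg
  exact Nat.sInf_mem (s := {n | ∃ l : List Γ, l.length = n ∧
    (∀ a ∈ l, a ∈ (S : Set Γ) ∨ a⁻¹ ∈ (S : Set Γ)) ∧ l.prod = g}) ⟨_, l, rfl, hl, hp⟩

theorem wordLength_le {g : Γ} (l : List Γ)
    (hl : ∀ a ∈ l, a ∈ (S : Set Γ) ∨ a⁻¹ ∈ (S : Set Γ)) (hp : l.prod = g) :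
    wordLength (S : Set Γ) g ≤ l.length :=
  Nat.sInf_le ⟨l, rfl, hl, hp⟩

theorem wordLength_mul_le (hS : Subgroup.closure (S : Set Γ) = ⊤) (g h : Γ) :
    wordLength (S : Set Γ) (g * h) ≤ wordLength (S : Set Γ) g + wordLength (S : Set Γ) h := by
  obtain ⟨l, h1, h2, h3⟩ := exists_list_wordLength hS g
  obtain ⟨l', h1', h2', h3'⟩ := exists_list_wordLength hS h
  rw [← h1, ← h1', ← List.length_append]
  refine wordLength_le _ (fun a ha => ?_) (by rw [List.prod_append, h3, h3'])
  rcases List.mem_append.1 ha with ha | ha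
  exacts [h2 a ha, h2' a ha]

theorem wordLength_inv_le (hS : Subgroup.closure (S : Set Γ) = ⊤) (g : Γ) :
    wordLength (S : Set Γ) g⁻¹ ≤ wordLength (S : Set Γ) g := by
  obtain ⟨l, h1, h2, h3⟩ := exists_list_wordLength hS g
  have := wordLength_le (S := S) (g := g⁻¹) (l.map fun a => a⁻¹).reverse (fun a ha => ?_)
    (by rw [← h3, List.prod_inv_reverse])
  · simpa [h1] using this
  · rw [List.mem_reverse, List.mem_map] at ha
    obtain ⟨b, hb, rfl⟩ := ha
    rw [inv_inv]
    exact (h2 b hb).symm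

theorem wordLength_one : wordLength (S : Set Γ) (1 : Γ) = 0 :=
  Nat.le_zero.1 (wordLength_le (S := S) [] (by simp) rfl)

/-- There are (card α)^n words of length n, so summing over the fibres of the length leaves a
geometric series. -/
theorem summable_pow_length {α : Type*} [Fintype α] {x : ℝ} (hx : 0 ≤ x)
    (hx' : Fintype.card α * x < 1) : Summable fun l : List α => x ^ l.length := by
  rw [← (Equiv.sigmaFiberEquiv (List.length (α := α))).summable_iff]
  refine (summable_sigma_of_nonneg (fun _ => pow_nonneg hx _)).2 ?_
  have hc : ∀ n : ℕ, (fun y : {l : List α // l.length = n} =>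
      ((fun l : List α => x ^ l.length) ∘ (Equiv.sigmaFiberEquiv (List.length (α := α))))
        ⟨n, y⟩) = fun _ => x ^ n := fun n => funext fun y => by
    simp [Equiv.sigmaFiberEquiv, y.2]
  constructor
  · intro n
    have : Fintype {l : List α // l.length = n} := inferInstanceAs (Fintype (List.Vector α n))
    exact Summable.of_finite
  · have : ∀ n : ℕ, (∑' y : {l : List α // l.length = n},
        ((fun l : List α => x ^ l.length) ∘ (Equiv.sigmaFiberEquiv (List.length (α := α))))
        ⟨n, y⟩) = (Fintype.card α * x) ^ n := by
      intro n
      rw [hc n]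
      have : Fintype {l : List α // l.length = n} := inferInstanceAs (Fintype (List.Vector α n))
      have e : Fintype.card {l : List α // l.length = n} = Fintype.card α ^ n := by
        rw [← card_vector]; exact Fintype.card_congr (Equiv.refl _)
      rw [tsum_fintype, Finset.sum_const, Finset.card_univ, e, nsmul_eq_mul, mul_pow]
      push_cast
      rfl
    refine Summable.congr ?_ fun n => (this n).symm
    exact summable_geometric_of_lt_one (by positivity) hx'

/-- Choosing a shortest word for each g is injective, so the series is a part of the series over all
words in the letters S ∪ S⁻¹. -/
theorem exists_summable_exp_wordLength (hS : Subgroup.closure (S : Set Γ) = ⊤) :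
    ∃ R : ℝ, 0 ≤ R ∧ ∀ r, R ≤ r →
      Summable fun g : Γ => Real.exp (-(r * (wordLength (S : Set Γ) g : ℝ))) := by
  classical
  let α := {a : Γ // a ∈ S ∪ S.image fun a => a⁻¹}
  -- For such r, exp r ≥ r + 1 exceeds the number of letters, which makes the ratio of the geometric
  -- series less than 1.
  refine ⟨Fintype.card α + 1, by positivity, fun r hr => ?_⟩
  choose l h1 h2 h3 using exists_list_wordLength hS
  have hm : ∀ g, ∀ a ∈ l g, a ∈ S ∪ S.image fun a => a⁻¹ := fun g a ha => by
    rcases h2 g a ha with h | h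
    · exact Finset.mem_union_left _ h
    · exact Finset.mem_union_right _ (Finset.mem_image.2 ⟨a⁻¹, h, inv_inv a⟩)
  let L : Γ → List α := fun g => (l g).attachWith _ (hm g)
  have hL : Function.Injective L := fun g g' hgg => by
    have : (L g).map Subtype.val = (L g').map Subtype.val := by rw [hgg]
    simp only [L, List.attachWith_map_subtype_val] at this
    rw [← h3 g, ← h3 g', this]
  have hx : Fintype.card α * Real.exp (-r) < 1 := by
    rw [Real.exp_neg, ← div_eq_mul_inv, div_lt_one (Real.exp_pos _)]
    have := Real.add_one_le_exp r
    linarith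
  have := (summable_pow_length (α := α) (Real.exp_nonneg (-r)) hx).comp_injective hL
  refine this.congr fun g => ?_
  have hl : (L g).length = wordLength (S : Set Γ) g :=
    List.length_attachWith.trans (h1 g)
  simp only [Function.comp, hl, ← Real.exp_nat_mul]
  congr 1
  ring

theorem exp_sum_summable {ι : Type*} {f : ι → ℝ} (hf : Summable f) (h0 : 0 ≤ f) :
    ∀ q : ℕ, Summable fun γ : Fin q → ι => ∏ i, f (γ i)
  | 0 => Summable.of_finite
  | q + 1 => by
    rw [← (Fin.consEquiv fun _ : Fin (q + 1) => ι).summable_iff]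
    have := hf.mul_of_nonneg (exp_sum_summable hf h0 q) h0
      (fun γ => Finset.prod_nonneg fun i _ => h0 _)
    refine this.congr fun x => ?_
    simp [Fin.prod_univ_succ, Fin.consEquiv]

theorem exists_summable_exp_totalLength (hS : Subgroup.closure (S : Set Γ) = ⊤) :
    ∃ R : ℝ, 0 ≤ R ∧ ∀ r, R ≤ r → ∀ q : ℕ,
      Summable fun γ : Fin (q + 1) → Γ => Real.exp (-(r * totalLength (S : Set Γ) γ)) := by
  obtain ⟨R, h0, hR⟩ := exists_summable_exp_wordLength hS
  refine ⟨R, h0, fun r hr q => (exp_sum_summable (hR r hr) (fun _ => Real.exp_nonneg _)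
    (q + 1)).congr fun γ => ?_⟩
  rw [← Real.exp_sum, totalLength, Finset.mul_sum, Finset.sum_neg_distrib]

end WordLength

/-! ### Suffix products as coordinates -/

section Suffix

variable {Γ : Type*} [Group Γ]

/-- The tuple `(γ₀, …, γ_q)` with the given suffix products `yᵢ = γᵢ ⋯ γ_q`. -/
def fromY {q : ℕ} (y : Fin (q + 1) → Γ) : Fin (q + 1) → Γ := fun i =>
  y i * if h : (i : ℕ) + 1 < q + 1 then (y ⟨i + 1, h⟩)⁻¹ else 1

/-- The suffix products `γᵢ ⋯ γ_q`. -/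
def toY {q : ℕ} (γ : Fin (q + 1) → Γ) : Fin (q + 1) → Γ := fun i =>
  ((List.ofFn γ).drop i).prod

theorem fromY_castSucc {q : ℕ} (y : Fin (q + 1) → Γ) (i : Fin q) :
    fromY y i.castSucc = y i.castSucc * (y i.succ)⁻¹ := by
  have : ((i.castSucc : Fin (q + 1)) : ℕ) + 1 < q + 1 := by simp
  simp only [fromY, dif_pos this]; rfl

theorem fromY_last {q : ℕ} (y : Fin (q + 1) → Γ) : fromY y (Fin.last q) = y (Fin.last q) := by
  simp [fromY]

theorem toY_eq {q : ℕ} (γ : Fin (q + 1) → Γ) (i : Fin (q + 1)) :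
    toY γ i = γ i * if h : (i : ℕ) + 1 < q + 1 then toY γ ⟨i + 1, h⟩ else 1 := by
  have hi : (i : ℕ) < (List.ofFn γ).length := by rw [List.length_ofFn]; exact i.2
  rw [toY, List.drop_eq_getElem_cons hi, List.prod_cons]
  congr 1
  · rw [List.getElem_ofFn]
  · split_ifs with h
    · rfl
    · rw [List.drop_eq_nil_of_le (by rw [List.length_ofFn]; omega), List.prod_nil]

theorem fromY_toY {q : ℕ} (γ : Fin (q + 1) → Γ) : fromY (toY γ) = γ := by
  funext i
  rw [fromY, toY_eq γ i]
  split_ifs <;> simp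

theorem fromY_injective {q : ℕ} : Function.Injective (fromY (Γ := Γ) (q := q)) := by
  intro y y' h
  funext i
  induction i using Fin.reverseInduction with
  | last => simpa [fromY_last] using congrFun h (Fin.last q)
  | cast i ih =>
    have := congrFun h i.castSucc
    rw [fromY_castSucc, fromY_castSucc, ih] at this
    exact mul_right_cancel this

theorem toY_fromY {q : ℕ} (y : Fin (q + 1) → Γ) : toY (fromY y) = y :=
  fromY_injective (fromY_toY _)

/-- Tuples and their suffix products. -/
def suffixEquiv (Γ : Type*) [Group Γ] (q : ℕ) : (Fin (q + 1) → Γ) ≃ (Fin (q + 1) → Γ) where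
  toFun := fromY
  invFun := toY
  left_inv := toY_fromY
  right_inv := fromY_toY

/-- Moving u across the i-th tensor sign changes only the suffix product that starts at the next
factor; the products starting further left contain u u⁻¹. -/
theorem fromY_update {q : ℕ} (y : Fin (q + 1) → Γ) (i : Fin q) (u : Γ) :
    fromY (Function.update y i.succ (u⁻¹ * y i.succ)) =
      Function.update (Function.update (fromY y) i.castSucc (fromY y i.castSucc * u))
        i.succ (u⁻¹ * fromY y i.succ) := by
  funext j
  by_cases h1 : j = i.succ
  · subst h1
    simp only [Function.update_self, fromY, mul_assoc]
    congr 2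
    split_ifs with h
    · rw [Function.update_of_ne]
      simp [Fin.ext_iff]
    · rfl
  · rw [Function.update_of_ne h1]
    by_cases h2 : j = i.castSucc
    · subst h2
      rw [Function.update_self, fromY_castSucc, fromY_castSucc, Function.update_self,
        Function.update_of_ne h1]
      group
    · rw [Function.update_of_ne h2]
      simp only [fromY]
      rw [Function.update_of_ne h1]
      congr 2
      funext h
      rw [Function.update_of_ne]
      intro hh
      apply h2
      simp [Fin.ext_iff] at hh ⊢
      omega

/-- By `fromY_update` and the substitution u ↦ u⁻¹ yᵢ₊₁, multiplying neighbours is summation over a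
single coordinate. The coordinate y₀, the total product, is never summed over. -/
theorem isForm_iff {S : Set Γ} {q : ℕ} {w : Chain Γ ℂ q} :
    IsForm S w ↔ RapidDecay S w ∧ ∀ (i : Fin q) (y : Fin (q + 1) → Γ),
      ∑' u : Γ, w (fromY (Function.update y i.succ u)) = 0 := by
  have key : ∀ (i : Fin q) (y : Fin (q + 1) → Γ),
      ∑' u : Γ, w (Function.update (Function.update (fromY y) i.castSucc (fromY y i.castSucc * u))
        i.succ (u⁻¹ * fromY y i.succ)) = ∑' u : Γ, w (fromY (Function.update y i.succ u)) := by
    intro i y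
    simp only [← fromY_update]
    exact ((Equiv.inv Γ).trans (Equiv.mulRight (y i.succ))).tsum_eq
      (fun u => w (fromY (Function.update y i.succ u)))
  refine and_congr_right fun _ => ⟨fun h i y => ?_, fun h i γ => ?_⟩
  · rw [← key]; exact h i _
  · rw [← fromY_toY γ, key]; exact h i _

theorem toY_zero {q : ℕ} (γ : Fin (q + 1) → Γ) : toY γ 0 = (List.ofFn γ).prod := rfl

/-- Two conjugators differ by an element of the centralizer of x, on the right, and τ is invariant
under it; so the choice made in the definition does not matter. -/
theorem cyclicCocycle_eq {x : Γ} {k : ℕ} {τ : Chain Γ ℂ k} (hτ : IsCocycle x τ)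
    {γ : Fin (k + 1) → Γ} {g : Γ} (hg : toY γ 0 = g * x * g⁻¹) :
    cyclicCocycle x τ γ = τ (fun i => toY γ i * g) := by
  have h : ∃ g : Γ, (List.ofFn γ).prod = g * x * g⁻¹ := ⟨g, hg⟩
  rw [cyclicCocycle, dif_pos h]
  have hc := h.choose_spec
  set g' := h.choose
  rw [← toY_zero, hg] at hc
  have hz : (g⁻¹ * g') * x = x * (g⁻¹ * g') := by
    calc (g⁻¹ * g') * x = g⁻¹ * (g' * x * g'⁻¹) * g' := by group
      _ = g⁻¹ * (g * x * g⁻¹) * g' := by rw [hc]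
      _ = _ := by group
  rw [← hτ.right_invariant _ hz (fun i => toY γ i * g)]
  congr 1
  funext i
  simp only [toY]
  group

theorem cyclicCocycle_eq_zero {x : Γ} {k : ℕ} {τ : Chain Γ ℂ k} {γ : Fin (k + 1) → Γ}
    (h : ¬ ∃ g : Γ, toY γ 0 = g * x * g⁻¹) : cyclicCocycle x τ γ = 0 :=
  dif_neg h

end Suffix

/-! ### The functional of a cyclic cocycle on the quotient by commutators -/

section Descent

variable {Γ : Type*} [Group Γ]

/-- The concatenation of two tuples in which the last entry of the first is multiplied with the
first entry of the second. -/
def joinTuple {p q k : ℕ} (h : p + q = k) (a : Fin (p + 1) → Γ) (b : Fin (q + 1) → Γ) :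
    Fin (k + 1) → Γ := fun i =>
  if hi : (i : ℕ) < p then a ⟨i, by omega⟩
  else if (i : ℕ) = p then a (Fin.last p) * b 0
  else b ⟨i - p, by have := i.2; omega⟩

/-- The suffix products of `joinTuple` in terms of those of the two tuples. -/
def joinSuffix {p q k : ℕ} (h : p + q = k) (A : Fin (p + 1) → Γ) (B : Fin (q + 1) → Γ) :
    Fin (k + 1) → Γ := fun i =>
  if hi : (i : ℕ) ≤ p then A ⟨i, by omega⟩ * B 0 else B ⟨i - p, by have := i.2; omega⟩

/-- A suffix that starts in the first tuple runs through all of the second, which contributes the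
factor `B 0`. -/
theorem fromY_joinSuffix {p q k : ℕ} (h : p + q = k) (A : Fin (p + 1) → Γ)
    (B : Fin (q + 1) → Γ) :
    fromY (joinSuffix h A B) = joinTuple h (fromY A) (fromY B) := by
  subst h
  funext i
  obtain ⟨i, hi⟩ := i
  rcases lt_trichotomy i p with h1 | h1 | h1
  · have e1 : i + 1 < p + q + 1 := by omega
    have e2 : i + 1 < p + 1 := by omega
    have e3 : i + 1 ≤ p := by omega
    simp only [fromY, joinSuffix, joinTuple, dif_pos e1, dif_pos e2, dif_pos h1.le, dif_pos e3,
      dif_pos h1]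
    group
  · subst h1
    have e3 : ¬ (i + 1 ≤ i) := by omega
    have e4 : ¬ (i < i) := by omega
    have e5 : i + 1 - i = 1 := by omega
    have e6 : ¬ (i + 1 < i + 1) := by omega
    simp only [fromY, joinSuffix, joinTuple, dif_pos le_rfl, dif_neg e3, dif_neg e4, e5,
      if_true, Fin.val_last, dif_neg e6, mul_one, mul_assoc]
    congr 2
    by_cases hq : 0 < q
    · rw [dif_pos (by omega)]
      have hq' : ((0 : Fin (q + 1)) : ℕ) + 1 < q + 1 := by simpa using hq
      rw [dif_pos hq']
      rfl
    · rw [dif_neg (by omega)]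
      have hq' : ¬ ((0 : Fin (q + 1)) : ℕ) + 1 < q + 1 := by simpa using hq
      rw [dif_neg hq']
  · have e1 : ¬ i ≤ p := by omega
    have e2 : ¬ i < p := by omega
    have e3 : ¬ i = p := by omega
    have e4 : ¬ i + 1 ≤ p := by omega
    simp only [fromY, joinSuffix, joinTuple, dif_neg e1, dif_neg e2, if_neg e3, dif_neg e4]
    congr 1
    by_cases hq : i + 1 < p + q + 1
    · rw [dif_pos hq, dif_pos (by omega)]
      congr 3
      omega
    · rw [dif_neg hq, dif_neg (by omega)]

/-- The change of variables in the sum which defines the product of two forms. -/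
def joinEquiv (Γ : Type*) [Group Γ] {p q k : ℕ} (h : p + q = k) :
    (Fin (p + 1) → Γ) × (Fin (q + 1) → Γ) ≃ (Fin (k + 1) → Γ) × Γ where
  toFun ab := (joinTuple h ab.1 ab.2, ab.1 (Fin.last p))
  invFun γu :=
    (fun i => if i = Fin.last p then γu.2 else γu.1 ⟨i, by have := i.2; omega⟩,
     fun j => if j = 0 then γu.2⁻¹ * γu.1 ⟨p, by omega⟩
      else γu.1 ⟨p + j, by have := j.2; omega⟩)
  left_inv := by
    rintro ⟨a, b⟩
    refine Prod.ext (funext fun i => ?_) (funext fun j => ?_)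
    · by_cases hi : i = Fin.last p
      · simp [hi]
      · have : (i : ℕ) < p := by
          have := i.2
          have : (i : ℕ) ≠ p := fun hh => hi (Fin.ext hh)
          omega
        simp [hi, joinTuple, this]
    · by_cases hj : j = 0
      · simp [hj, joinTuple]
      · have : (j : ℕ) ≠ 0 := fun hh => hj (Fin.ext hh)
        simp [hj, joinTuple, this]
  right_inv := by
    rintro ⟨γ, u⟩
    refine Prod.ext (funext fun i => ?_) (by simp)
    obtain ⟨i, hi⟩ := i
    rcases lt_trichotomy i p with h1 | h1 | h1
    · have : (⟨i, by omega⟩ : Fin (p + 1)) ≠ Fin.last p := by simp [Fin.ext_iff]; omega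
      simp [joinTuple, h1, this]
    · subst h1
      simp [joinTuple]
    · have e1 : ¬ i < p := by omega
      have e2 : ¬ i = p := by omega
      have e3 : (⟨i - p, by omega⟩ : Fin (q + 1)) ≠ 0 := by simp [Fin.ext_iff]; omega
      have e4 : p + (i - p) = i := by omega
      simp [joinTuple, e1, e2, e3, e4]

/-- The outer variable γ and the convolution variable u together are the same data as a pair of
tuples (`joinEquiv`), so the double sum is reindexed and then summed fibrewise. -/
theorem hasSum_mul {p q k : ℕ} (h : p + q = k) (c : Chain Γ ℂ k) (w : Chain Γ ℂ p)
    (v : Chain Γ ℂ q)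
    (hs : Summable fun AB : (Fin (p + 1) → Γ) × (Fin (q + 1) → Γ) =>
      c (fromY (joinSuffix h AB.1 AB.2)) * (w (fromY AB.1) * v (fromY AB.2))) :
    HasSum (fun γ => c γ * mul h w v γ)
      (∑' AB : (Fin (p + 1) → Γ) × (Fin (q + 1) → Γ),
        c (fromY (joinSuffix h AB.1 AB.2)) * (w (fromY AB.1) * v (fromY AB.2))) := by
  let F : (Fin (k + 1) → Γ) × Γ → ℂ := fun γu =>
    c γu.1 * (v ((joinEquiv Γ h).symm γu).2 • w ((joinEquiv Γ h).symm γu).1)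
  let e := ((suffixEquiv Γ p).prodCongr (suffixEquiv Γ q)).trans (joinEquiv Γ h)
  have hF : (F ∘ e) = fun AB : (Fin (p + 1) → Γ) × (Fin (q + 1) → Γ) =>
      c (fromY (joinSuffix h AB.1 AB.2)) * (w (fromY AB.1) * v (fromY AB.2)) := by
    funext AB
    simp only [Function.comp, F, e, Equiv.trans_apply, Equiv.symm_apply_apply]
    rw [fromY_joinSuffix, smul_eq_mul, mul_comm (w _)]
    rfl
  rw [← hF] at hs ⊢
  have hsum : HasSum F (∑' AB, (F ∘ e) AB) := e.hasSum_iff.1 hs.hasSum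
  refine hsum.prod_fiberwise fun γ => ?_
  have h1 := hsum.summable.prod_factor γ
  -- Summability of the convolution series is known only after multiplication by `c γ`, so it can be
  -- inferred only where `c γ` is nonzero.
  by_cases hc : c γ = 0
  · simp only [F, hc, zero_mul]; exact hasSum_zero
  · have h2 : Summable fun u => v ((joinEquiv Γ h).symm (γ, u)).2 •
        w ((joinEquiv Γ h).symm (γ, u)).1 := (summable_mul_left_iff hc).1 h1
    exact h2.hasSum.mul_left (c γ)

theorem tsum_eq_zero_of_slice {ι : Type*} {n : ℕ} {f : (Fin (n + 1) → ι) → ℂ} (i : Fin (n + 1))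
    (hf : Summable f) (h : ∀ y, ∑' u, f (Function.update y i u) = 0) : ∑' y, f y = 0 := by
  let e := Fin.insertNthEquiv (fun _ : Fin (n + 1) => ι) i
  rw [← e.tsum_eq, ← (Equiv.prodComm _ _).tsum_eq]
  have hs : Summable fun c : (Fin n → ι) × ι => f (e (Equiv.prodComm _ _ c)) :=
    (Equiv.prodComm _ _).summable_iff.2 (e.summable_iff.2 hf)
  have := hs.tsum_prod' (fun b => hs.prod_factor b)
  refine this.trans ?_
  simp only [Equiv.prodComm_apply, Prod.swap_prod_mk]
  refine (tsum_congr fun b => ?_).trans tsum_zero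
  by_cases hι : Nonempty ι
  · obtain ⟨u₀⟩ := hι
    rw [← h (e (u₀, b))]
    refine tsum_congr fun u => ?_
    congr 1
    simp [e, Fin.insertNthEquiv]
  · have : IsEmpty ι := not_nonempty_iff.1 hι
    exact tsum_empty

variable {x : Γ} {k : ℕ} {τ : Chain Γ ℂ k}

theorem IsCocycle.update_mul (hτ : IsCocycle x τ) (γ : Fin (k + 1) → Γ) (i : Fin (k + 1)) :
    τ (Function.update γ i (γ i * x)) = τ γ := by
  by_cases hi : i = 0
  · rw [hi]; exact hτ.x_invariant γ
  have h1 := hτ.skew (Equiv.swap 0 i) γ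
  have h2 := hτ.skew (Equiv.swap 0 i) (Function.update γ i (γ i * x))
  have e : Function.update γ i (γ i * x) ∘ Equiv.swap 0 i =
      Function.update (γ ∘ Equiv.swap 0 i) 0 ((γ ∘ Equiv.swap 0 i) 0 * x) := by
    funext j
    by_cases hj : j = 0
    · subst hj; simp
    · rw [Function.update_of_ne hj, Function.comp, Function.comp, Function.update_of_ne]
      intro hh
      apply hj
      rw [← Equiv.swap_apply_left 0 i] at hh
      exact (Equiv.swap 0 i).injective hh
  rw [e, hτ.x_invariant, h1] at h2
  have hs : ((Equiv.Perm.sign (Equiv.swap 0 i) : ℤ) : ℂ) ≠ 0 := by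
    exact_mod_cast Units.ne_zero _
  exact (mul_left_cancel₀ hs h2).symm

theorem IsCocycle.mul_on (hτ : IsCocycle x τ) (γ : Fin (k + 1) → Γ) (s : Finset (Fin (k + 1))) :
    τ (fun i => if i ∈ s then γ i * x else γ i) = τ γ := by
  induction s using Finset.induction_on with
  | empty => simp
  | insert a s ha ih =>
    rw [← ih, ← hτ.update_mul (fun i => if i ∈ s then γ i * x else γ i) a]
    congr 1
    funext i
    by_cases h : i = a
    · subst h; simp [ha]
    · simp [h]

theorem IsCocycle.skew_tail {x : Γ} {k : ℕ} {τ : Chain Γ ℂ (k + 1)} (hτ : IsCocycle x τ)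
    (e : Equiv.Perm (Fin (k + 1))) (c : Γ) (ζ : Fin (k + 1) → Γ) :
    τ (Fin.cons c (ζ ∘ e)) = ((Equiv.Perm.sign e : ℤ) : ℂ) * τ (Fin.cons c ζ) := by
  have hs : Equiv.Perm.sign (Equiv.Perm.decomposeFin.symm (0, e)) = Equiv.Perm.sign e := by simp
  rw [← hs, ← hτ.skew]
  congr 1
  funext i
  refine Fin.cases ?_ (fun i => ?_) i
  · simp
  · simp

theorem finRotate_pow_apply (n p : ℕ) (i : Fin (n + 1)) :
    (((finRotate (n + 1)) ^ p) i : ℕ) = (i + p) % (n + 1) := by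
  induction p with
  | zero => simp [Nat.mod_eq_of_lt i.2]
  | succ p ih =>
    rw [pow_succ', Equiv.Perm.mul_apply, finRotate_apply, Fin.val_add, ih, Fin.val_one',
      ← Nat.add_mod, add_assoc]

/-- Here n p = p q + p (p - 1), and p (p - 1) is even. -/
theorem sign_finRotate_pow (p q : ℕ) (n : ℕ) (h : p + q = n + 1) :
    ((Equiv.Perm.sign ((finRotate (n + 1)) ^ p) : ℤ) : ℂ) = (-1) ^ (p * q) := by
  rw [map_pow, sign_finRotate]
  push_cast
  rw [← pow_mul]
  obtain ⟨m, hm⟩ := Nat.even_mul_pred_self p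
  rcases Nat.eq_zero_or_pos p with rfl | hp
  · simp
  · have : n * p = p * q + (m + m) := by
      rw [← hm]
      obtain ⟨p, rfl⟩ : ∃ p', p = p' + 1 := ⟨p - 1, by omega⟩
      have : n = p + q := by omega
      subst this
      simp
      ring
    rw [this, pow_add, ← two_mul, pow_mul (-1 : ℂ) 2 m]
    simp

/-- The `k + 2` points whose boundary compares the two products of a graded commutator. -/
def commVec {p q k : ℕ} (h : p + q = k) (A : Fin (p + 1) → Γ) (B : Fin (q + 1) → Γ) :
    Fin (k + 2) → Γ := fun i =>
  if (i : ℕ) = 0 then 1 else if (i : ℕ) = 1 then B 0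
  else if hi : (i : ℕ) ≤ p + 1 then A ⟨i - 1, by omega⟩ * B 0
  else B ⟨i - p - 1, by have := i.2; omega⟩

/-- The tuples agree except in the first entry, where A₀B₀ g = g x stands against g; τ does not see
the factor x there. The product w v is thus the face that omits B₀. -/
theorem cyclicCocycle_joinSuffix {p q : ℕ} (h : p + q = k) (hτ : IsCocycle x τ)
    (A : Fin (p + 1) → Γ) (B : Fin (q + 1) → Γ) {g : Γ} (hg : A 0 * B 0 = g * x * g⁻¹) :
    cyclicCocycle x τ (fromY (joinSuffix h A B)) =
      τ (fun i => commVec h A B ((1 : Fin (k + 2)).succAbove i) * g) := by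
  have h0 : joinSuffix h A B 0 = A 0 * B 0 := by simp [joinSuffix]
  rw [cyclicCocycle_eq hτ (g := g) (by rw [toY_fromY, h0, hg]), toY_fromY,
    ← hτ.x_invariant (fun i => commVec h A B ((1 : Fin (k + 2)).succAbove i) * g)]
  congr 1
  funext i
  refine Fin.cases ?_ (fun i => ?_) i
  · simp [h0, hg, commVec]
  · rw [Function.update_of_ne (Fin.succ_ne_zero i)]
    congr 1
    have e : (((1 : Fin (k + 2)).succAbove i.succ : Fin (k + 2)) : ℕ) = i + 2 := by
      rw [Fin.succAbove_of_le_castSucc _ _ (by simp [Fin.le_def])]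
      simp
    simp only [joinSuffix, commVec, e, Fin.val_succ]
    by_cases hi : (i : ℕ) + 1 ≤ p
    · rw [dif_pos hi, if_neg (by omega), if_neg (by omega), dif_pos (by omega)]
      rfl
    · rw [dif_neg hi, if_neg (by omega), if_neg (by omega), dif_neg (by omega)]
      congr 2
      omega

/-- The product v w has total product B₀A₀, with conjugator B₀ g. Its entries BᵢA₀ · B₀ g equal Bᵢ g
x, so x can be dropped from them. What is left is the face omitting 1, with all entries but the
first rotated by p places; the rotation has sign (-1)^(p q). -/
theorem cyclicCocycle_joinSuffix_comm {p q : ℕ} (h : p + q = k) (hτ : IsCocycle x τ)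
    (A : Fin (p + 1) → Γ) (B : Fin (q + 1) → Γ) {g : Γ} (hg : A 0 * B 0 = g * x * g⁻¹) :
    (-1 : ℂ) ^ (p * q) *
      cyclicCocycle x τ (fromY (joinSuffix ((add_comm q p).trans h) B A)) =
      τ (fun i => commVec h A B ((0 : Fin (k + 2)).succAbove i) * g) := by
  have h0 : joinSuffix ((add_comm q p).trans h) B A 0 = B 0 * A 0 := by simp [joinSuffix]
  have hA : A 0 = g * x * g⁻¹ * (B 0)⁻¹ := by rw [← hg]; group
  have hg' : B 0 * A 0 = (B 0 * g) * x * (B 0 * g)⁻¹ := by rw [hA]; group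
  rw [cyclicCocycle_eq hτ (g := B 0 * g) (by rw [toY_fromY, h0, hg']), toY_fromY]
  let δ : Fin (k + 1) → Γ := fun i =>
    if hi : (i : ℕ) ≤ q then B ⟨i, by omega⟩ * g
    else A ⟨i - q, by have := i.2; omega⟩ * B 0 * g
  have e1 : τ (fun i => joinSuffix ((add_comm q p).trans h) B A i * (B 0 * g)) = τ δ := by
    rw [← hτ.mul_on δ (Finset.univ.filter fun i => (i : ℕ) ≤ q)]
    congr 1
    funext i
    simp only [joinSuffix, δ, Finset.mem_filter, Finset.mem_univ, true_and]
    split_ifs with hi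
    · rw [hA]; group
    · group
  rw [e1]
  cases k with
  | zero =>
    obtain rfl : p = 0 := by omega
    obtain rfl : q = 0 := by omega
    simp only [mul_zero, pow_zero, one_mul]
    congr 1
    funext i
    obtain rfl : i = 0 := Fin.ext (by omega)
    simp [δ, commVec]
  | succ n =>
    rw [← sign_finRotate_pow p q n h]
    have e2 : (fun i => commVec h A B ((0 : Fin (n + 1 + 2)).succAbove i) * g) =
        Fin.cons (B 0 * g) fun i : Fin (n + 1) => commVec h A B i.succ.succ * g := by
      funext i
      refine Fin.cases ?_ (fun i => ?_) i
      · simp [commVec]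
      · simp
    have e3 : δ = Fin.cons (B 0 * g) ((fun i : Fin (n + 1) => commVec h A B i.succ.succ * g) ∘
        ((finRotate (n + 1)) ^ p)) := by
      funext i
      refine Fin.cases ?_ (fun i => ?_) i
      · simp [δ]
      · simp only [Fin.cons_succ, Function.comp, δ, commVec, Fin.val_succ, finRotate_pow_apply]
        rw [if_neg (by omega), if_neg (by omega)]
        have hi := i.2
        by_cases hq : (i : ℕ) + 1 ≤ q
        · have e : (i + p) % (n + 1) = i + p := Nat.mod_eq_of_lt (by omega)
          rw [dif_pos hq, dif_neg (by omega)]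
          congr 2
          simp only [Fin.mk.injEq]
          omega
        · have e : (i + p) % (n + 1) = i - q := by
            rw [Nat.mod_eq_sub_mod (by omega), Nat.mod_eq_of_lt (by omega)]
            omega
          rw [dif_neg hq, dif_pos (by omega)]
          congr 3
          simp only [Fin.mk.injEq]
          omega
    rw [e3, hτ.skew_tail, e2, ← mul_assoc]
    have : (((Equiv.Perm.sign ((finRotate (n + 1)) ^ p) : ℤ) : ℂ)) *
        ((Equiv.Perm.sign ((finRotate (n + 1)) ^ p) : ℤ) : ℂ) = 1 := by
      rw [← Int.cast_mul, Int.units_coe_mul_self, Int.cast_one]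
    rw [this, one_mul]

end Descent

section Descent

variable {Γ : Type*} [Group Γ] {S : Finset Γ} {x : Γ} {k : ℕ} {τ : Chain Γ ℂ k}

/-- Exponential growth of the cyclic cocycle of `τ`. -/
def HasExpGrowth (S : Finset Γ) (x : Γ) (τ : Chain Γ ℂ k) : Prop :=
  ∃ C D : ℝ, 0 < C ∧ 0 < D ∧ ∀ γ : Fin (k + 1) → Γ,
    ‖cyclicCocycle x τ γ‖ ≤ C * Real.exp (D * totalLength (S : Set Γ) γ)

theorem wordLength_toY_le (hS : Subgroup.closure (S : Set Γ) = ⊤) {q : ℕ} (γ : Fin (q + 1) → Γ)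
    (i : Fin (q + 1)) : (wordLength (S : Set Γ) (toY γ i) : ℝ) ≤ totalLength (S : Set Γ) γ := by
  have key : ∀ l : List Γ, wordLength (S : Set Γ) l.prod ≤
      (l.map (wordLength (S : Set Γ))).sum := by
    intro l
    induction l with
    | nil => simp [wordLength_one]
    | cons a l ih =>
      rw [List.prod_cons, List.map_cons, List.sum_cons]
      exact (wordLength_mul_le hS _ _).trans (Nat.add_le_add_left ih _)
  have h2 : ((List.ofFn γ).map (wordLength (S : Set Γ))).sum =
      ∑ i, wordLength (S : Set Γ) (γ i) := by
    rw [List.map_ofFn, List.sum_ofFn]; rfl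
  have h3 : wordLength (S : Set Γ) (toY γ i) ≤ ∑ i, wordLength (S : Set Γ) (γ i) := by
    rw [← h2]
    refine (key _).trans (List.Sublist.sum_le_sum ((List.drop_sublist _ _).map _) ?_)
    intro a _
    exact Nat.zero_le a
  rw [totalLength]
  exact_mod_cast h3

/-- The hypothesis bounds values of the cyclic cocycle, whereas the faces of `commVec` need bounds
for τ itself. Dividing all points by Y₀ on the right exhibits the value of τ as a value of the
cyclic cocycle, at a tuple whose word lengths are controlled. -/
theorem norm_cocycle_le (hS : Subgroup.closure (S : Set Γ) = ⊤) (hτ : IsCocycle x τ)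
    (hZ : HasExpGrowth S x τ) : ∃ K E : ℝ, 0 ≤ K ∧ 0 ≤ E ∧
      ∀ (Y : Fin (k + 1) → Γ) (g : Γ) (L : ℝ), (∀ i, (wordLength (S : Set Γ) (Y i) : ℝ) ≤ L) →
        (wordLength (S : Set Γ) (g * x * g⁻¹) : ℝ) ≤ L →
        ‖τ (fun i => Y i * g)‖ ≤ K * Real.exp (E * L) := by
  obtain ⟨C, D, hC, hD, hb⟩ := hZ
  refine ⟨C, D * ((k + 1) * 6), hC.le, by positivity, fun Y g L hY hg => ?_⟩
  have hmul : ∀ a b : Γ, (wordLength (S : Set Γ) (a * b) : ℝ) ≤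
      wordLength (S : Set Γ) a + wordLength (S : Set Γ) b := fun a b => by
    exact_mod_cast wordLength_mul_le hS a b
  have hinv : ∀ a : Γ, (wordLength (S : Set Γ) a⁻¹ : ℝ) ≤ wordLength (S : Set Γ) a := fun a => by
    exact_mod_cast wordLength_inv_le hS a
  have hL : 0 ≤ L := (Nat.cast_nonneg _).trans hg
  -- The first entry is chosen conjugate to x by Y₀ g, so that y₀ Y₀ g = Y₀ g x. Each entry has
  -- length at most 3 L, hence each of the k + 1 quotients of neighbours at most 6 L; this is the
  -- exponent claimed above.
  let y : Fin (k + 1) → Γ := fun i =>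
    if i = 0 then Y 0 * (g * x * g⁻¹) * (Y 0)⁻¹ else Y i * (Y 0)⁻¹
  have hy : ∀ i, (wordLength (S : Set Γ) (y i) : ℝ) ≤ 3 * L := by
    intro i
    have h0 := hinv (Y 0)
    have h0' := hY 0
    simp only [y]
    split_ifs with hi
    · have h1 := hmul (Y 0 * (g * x * g⁻¹)) (Y 0)⁻¹
      have h2 := hmul (Y 0) (g * x * g⁻¹)
      linarith
    · have h1 := hmul (Y i) (Y 0)⁻¹
      have h2 := hY i
      linarith
  have hγ : ∀ i, (wordLength (S : Set Γ) (fromY y i) : ℝ) ≤ 6 * L := by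
    intro i
    simp only [fromY]
    refine (hmul _ _).trans ?_
    have h1 := hy i
    split_ifs with h
    · have h2 := hinv (y ⟨i + 1, h⟩)
      have h3 := hy ⟨i + 1, h⟩
      linarith
    · rw [wordLength_one, Nat.cast_zero]; linarith
  have htot : totalLength (S : Set Γ) (fromY y) ≤ (k + 1) * (6 * L) := by
    rw [totalLength]
    refine (Finset.sum_le_sum fun i _ => hγ i).trans ?_
    simp
  have hτy : τ (fun i => Y i * g) = cyclicCocycle x τ (fromY y) := by
    rw [cyclicCocycle_eq hτ (g := Y 0 * g) (by rw [toY_fromY]; simp [y, mul_assoc]), toY_fromY,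
      ← hτ.x_invariant]
    congr 1
    funext i
    by_cases hi : i = 0
    · subst hi; simp [y, mul_assoc]
    · simp [y, hi]
  rw [hτy]
  refine (hb _).trans (mul_le_mul_of_nonneg_left (Real.exp_le_exp.2 ?_) hC.le)
  calc D * totalLength (S : Set Γ) (fromY y) ≤ D * ((k + 1) * (6 * L)) :=
        mul_le_mul_of_nonneg_left htot hD.le
    _ = D * ((k + 1) * 6) * L := by ring

theorem RapidDecay.norm_le {q : ℕ} {w : Chain Γ ℂ q} (hw : RapidDecay (S : Set Γ) w) (r : ℝ) :
    ∃ C, 0 ≤ C ∧ ∀ γ, ‖w γ‖ ≤ C * Real.exp (-(r * totalLength (S : Set Γ) γ)) := by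
  obtain ⟨n, hn⟩ := exists_nat_ge r
  obtain ⟨C, hC⟩ := hw n
  refine ⟨C, (mul_nonneg (Real.exp_nonneg _) (norm_nonneg _)).trans (hC fun _ => 1), fun γ => ?_⟩
  have h0 : 0 ≤ totalLength (S : Set Γ) γ := Finset.sum_nonneg fun _ _ => Nat.cast_nonneg _
  have h1 : Real.exp (r * totalLength (S : Set Γ) γ) * ‖w γ‖ ≤ C :=
    (mul_le_mul_of_nonneg_right (Real.exp_le_exp.2 (mul_le_mul_of_nonneg_right hn h0))
      (norm_nonneg _)).trans (hC γ)
  rw [Real.exp_neg, ← div_eq_mul_inv, le_div_iff₀ (Real.exp_pos _), mul_comm]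
  exact h1

/-- Continuity of the pairing in a single seminorm: its rate r exceeds the growth rate D by enough
for the exponentials exp(-(r - D) length) to be summable, and B is C times their sum. -/
theorem summable_cyclicCocycle_mul (hS : Subgroup.closure (S : Set Γ) = ⊤)
    (hZ : HasExpGrowth S x τ) : ∃ r : ℕ, ∃ B : ℝ, 0 ≤ B ∧ ∀ (z : Chain Γ ℂ k) (ε : ℝ),
      (∀ γ, Real.exp (r * totalLength (S : Set Γ) γ) * ‖z γ‖ ≤ ε) →
        Summable (fun γ => cyclicCocycle x τ γ * z γ) ∧
        ‖∑' γ, cyclicCocycle x τ γ * z γ‖ ≤ B * ε := by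
  obtain ⟨C, D, hC, hD, hb⟩ := hZ
  obtain ⟨R, hR0, hR⟩ := exists_summable_exp_totalLength hS
  obtain ⟨r, hr⟩ := exists_nat_ge (R + D)
  have hs := (hR (r - D) (by linarith) k).mul_left C
  refine ⟨r, ∑' γ : Fin (k + 1) → Γ, C * Real.exp (-((r - D) * totalLength (S : Set Γ) γ)),
    tsum_nonneg fun γ => by positivity, fun z ε hz => ?_⟩
  have hle : ∀ γ, ‖cyclicCocycle x τ γ * z γ‖ ≤
      C * Real.exp (-((r - D) * totalLength (S : Set Γ) γ)) * ε := by
    intro γ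
    rw [norm_mul]
    have h1 : ‖z γ‖ ≤ Real.exp (-(r * totalLength (S : Set Γ) γ)) * ε := by
      rw [Real.exp_neg, mul_comm, ← div_eq_mul_inv, le_div_iff₀ (Real.exp_pos _), mul_comm]
      exact hz γ
    refine (mul_le_mul (hb γ) h1 (norm_nonneg _) (by positivity)).trans (le_of_eq ?_)
    rw [mul_assoc, mul_assoc, ← mul_assoc (Real.exp _), ← Real.exp_add]
    congr 3
    ring
  have hsε := hs.mul_right ε
  refine ⟨Summable.of_norm_bounded hsε hle, ?_⟩
  rw [← tsum_mul_right]
  exact tsum_of_norm_bounded hsε.hasSum hle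

/-- Both factors decay at the rate R + E: the part E absorbs the growth of the weight, and the part
R makes the sum converge. -/
theorem summable_weighted (hS : Subgroup.closure (S : Set Γ) = ⊤) {p q : ℕ}
    {w : Chain Γ ℂ p} {v : Chain Γ ℂ q} (hw : RapidDecay (S : Set Γ) w)
    (hv : RapidDecay (S : Set Γ) v) {K E : ℝ} (hK : 0 ≤ K)
    (H : (Fin (p + 1) → Γ) → (Fin (q + 1) → Γ) → ℂ)
    (hH : ∀ A B, ‖H A B‖ ≤ K * Real.exp (E * (totalLength (S : Set Γ) (fromY A) +
      totalLength (S : Set Γ) (fromY B)))) :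
    Summable fun AB : (Fin (p + 1) → Γ) × (Fin (q + 1) → Γ) =>
      H AB.1 AB.2 * (w (fromY AB.1) * v (fromY AB.2)) := by
  obtain ⟨R, hR0, hR⟩ := exists_summable_exp_totalLength hS
  obtain ⟨C, hC0, hC⟩ := hw.norm_le (R + E)
  obtain ⟨C', hC0', hC'⟩ := hv.norm_le (R + E)
  have h1 := (suffixEquiv Γ p).summable_iff.2 (hR R le_rfl p)
  have h2 := (suffixEquiv Γ q).summable_iff.2 (hR R le_rfl q)
  have h3 := (h1.mul_of_nonneg h2 (fun _ => Real.exp_nonneg _)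
    (fun _ => Real.exp_nonneg _)).mul_left (K * (C * C'))
  refine Summable.of_norm_bounded h3 fun AB => ?_
  rw [norm_mul, norm_mul]
  refine (mul_le_mul (hH _ _) (mul_le_mul (hC _) (hC' _) (norm_nonneg _) (by positivity))
    (by positivity) (by positivity)).trans (le_of_eq ?_)
  simp only [Function.comp, suffixEquiv, Equiv.coe_fn_mk]
  set a := totalLength (S : Set Γ) (fromY AB.1)
  set b := totalLength (S : Set Γ) (fromY AB.2)
  have : Real.exp (E * (a + b)) * (Real.exp (-((R + E) * a)) * Real.exp (-((R + E) * b))) =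
      Real.exp (-(R * a)) * Real.exp (-(R * b)) := by
    rw [← Real.exp_add, ← Real.exp_add, ← Real.exp_add]
    congr 1
    ring
  calc _ = K * (C * C') * (Real.exp (E * (a + b)) *
        (Real.exp (-((R + E) * a)) * Real.exp (-((R + E) * b)))) := by ring
    _ = _ := by rw [this]

/-- Sum first over the coordinate on which the weight does not depend; the form w sums to zero there
by `isForm_iff`. -/
theorem tsum_left_eq_zero {p q : ℕ} {w : Chain Γ ℂ p} {v : Chain Γ ℂ q}
    (hw : IsForm (S : Set Γ) w) (i : Fin p)
    (H : (Fin (p + 1) → Γ) → (Fin (q + 1) → Γ) → ℂ)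
    (hs : Summable fun AB : (Fin (p + 1) → Γ) × (Fin (q + 1) → Γ) =>
      H AB.1 AB.2 * (w (fromY AB.1) * v (fromY AB.2)))
    (hH : ∀ A B u, H (Function.update A i.succ u) B = H A B) :
    ∑' AB : (Fin (p + 1) → Γ) × (Fin (q + 1) → Γ),
      H AB.1 AB.2 * (w (fromY AB.1) * v (fromY AB.2)) = 0 := by
  have hs' := (Equiv.prodComm (Fin (q + 1) → Γ) (Fin (p + 1) → Γ)).summable_iff.2 hs
  rw [← (Equiv.prodComm (Fin (q + 1) → Γ) (Fin (p + 1) → Γ)).tsum_eq]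
  refine (hs'.tsum_prod' fun B => hs'.prod_factor B).trans ?_
  refine (tsum_congr fun B => ?_).trans tsum_zero
  refine tsum_eq_zero_of_slice i.succ (hs'.prod_factor B) fun A => ?_
  simp only [Function.comp, Equiv.prodComm_apply, Prod.swap_prod_mk, hH]
  rw [tsum_mul_left, tsum_mul_right, (isForm_iff.1 hw).2 i A, zero_mul, mul_zero]

theorem tsum_right_eq_zero {p q : ℕ} {w : Chain Γ ℂ p} {v : Chain Γ ℂ q}
    (hv : IsForm (S : Set Γ) v) (i : Fin q)
    (H : (Fin (p + 1) → Γ) → (Fin (q + 1) → Γ) → ℂ)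
    (hs : Summable fun AB : (Fin (p + 1) → Γ) × (Fin (q + 1) → Γ) =>
      H AB.1 AB.2 * (w (fromY AB.1) * v (fromY AB.2)))
    (hH : ∀ A B u, H A (Function.update B i.succ u) = H A B) :
    ∑' AB : (Fin (p + 1) → Γ) × (Fin (q + 1) → Γ),
      H AB.1 AB.2 * (w (fromY AB.1) * v (fromY AB.2)) = 0 := by
  refine (hs.tsum_prod' fun A => hs.prod_factor A).trans ?_
  refine (tsum_congr fun A => ?_).trans tsum_zero
  refine tsum_eq_zero_of_slice i.succ (hs.prod_factor A) fun B => ?_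
  simp only [hH]
  rw [tsum_mul_left, tsum_mul_left, (isForm_iff.1 hv).2 i B, mul_zero, mul_zero]

/-- The term of the coboundary of `τ` which omits one of the points of `commVec`. -/
def commTerm (x : Γ) (τ : Chain Γ ℂ k) {p q : ℕ} (h : p + q = k) (j : Fin (k + 2))
    (A : Fin (p + 1) → Γ) (B : Fin (q + 1) → Γ) : ℂ :=
  open Classical in
  if hg : ∃ g : Γ, A 0 * B 0 = g * x * g⁻¹ then
    τ (fun i => commVec h A B (j.succAbove i) * hg.choose) else 0

theorem commTerm_zero (hτ : IsCocycle x τ) {p q : ℕ} (h : p + q = k)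
    (A : Fin (p + 1) → Γ) (B : Fin (q + 1) → Γ) :
    commTerm x τ h 0 A B = (-1 : ℂ) ^ (p * q) *
      cyclicCocycle x τ (fromY (joinSuffix ((add_comm q p).trans h) B A)) := by
  by_cases hg : ∃ g : Γ, A 0 * B 0 = g * x * g⁻¹
  · rw [commTerm, dif_pos hg, cyclicCocycle_joinSuffix_comm h hτ A B hg.choose_spec]
  · rw [commTerm, dif_neg hg, cyclicCocycle_eq_zero, mul_zero]
    rintro ⟨g, hg'⟩
    refine hg ⟨(B 0)⁻¹ * g, ?_⟩
    rw [toY_fromY] at hg'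
    have h0 : joinSuffix ((add_comm q p).trans h) B A 0 = B 0 * A 0 := by simp [joinSuffix]
    rw [h0] at hg'
    rw [← eq_inv_mul_iff_mul_eq] at hg'
    rw [hg']
    group

theorem commTerm_one (hτ : IsCocycle x τ) {p q : ℕ} (h : p + q = k)
    (A : Fin (p + 1) → Γ) (B : Fin (q + 1) → Γ) :
    commTerm x τ h 1 A B = cyclicCocycle x τ (fromY (joinSuffix h A B)) := by
  by_cases hg : ∃ g : Γ, A 0 * B 0 = g * x * g⁻¹
  · rw [commTerm, dif_pos hg, cyclicCocycle_joinSuffix h hτ A B hg.choose_spec]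
  · rw [commTerm, dif_neg hg, cyclicCocycle_eq_zero]
    rintro ⟨g, hg'⟩
    refine hg ⟨g, ?_⟩
    rw [toY_fromY] at hg'
    have h0 : joinSuffix h A B 0 = A 0 * B 0 := by simp [joinSuffix]
    rw [← h0, hg']

theorem sum_commTerm (hτ : IsCocycle x τ) {p q : ℕ} (h : p + q = k)
    (A : Fin (p + 1) → Γ) (B : Fin (q + 1) → Γ) :
    ∑ j : Fin (k + 2), (-1 : ℂ) ^ (j : ℕ) * commTerm x τ h j A B = 0 := by
  by_cases hg : ∃ g : Γ, A 0 * B 0 = g * x * g⁻¹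
  · simp only [commTerm, dif_pos hg]
    exact hτ.closed fun i => commVec h A B i * hg.choose
  · simp [commTerm, dif_neg hg]

theorem norm_commTerm_le (hS : Subgroup.closure (S : Set Γ) = ⊤) (hτ : IsCocycle x τ)
    (hZ : HasExpGrowth S x τ) {p q : ℕ} (h : p + q = k) (j : Fin (k + 2)) :
    ∃ K E : ℝ, 0 ≤ K ∧ ∀ A B, ‖commTerm x τ h j A B‖ ≤
      K * Real.exp (E * (totalLength (S : Set Γ) (fromY (q := p) A) +
        totalLength (S : Set Γ) (fromY (q := q) B))) := by
  obtain ⟨K, E, hK, hE, hb⟩ := norm_cocycle_le hS hτ hZ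
  refine ⟨K, E, hK, fun A B => ?_⟩
  have hA : ∀ i, (wordLength (S : Set Γ) (A i) : ℝ) ≤ totalLength (S : Set Γ) (fromY A) :=
    fun i => by simpa [toY_fromY] using wordLength_toY_le hS (fromY A) i
  have hB : ∀ i, (wordLength (S : Set Γ) (B i) : ℝ) ≤ totalLength (S : Set Γ) (fromY B) :=
    fun i => by simpa [toY_fromY] using wordLength_toY_le hS (fromY B) i
  have hAB : ∀ i, (wordLength (S : Set Γ) (A i * B 0) : ℝ) ≤ totalLength (S : Set Γ) (fromY A) +
      totalLength (S : Set Γ) (fromY B) := fun i =>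
    (Nat.cast_le.2 (wordLength_mul_le hS (A i) (B 0))).trans (by
      push_cast; exact add_le_add (hA i) (hB 0))
  have hA0 : 0 ≤ totalLength (S : Set Γ) (fromY A) := (Nat.cast_nonneg _).trans (hA 0)
  have hB0 : 0 ≤ totalLength (S : Set Γ) (fromY B) := (Nat.cast_nonneg _).trans (hB 0)
  rw [commTerm]
  split_ifs with hg
  · refine hb (fun i => commVec h A B (j.succAbove i)) _ _ (fun i => ?_) ?_
    · simp only [commVec]
      split_ifs
      · rw [wordLength_one, Nat.cast_zero]; linarith
      · exact (hB 0).trans (by linarith)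
      · exact hAB _
      · exact (hB _).trans (by linarith)
    · rw [← hg.choose_spec]; exact hAB 0
  · rw [norm_zero]; positivity

/-- The entry in question occurs in `commVec` only at the omitted point, and the conjugator depends
only on A₀B₀. -/
theorem commTerm_update_left {p q : ℕ} (h : p + q = k) (i : Fin p) (j : Fin (k + 2))
    (hj : (j : ℕ) = i + 2) (A : Fin (p + 1) → Γ) (B : Fin (q + 1) → Γ) (u : Γ) :
    commTerm x τ h j (Function.update A i.succ u) B = commTerm x τ h j A B := by
  have h0 : Function.update A i.succ u 0 = A 0 := Function.update_of_ne (Fin.succ_ne_zero i).symm _ _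
  have h1 : ∀ l, commVec h (Function.update A i.succ u) B (j.succAbove l) =
      commVec h A B (j.succAbove l) := by
    intro l
    have hl : ((j.succAbove l : Fin (k + 2)) : ℕ) ≠ i + 2 := fun hh =>
      Fin.succAbove_ne j l (Fin.ext (hh.trans hj.symm))
    simp only [commVec]
    split_ifs with a1 a2 a3
    · rfl
    · rfl
    · rw [Function.update_of_ne]
      simp only [ne_eq, Fin.ext_iff, Fin.val_succ]
      omega
    · rfl
  simp only [commTerm, h1]
  rw [h0]

/-- Entries of B after the first occupy the places from p + 2 on; the factor B₀ inside the earlier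
points is not touched. -/
theorem commTerm_update_right {p q : ℕ} (h : p + q = k) (i : Fin q) (j : Fin (k + 2))
    (hj : (j : ℕ) = p + i + 2) (A : Fin (p + 1) → Γ) (B : Fin (q + 1) → Γ) (u : Γ) :
    commTerm x τ h j A (Function.update B i.succ u) = commTerm x τ h j A B := by
  have h0 : Function.update B i.succ u 0 = B 0 := Function.update_of_ne (Fin.succ_ne_zero i).symm _ _
  have h1 : ∀ l, commVec h A (Function.update B i.succ u) (j.succAbove l) =
      commVec h A B (j.succAbove l) := by
    intro l
    have hl : ((j.succAbove l : Fin (k + 2)) : ℕ) ≠ p + i + 2 := fun hh =>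
      Fin.succAbove_ne j l (Fin.ext (hh.trans hj.symm))
    simp only [commVec, h0]
    split_ifs with a1 a2 a3
    · rfl
    · rfl
    · rfl
    · rw [Function.update_of_ne]
      simp only [ne_eq, Fin.ext_iff, Fin.val_succ]
      omega
  simp only [commTerm, h1]
  rw [h0]

/-- The cocycle identity of τ at `commVec` is summed against w and v. The faces 0 and 1 are the two
products of the commutator, and each of the remaining k faces vanishes in the sum, by w or by v
according to which of them owns the omitted point. -/
theorem hasSum_commutator (hS : Subgroup.closure (S : Set Γ) = ⊤) (hτ : IsCocycle x τ)
    (hZ : HasExpGrowth S x τ) {p q : ℕ} (h : p + q = k) {w : Chain Γ ℂ p} {v : Chain Γ ℂ q}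
    (hw : IsForm (S : Set Γ) w) (hv : IsForm (S : Set Γ) v) :
    HasSum (fun γ => cyclicCocycle x τ γ *
      (mul h w v - (-1 : ℂ) ^ (p * q) • mul ((add_comm q p).trans h) v w) γ) 0 := by
  have hsum : ∀ j, Summable fun AB : (Fin (p + 1) → Γ) × (Fin (q + 1) → Γ) =>
      commTerm x τ h j AB.1 AB.2 * (w (fromY AB.1) * v (fromY AB.2)) := fun j => by
    obtain ⟨K, E, hK, hb⟩ := norm_commTerm_le hS hτ hZ h j
    exact summable_weighted hS hw.1 hv.1 hK _ hb
  have h1 := hasSum_mul h (cyclicCocycle x τ) w v (by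
    simpa only [commTerm_one hτ] using hsum 1)
  have hsq : (-1 : ℂ) ^ (p * q) * (-1) ^ (p * q) = 1 := by rw [← mul_pow]; simp
  have h0' : ∀ A B, cyclicCocycle x τ (fromY (joinSuffix ((add_comm q p).trans h) B A)) =
      (-1 : ℂ) ^ (p * q) * commTerm x τ h 0 A B := fun A B => by
    rw [commTerm_zero hτ, ← mul_assoc, hsq, one_mul]
  have hs0 : Summable fun BA : (Fin (q + 1) → Γ) × (Fin (p + 1) → Γ) =>
      cyclicCocycle x τ (fromY (joinSuffix ((add_comm q p).trans h) BA.1 BA.2)) *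
        (v (fromY BA.1) * w (fromY BA.2)) := by
    have := (Equiv.prodComm (Fin (q + 1) → Γ) (Fin (p + 1) → Γ)).summable_iff.2
      ((hsum 0).mul_left ((-1 : ℂ) ^ (p * q)))
    refine this.congr fun BA => ?_
    simp only [Function.comp, Equiv.prodComm_apply, Prod.fst_swap, Prod.snd_swap, h0']
    ring
  have h2 := hasSum_mul ((add_comm q p).trans h) (cyclicCocycle x τ) v w hs0
  have h3 := h1.sub (h2.mul_left ((-1 : ℂ) ^ (p * q)))
  have e2 : (-1 : ℂ) ^ (p * q) * ∑' BA : (Fin (q + 1) → Γ) × (Fin (p + 1) → Γ),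
      cyclicCocycle x τ (fromY (joinSuffix ((add_comm q p).trans h) BA.1 BA.2)) *
        (v (fromY BA.1) * w (fromY BA.2)) =
      ∑' AB : (Fin (p + 1) → Γ) × (Fin (q + 1) → Γ),
        commTerm x τ h 0 AB.1 AB.2 * (w (fromY AB.1) * v (fromY AB.2)) := by
    rw [← (Equiv.prodComm (Fin (p + 1) → Γ) (Fin (q + 1) → Γ)).tsum_eq, ← tsum_mul_left]
    refine tsum_congr fun AB => ?_
    simp only [Equiv.prodComm_apply, Prod.fst_swap, Prod.snd_swap, h0']
    linear_combination (commTerm x τ h 0 AB.1 AB.2 * (w (fromY AB.1) * v (fromY AB.2))) * hsq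
  have e1 : ∑' AB : (Fin (p + 1) → Γ) × (Fin (q + 1) → Γ),
      cyclicCocycle x τ (fromY (joinSuffix h AB.1 AB.2)) * (w (fromY AB.1) * v (fromY AB.2)) =
      ∑' AB : (Fin (p + 1) → Γ) × (Fin (q + 1) → Γ),
        commTerm x τ h 1 AB.1 AB.2 * (w (fromY AB.1) * v (fromY AB.2)) := by
    simp only [commTerm_one hτ]
  have hvan : ∀ j : Fin k, ∑' AB : (Fin (p + 1) → Γ) × (Fin (q + 1) → Γ),
      commTerm x τ h j.succ.succ AB.1 AB.2 * (w (fromY AB.1) * v (fromY AB.2)) = 0 := by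
    intro j
    by_cases hj : (j : ℕ) < p
    · exact tsum_left_eq_zero hw ⟨j, hj⟩ _ (hsum _)
        (commTerm_update_left h ⟨j, hj⟩ _ (by simp))
    · exact tsum_right_eq_zero hv ⟨j - p, by have := j.2; omega⟩ _ (hsum _)
        (commTerm_update_right h ⟨j - p, by have := j.2; omega⟩ _ (by simp; omega))
  have htot : ∑ j : Fin (k + 2), (-1 : ℂ) ^ (j : ℕ) *
      ∑' AB : (Fin (p + 1) → Γ) × (Fin (q + 1) → Γ),
        commTerm x τ h j AB.1 AB.2 * (w (fromY AB.1) * v (fromY AB.2)) = 0 := by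
    simp only [← tsum_mul_left]
    rw [← Summable.tsum_finsetSum fun j _ => (hsum j).mul_left _]
    refine (tsum_congr fun AB => ?_).trans tsum_zero
    simp only [← mul_assoc]
    rw [← Finset.sum_mul, ← Finset.sum_mul, sum_commTerm hτ, zero_mul, zero_mul]
  rw [Fin.sum_univ_succ, Fin.sum_univ_succ] at htot
  simp only [hvan, mul_zero, Finset.sum_const_zero, add_zero] at htot
  have hz : ∑' AB : (Fin (p + 1) → Γ) × (Fin (q + 1) → Γ),
        commTerm x τ h 1 AB.1 AB.2 * (w (fromY AB.1) * v (fromY AB.2)) -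
      ∑' AB : (Fin (p + 1) → Γ) × (Fin (q + 1) → Γ),
        commTerm x τ h 0 AB.1 AB.2 * (w (fromY AB.1) * v (fromY AB.2)) = 0 := by
    have : Fin.succ (0 : Fin (k + 1)) = 1 := rfl
    rw [this] at htot
    simp only [Fin.val_zero, pow_zero, one_mul, Fin.val_one, pow_one] at htot
    linear_combination -htot
  rw [e1, e2, hz] at h3
  refine h3.congr_fun fun γ => ?_
  simp only [Pi.sub_apply, Pi.smul_apply, smul_eq_mul]
  ring

theorem hasSum_of_mem_commutators (hS : Subgroup.closure (S : Set Γ) = ⊤) (hτ : IsCocycle x τ)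
    (hZ : HasExpGrowth S x τ) {c : Chain Γ ℂ k} (hc : c ∈ commutators (S : Set Γ) k) :
    HasSum (fun γ => cyclicCocycle x τ γ * c γ) 0 := by
  induction hc using Submodule.span_induction with
  | mem z hz =>
    obtain ⟨p, q, h, w, v, hw, hv, rfl⟩ := hz
    exact hasSum_commutator hS hτ hZ h hw hv
  | zero => simp
  | add a b _ _ ha hb => simpa [mul_add] using ha.add hb
  | smul r a _ ha =>
    simpa [mul_left_comm] using ha.mul_left r

/-- The pairing vanishes on commutators and is bounded by one of the seminorms that define the
closure, so approximation in that seminorm suffices. -/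
theorem descends_cyclicCocycle (hS : Subgroup.closure (S : Set Γ) = ⊤) (hτ : IsCocycle x τ)
    (hZ : HasExpGrowth S x τ) : Descends (S : Set Γ) (cyclicCocycle x τ) := by
  intro w w' hww
  obtain ⟨r, B, hB, hb⟩ := summable_cyclicCocycle_mul hS hZ
  have hsum : ∀ w : Omega (S : Set Γ) k, Summable fun γ => cyclicCocycle x τ γ * w.1 γ := fun w => by
    obtain ⟨C, hC⟩ := w.2.1 r
    exact (hb w.1 C hC).1
  rw [← sub_eq_zero, ← norm_eq_zero]
  refine le_antisymm (le_of_forall_pos_le_add fun ε hε => ?_) (norm_nonneg _)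
  -- The bound B may be 0, hence the shift by 1.
  have hε' : 0 < ε / (B + 1) := by positivity
  obtain ⟨c, hc, hle⟩ := hww r _ hε'
  have h1 := hb ((w.1 - w'.1) - c) _ hle
  have h2 : HasSum (fun γ => cyclicCocycle x τ γ * ((w.1 - w'.1) - c) γ)
      (evalCochain (cyclicCocycle x τ) w.1 - evalCochain (cyclicCocycle x τ) w'.1 - 0) := by
    refine (((hsum w).hasSum.sub (hsum w').hasSum).sub
      (hasSum_of_mem_commutators hS hτ hZ hc)).congr_fun fun γ => ?_
    simp only [Pi.sub_apply]
    ring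
  rw [h2.tsum_eq, sub_zero] at h1
  refine h1.2.trans ?_
  rw [zero_add, mul_div_assoc', div_le_iff₀ (by positivity)]
  nlinarith

end Descent

/-! ### Smooth families of alternating forms -/

section Alternating

variable {X Y Z : Type*} [NormedAddCommGroup X] [NormedSpace ℝ X] [NormedAddCommGroup Y]
  [NormedSpace ℝ Y] [NormedAddCommGroup Z] [NormedSpace ℝ Z] {p : ℕ}

/-- In finite dimensions an alternating map is determined by its finitely many values on basis
vectors, and a linear left inverse of this evaluation is automatically continuous. -/
theorem contDiffAt_alternating_iff [FiniteDimensional ℝ X] {r : WithTop ℕ∞}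
    {f : Y → X [⋀^Fin p]→L[ℝ] ℂ} {y : Y} :
    ContDiffAt ℝ r f y ↔ ∀ v, ContDiffAt ℝ r (fun y => f y v) y := by
  constructor
  · intro h v
    exact ((ContinuousAlternatingMap.apply ℝ X ℂ v).contDiff.contDiffAt (x := f y)).comp y h
  · intro h
    let b := Module.finBasis ℝ X
    let ev : (X [⋀^Fin p]→L[ℝ] ℂ) →ₗ[ℝ] ((Fin p → Fin (Module.finrank ℝ X)) → ℂ) :=
      { toFun := fun α r => α fun i => b (r i)
        map_add' := fun _ _ => rfl
        map_smul' := fun _ _ => rfl }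
    have hinj : Function.Injective ev := by
      intro α β hαβ
      apply ContinuousAlternatingMap.toAlternatingMap_injective
      apply AlternatingMap.coe_multilinearMap_injective
      exact Module.Basis.ext_multilinear (fun _ => b) fun r => congrFun hαβ r
    obtain ⟨g, hg⟩ := LinearMap.exists_leftInverse_of_injective ev (LinearMap.ker_eq_bot.2 hinj)
    have h1 : ContDiffAt ℝ r (fun y => ev (f y)) y := contDiffAt_pi.2 fun r => h _
    have h2 := ((LinearMap.toContinuousLinearMap g).contDiff.contDiffAt
      (n := r) (x := ev (f y))).comp y h1
    refine h2.congr_of_eventuallyEq (Filter.Eventually.of_forall fun z => ?_)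
    exact (LinearMap.congr_fun hg (f z)).symm

theorem contDiffAt_compContinuousLinearMap [FiniteDimensional ℝ X] {r : WithTop ℕ∞}
    {f : Y → Z [⋀^Fin p]→L[ℝ] ℂ} {L : Y → X →L[ℝ] Z} {y : Y} (hf : ContDiffAt ℝ r f y)
    (hL : ContDiffAt ℝ r L y) :
    ContDiffAt ℝ r (fun y => (f y).compContinuousLinearMap (L y)) y := by
  rw [contDiffAt_alternating_iff]
  intro v
  have h1 : ContDiffAt ℝ r (fun y => (f y).toContinuousMultilinearMap) y :=
    (ContinuousAlternatingMap.toContinuousMultilinearMapLI (𝕜 := ℝ) (E := Z) (F := ℂ)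
      (ι := Fin p)).toContinuousLinearMap.contDiff.contDiffAt.comp y hf
  have hc : ContDiff ℝ r (fun L : Fin p → X →L[ℝ] Z =>
      ContinuousMultilinearMap.compContinuousLinearMapContinuousMultilinear ℝ
        (fun _ : Fin p => X) (fun _ : Fin p => Z) ℂ L) := by
    apply ContinuousMultilinearMap.contDiff
  have h2 := hc.contDiffAt.comp y (contDiffAt_pi.2 fun _ : Fin p => hL)
  have h3 := h2.clm_apply h1
  exact ((ContinuousMultilinearMap.apply ℝ (fun _ : Fin p => X) ℂ v).contDiff.contDiffAt).comp y h3

/-- The exterior product of a linear form with an alternating form. -/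
def wedge (ℓ : X →L[ℝ] ℝ) (α : X [⋀^Fin p]→L[ℝ] ℂ) : X [⋀^Fin (p + 1)]→L[ℝ] ℂ :=
  ContinuousAlternatingMap.alternatizeUncurryFin (ℓ.smulRight α)

theorem wedge_apply (ℓ : X →L[ℝ] ℝ) (α : X [⋀^Fin p]→L[ℝ] ℂ) (v : Fin (p + 1) → X) :
    wedge ℓ α v = ∑ i : Fin (p + 1), (-1 : ℤ) ^ (i : ℕ) • (ℓ (v i) • α (i.removeNth v)) := by
  simp [wedge, ContinuousAlternatingMap.alternatizeUncurryFin_apply]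

theorem wedge_comp (ℓ : Z →L[ℝ] ℝ) (α : Z [⋀^Fin p]→L[ℝ] ℂ) (L : X →L[ℝ] Z) :
    (wedge ℓ α).compContinuousLinearMap L =
      wedge (ℓ.comp L) (α.compContinuousLinearMap L) := by
  ext v
  rw [wedge_apply]
  exact wedge_apply ℓ α (L ∘ v)

/-- `wedge` as a bilinear map. -/
def wedgeHom (X : Type*) [NormedAddCommGroup X] [NormedSpace ℝ X] (p : ℕ) :
    (X →L[ℝ] ℝ) →ₗ[ℝ] (X [⋀^Fin p]→L[ℝ] ℂ) →ₗ[ℂ] X [⋀^Fin (p + 1)]→L[ℝ] ℂ where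
  toFun ℓ :=
    { toFun := wedge ℓ
      map_add' := fun α β => by
        ext v; simp [wedge_apply, smul_add, Finset.sum_add_distrib]
      map_smul' := fun c α => by
        ext v
        simp only [wedge_apply, ContinuousAlternatingMap.smul_apply, Finset.smul_sum,
          RingHom.id_apply]
        refine Finset.sum_congr rfl fun i _ => ?_
        rw [smul_comm c, smul_comm c] }
  map_add' ℓ ℓ' := by
    ext α v; simp [wedge_apply, add_smul, smul_add, Finset.sum_add_distrib]
  map_smul' c ℓ := by
    ext α v
    simp only [wedge_apply, LinearMap.coe_mk, AddHom.coe_mk, _root_.smul_apply,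
      RingHom.id_apply, LinearMap.smul_apply, ContinuousAlternatingMap.smul_apply,
      Finset.smul_sum, smul_assoc]
    refine Finset.sum_congr rfl fun i _ => ?_
    rw [smul_comm ((-1 : ℤ) ^ (i : ℕ)) c]

theorem extDeriv_smul_fun {u : X → ℝ} {α : X → X [⋀^Fin p]→L[ℝ] ℂ} {x : X}
    (hu : DifferentiableAt ℝ u x) (hα : DifferentiableAt ℝ α x) :
    extDeriv (fun x => u x • α x) x = u x • extDeriv α x + wedge (fderiv ℝ u x) (α x) := by
  rw [extDeriv, fderiv_fun_smul hu hα, ContinuousAlternatingMap.alternatizeUncurryFin_add]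
  congr 1
  rw [ContinuousAlternatingMap.alternatizeUncurryFin_smul]
  rfl

theorem ContDiffAt.extDeriv {α : X → X [⋀^Fin p]→L[ℝ] ℂ} {x : X}
    (hα : ContDiffAt ℝ ∞ α x) : ContDiffAt ℝ ∞ (extDeriv α) x := by
  have h1 : ContDiffAt ℝ ∞ (fderiv ℝ α) x := hα.fderiv_right (m := ∞) (by simp)
  exact (ContinuousAlternatingMap.alternatizeUncurryFinCLM ℝ X ℂ).contDiff.contDiffAt.comp x h1

end Alternating

/-! ### Calculus of forms on manifolds -/

section Pullback

variable {n : ℕ} {M : Type*} [TopologicalSpace M] [ChartedSpace (EuclideanSpace ℝ (Fin n)) M]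
  {X : Type*} [NormedAddCommGroup X] [NormedSpace ℝ X] {p : ℕ}

/-- The pull-back of a form on `M` by a map from a normed space. -/
def pullForm (f : X → M) (α : DForm n M p) : X → X [⋀^Fin p]→L[ℝ] ℂ := fun x =>
  (α (f x)).compContinuousLinearMap
    (show X →L[ℝ] EuclideanSpace ℝ (Fin n) from mfderiv 𝓘(ℝ, X) (𝓡 n) f x)

theorem chartRep_eq_pullForm (α : DForm n M p) (x₀ : M) :
    chartRep α x₀ = pullForm (extChartAt (𝓡 n) x₀).symm α := rfl

theorem IsSmoothForm.contDiffAt {α : DForm n M p} (hα : IsSmoothForm α) {x₀ : M}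
    {y : EuclideanSpace ℝ (Fin n)} (hy : y ∈ (extChartAt (𝓡 n) x₀).target) :
    ContDiffAt ℝ ∞ (chartRep α x₀) y :=
  (hα x₀).contDiffAt ((isOpen_extChartAt_target x₀).mem_nhds hy)

theorem isSmoothForm_of_contDiffAt {α : DForm n M p}
    (h : ∀ x₀, ∀ y ∈ (extChartAt (𝓡 n) x₀).target, ContDiffAt ℝ ∞ (chartRep α x₀) y) :
    IsSmoothForm α := fun x₀ y hy => (h x₀ y hy).contDiffWithinAt

theorem IsSmoothForm.differentiableAt {α : DForm n M p} (hα : IsSmoothForm α) (x : M) :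
    DifferentiableAt ℝ (chartRep α x) (extChartAt (𝓡 n) x x) :=
  (hα.contDiffAt (mem_extChartAt_target x)).differentiableAt (by simp)

variable [IsManifold (𝓡 n) ∞ M]

/-- Near x, f is the inverse chart composed with f read in that chart; the chain rule moves all
questions about pull-backs to forms on vector spaces. -/
theorem pullForm_eq {f : X → M} {x : X} {x₀ : M} (α : DForm n M p)
    (hf : MDifferentiableAt 𝓘(ℝ, X) (𝓡 n) f x) (hx : f x ∈ (extChartAt (𝓡 n) x₀).source) :
    pullForm f α x = (chartRep α x₀ (extChartAt (𝓡 n) x₀ (f x))).compContinuousLinearMap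
      (fderiv ℝ (fun z => extChartAt (𝓡 n) x₀ (f z)) x) := by
  have hx' : f x ∈ (chartAt (EuclideanSpace ℝ (Fin n)) x₀).source := by
    rwa [extChartAt_source] at hx
  have h1 : MDifferentiableAt (𝓡 n) 𝓘(ℝ, EuclideanSpace ℝ (Fin n)) (extChartAt (𝓡 n) x₀) (f x) :=
    mdifferentiableAt_extChartAt hx'
  have hmem : extChartAt (𝓡 n) x₀ (f x) ∈ (extChartAt (𝓡 n) x₀).target :=
    (extChartAt (𝓡 n) x₀).map_source hx
  have h2 : MDifferentiableAt 𝓘(ℝ, EuclideanSpace ℝ (Fin n)) (𝓡 n) (extChartAt (𝓡 n) x₀).symm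
      (extChartAt (𝓡 n) x₀ (f x)) :=
    ((contMDiffOn_extChartAt_symm (n := ∞) x₀).contMDiffAt
      ((isOpen_extChartAt_target x₀).mem_nhds hmem)).mdifferentiableAt (by simp)
  have h3 : MDifferentiableAt 𝓘(ℝ, X) 𝓘(ℝ, EuclideanSpace ℝ (Fin n))
      (fun z => extChartAt (𝓡 n) x₀ (f z)) x := h1.comp x hf
  have heq : f =ᶠ[𝓝 x] (extChartAt (𝓡 n) x₀).symm ∘ fun z => extChartAt (𝓡 n) x₀ (f z) := by
    filter_upwards [hf.continuousAt.preimage_mem_nhds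
      ((isOpen_extChartAt_source x₀).mem_nhds hx)] with z hz
    exact ((extChartAt (𝓡 n) x₀).left_inv hz).symm
  have hd : mfderiv 𝓘(ℝ, X) (𝓡 n) f x =
      (mfderiv 𝓘(ℝ, EuclideanSpace ℝ (Fin n)) (𝓡 n) (extChartAt (𝓡 n) x₀).symm
        (extChartAt (𝓡 n) x₀ (f x))).comp
      (mfderiv 𝓘(ℝ, X) 𝓘(ℝ, EuclideanSpace ℝ (Fin n)) (fun z => extChartAt (𝓡 n) x₀ (f z)) x) := by
    rw [heq.mfderiv_eq]
    exact mfderiv_comp x h2 h3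
  have hsymm : (extChartAt (𝓡 n) x₀).symm (extChartAt (𝓡 n) x₀ (f x)) = f x :=
    (extChartAt (𝓡 n) x₀).left_inv hx
  rw [mfderiv_eq_fderiv] at hd
  ext v
  simp only [pullForm, chartRep, ContinuousAlternatingMap.compContinuousLinearMap_apply]
  rw [hd]
  have : ∀ z, z = f x → ∀ v' : Fin p → EuclideanSpace ℝ (Fin n), α (f x) v' = α z v' := by
    rintro z rfl v'; rfl
  exact this _ hsymm _

theorem contMDiffAt_extChartAt_symm {x₀ : M} {y : EuclideanSpace ℝ (Fin n)}
    (hy : y ∈ (extChartAt (𝓡 n) x₀).target) :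
    ContMDiffAt 𝓘(ℝ, EuclideanSpace ℝ (Fin n)) (𝓡 n) ∞ (extChartAt (𝓡 n) x₀).symm y :=
  (contMDiffOn_extChartAt_symm (n := ∞) x₀).contMDiffAt ((isOpen_extChartAt_target x₀).mem_nhds hy)

theorem contDiffAt_extChartAt_comp {f : X → M} {x : X} {x₀ : M}
    (hf : ContMDiffAt 𝓘(ℝ, X) (𝓡 n) ∞ f x) (hx : f x ∈ (extChartAt (𝓡 n) x₀).source) :
    ContDiffAt ℝ ∞ (fun z => extChartAt (𝓡 n) x₀ (f z)) x := by
  rw [extChartAt_source] at hx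
  have := (contMDiffAt_extChartAt' (n := ∞) hx).comp x hf
  exact contMDiffAt_iff_contDiffAt.1 this

theorem eventually_contMDiffAt {f : X → M} {x : X} (hf : ContMDiffAt 𝓘(ℝ, X) (𝓡 n) ∞ f x) :
    ∀ᶠ z in 𝓝 x, MDifferentiableAt 𝓘(ℝ, X) (𝓡 n) f z := by
  have h1 : ContMDiffAt 𝓘(ℝ, X) (𝓡 n) 1 f x := hf.of_le (by simp)
  have : IsManifold (𝓡 n) 1 M := IsManifold.of_le (n := ∞) (by simp)
  exact ((contMDiffAt_iff_contMDiffAt_nhds (by simp)).1 h1).mono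
    fun z hz => hz.mdifferentiableAt (by simp)

theorem pullForm_eventuallyEq {f : X → M} {x : X} {x₀ : M} (α : DForm n M p)
    (hf : ContMDiffAt 𝓘(ℝ, X) (𝓡 n) ∞ f x) (hx : f x ∈ (extChartAt (𝓡 n) x₀).source) :
    pullForm f α =ᶠ[𝓝 x] fun z =>
      (chartRep α x₀ (extChartAt (𝓡 n) x₀ (f z))).compContinuousLinearMap
        (fderiv ℝ (fun z => extChartAt (𝓡 n) x₀ (f z)) z) := by
  filter_upwards [eventually_contMDiffAt hf, hf.continuousAt.preimage_mem_nhds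
      ((isOpen_extChartAt_source x₀).mem_nhds hx)] with z h1 h2
  exact pullForm_eq α h1 h2

theorem IsSmoothForm.pullForm [FiniteDimensional ℝ X] {α : DForm n M p} (hα : IsSmoothForm α)
    {f : X → M} {x : X} (hf : ContMDiffAt 𝓘(ℝ, X) (𝓡 n) ∞ f x) :
    ContDiffAt ℝ ∞ (pullForm f α) x := by
  have hx := mem_extChartAt_source (I := 𝓡 n) (f x)
  refine ContDiffAt.congr_of_eventuallyEq ?_ (pullForm_eventuallyEq α hf hx)
  have h1 := contDiffAt_extChartAt_comp hf hx
  refine contDiffAt_compContinuousLinearMap ?_ (h1.fderiv_right (m := ∞) (by simp))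
  exact ContDiffAt.comp x (hα.contDiffAt ((extChartAt (𝓡 n) (f x)).map_source hx)) h1

theorem two_le_infty : minSmoothness ℝ 2 ≤ (∞ : WithTop ℕ∞) := by
  simp only [minSmoothness_of_isRCLikeNormedField]
  exact WithTop.coe_le_coe.2 le_top

/-- Naturality of d in the preferred chart at f x. That same chart defines `extd` at f x and turns
the manifold derivative of f at x into an ordinary derivative, so no change-of-chart factor appears.
-/
theorem extDeriv_pullForm {α : DForm n M p} (hα : IsSmoothForm α)
    {f : X → M} {x : X} (hf : ContMDiffAt 𝓘(ℝ, X) (𝓡 n) ∞ f x) :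
    extDeriv (pullForm f α) x = pullForm f (extd α) x := by
  have hx := mem_extChartAt_source (I := 𝓡 n) (f x)
  rw [(pullForm_eventuallyEq α hf hx).extDeriv_eq]
  have h1 := contDiffAt_extChartAt_comp hf hx
  have h2 : DifferentiableAt ℝ (chartRep α (f x)) ((fun z => extChartAt (𝓡 n) (f x) (f z)) x) :=
    (hα.contDiffAt ((extChartAt (𝓡 n) (f x)).map_source hx)).differentiableAt (by simp)
  refine (extDeriv_pullback (f := fun z => extChartAt (𝓡 n) (f x) (f z)) h2 h1
    two_le_infty).trans ?_
  have hd : mfderiv 𝓘(ℝ, X) (𝓡 n) f x = fderiv ℝ (fun z => extChartAt (𝓡 n) (f x) (f z)) x := by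
    rw [(hf.mdifferentiableAt (by simp)).mfderiv]
    simp only [writtenInExtChartAt, Function.comp_def, extChartAt_model_space_eq_id,
      PartialEquiv.refl_coe, PartialEquiv.refl_symm, modelWithCornersSelf_coe, Set.range_id,
      fderivWithin_univ, id]
    rfl
  rw [NCChern.pullForm, hd, extd]

/-- Naturality applied to an inverse chart: `extd`, defined with a different chart at every point,
can be computed in any one chart. Smoothness of `extd α` and d² = 0 follow. -/
theorem chartRep_extd {α : DForm n M p} (hα : IsSmoothForm α) {x₀ : M}
    {y : EuclideanSpace ℝ (Fin n)} (hy : y ∈ (extChartAt (𝓡 n) x₀).target) :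
    chartRep (extd α) x₀ y = extDeriv (chartRep α x₀) y :=
  (extDeriv_pullForm hα (contMDiffAt_extChartAt_symm hy)).symm

theorem chartRep_extd_eventuallyEq {α : DForm n M p} (hα : IsSmoothForm α) {x₀ : M}
    {y : EuclideanSpace ℝ (Fin n)} (hy : y ∈ (extChartAt (𝓡 n) x₀).target) :
    chartRep (extd α) x₀ =ᶠ[𝓝 y] extDeriv (chartRep α x₀) :=
  Filter.eventually_of_mem ((isOpen_extChartAt_target x₀).mem_nhds hy)
    fun _ hz => chartRep_extd hα hz

theorem IsSmoothForm.extd {α : DForm n M p} (hα : IsSmoothForm α) : IsSmoothForm (extd α) :=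
  isSmoothForm_of_contDiffAt fun _ _ hy =>
    (ContDiffAt.extDeriv (hα.contDiffAt hy)).congr_of_eventuallyEq
      (chartRep_extd_eventuallyEq hα hy)

theorem extd_extd {α : DForm n M p} (hα : IsSmoothForm α) : extd (extd α) = 0 := by
  funext x
  rw [NCChern.extd, (chartRep_extd_eventuallyEq hα (mem_extChartAt_target x)).extDeriv_eq]
  exact extDeriv_extDeriv_apply (hα.contDiffAt (mem_extChartAt_target x)) two_le_infty

end Pullback

/-! ### Linearity and the Leibniz rule for forms on a manifold -/

section Operations

variable {n : ℕ} {M : Type*} [TopologicalSpace M] [ChartedSpace (EuclideanSpace ℝ (Fin n)) M]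
  {p : ℕ} {α β : DForm n M p}

theorem isSmoothForm_zero : IsSmoothForm (0 : DForm n M p) := fun _ => contDiffOn_const (c := 0)

theorem IsSmoothForm.add (hα : IsSmoothForm α) (hβ : IsSmoothForm β) : IsSmoothForm (α + β) :=
  fun x₀ => (hα x₀).add (hβ x₀)

theorem IsSmoothForm.const_smul (c : ℂ) (hα : IsSmoothForm α) : IsSmoothForm (c • α) :=
  fun x₀ => (hα x₀).const_smul c

theorem IsSmoothForm.sum {ι : Type*} (s : Finset ι) {α : ι → DForm n M p}
    (h : ∀ i ∈ s, IsSmoothForm (α i)) : IsSmoothForm (∑ i ∈ s, α i) := by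
  classical
  induction s using Finset.induction_on with
  | empty => simpa using isSmoothForm_zero
  | insert a s ha ih =>
    rw [Finset.sum_insert ha]
    exact (h a (Finset.mem_insert_self _ _)).add
      (ih fun i hi => h i (Finset.mem_insert_of_mem hi))

theorem extd_zero : extd (0 : DForm n M p) = 0 := by
  funext x
  have : chartRep (0 : DForm n M p) x = fun _ => 0 := rfl
  ext v
  rw [extd, this, extDeriv, ContinuousAlternatingMap.alternatizeUncurryFin_apply]
  simp

theorem extd_const_smul (c : ℂ) (hα : IsSmoothForm α) :
    extd (c • α) = c • extd α := by
  funext x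
  have : chartRep (c • α) x = fun y => c • chartRep α x y := rfl
  rw [extd, this, extDeriv, fderiv_fun_const_smul (hα.differentiableAt x)]
  ext v
  simp only [ContinuousAlternatingMap.alternatizeUncurryFin_apply, Pi.smul_apply,
    ContinuousAlternatingMap.smul_apply, extd, extDeriv, Finset.smul_sum]
  refine Finset.sum_congr rfl fun i _ => ?_
  rw [smul_comm c]
  rfl

theorem extd_add (hα : IsSmoothForm α) (hβ : IsSmoothForm β) :
    extd (α + β) = extd α + extd β := by
  funext x
  exact extDeriv_fun_add (hα.differentiableAt x) (hβ.differentiableAt x)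

theorem extd_sum {ι : Type*} (s : Finset ι) {α : ι → DForm n M p}
    (h : ∀ i ∈ s, IsSmoothForm (α i)) : extd (∑ i ∈ s, α i) = ∑ i ∈ s, extd (α i) := by
  classical
  induction s using Finset.induction_on with
  | empty => simpa using extd_zero
  | insert a s ha ih =>
    have h2 : ∀ i ∈ s, IsSmoothForm (α i) := fun i hi => h i (Finset.mem_insert_of_mem hi)
    rw [Finset.sum_insert ha, Finset.sum_insert ha,
      extd_add (h a (Finset.mem_insert_self _ _)) (IsSmoothForm.sum s h2), ih h2]

/-- The differential of a real function, as a linear form on the model space. -/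
def dfun (u : M → ℝ) (x : M) : EuclideanSpace ℝ (Fin n) →L[ℝ] ℝ :=
  mfderiv (𝓡 n) 𝓘(ℝ, ℝ) u x

theorem fderiv_comp_extChartAt_symm {u : M → ℝ} {x : M}
    (hu : MDifferentiableAt (𝓡 n) 𝓘(ℝ, ℝ) u x) :
    fderiv ℝ (fun y => u ((extChartAt (𝓡 n) x).symm y)) (extChartAt (𝓡 n) x x) = dfun u x := by
  rw [dfun, hu.mfderiv]
  simp only [writtenInExtChartAt, Function.comp_def, extChartAt_model_space_eq_id,
    PartialEquiv.refl_coe, modelWithCornersSelf_coe, Set.range_id, fderivWithin_univ, id]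

variable [IsManifold (𝓡 n) ∞ M]

theorem mfderiv_extChartAt_symm_self (x : M) :
    mfderiv 𝓘(ℝ, EuclideanSpace ℝ (Fin n)) (𝓡 n) (extChartAt (𝓡 n) x).symm
      (extChartAt (𝓡 n) x x) = ContinuousLinearMap.id ℝ (EuclideanSpace ℝ (Fin n)) := by
  have hy := mem_extChartAt_target (I := 𝓡 n) x
  rw [((contMDiffAt_extChartAt_symm hy).mdifferentiableAt (by simp)).mfderiv]
  simp only [writtenInExtChartAt, extChartAt_model_space_eq_id, PartialEquiv.refl_coe,
    PartialEquiv.refl_symm, modelWithCornersSelf_coe, Set.range_id, fderivWithin_univ, id,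
    extChartAt_to_inv, Function.comp_id]
  have : (extChartAt (𝓡 n) x) ∘ (extChartAt (𝓡 n) x).symm =ᶠ[𝓝 (extChartAt (𝓡 n) x x)] id :=
    Filter.eventually_of_mem ((isOpen_extChartAt_target x).mem_nhds hy)
      fun z hz => (extChartAt (𝓡 n) x).right_inv hz
  exact this.fderiv_eq.trans fderiv_id

theorem chartRep_self (α : DForm n M p) (x : M) : chartRep α x (extChartAt (𝓡 n) x x) = α x := by
  ext v
  rw [chartRep, mfderiv_extChartAt_symm_self, extChartAt_to_inv]
  rfl

theorem IsSmoothForm.smul {u : M → ℝ} (hu : ContMDiff (𝓡 n) 𝓘(ℝ, ℝ) ∞ u)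
    (hα : IsSmoothForm α) : IsSmoothForm (fun x => u x • α x) :=
  isSmoothForm_of_contDiffAt fun x₀ y hy => by
    have h1 : ContDiffAt ℝ ∞ (fun y => u ((extChartAt (𝓡 n) x₀).symm y)) y :=
      contMDiffAt_iff_contDiffAt.1 ((hu _).comp y (contMDiffAt_extChartAt_symm hy))
    exact h1.smul (hα.contDiffAt hy)

theorem extd_smul {u : M → ℝ} (hu : ContMDiff (𝓡 n) 𝓘(ℝ, ℝ) ∞ u) (hα : IsSmoothForm α) :
    extd (fun x => u x • α x) = fun x => u x • extd α x + wedge (dfun u x) (α x) := by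
  funext x
  have hy := mem_extChartAt_target (I := 𝓡 n) x
  have h1 : ContDiffAt ℝ ∞ (fun y => u ((extChartAt (𝓡 n) x).symm y)) (extChartAt (𝓡 n) x x) :=
    contMDiffAt_iff_contDiffAt.1 ((hu _).comp _ (contMDiffAt_extChartAt_symm hy))
  have h2 := extDeriv_smul_fun (h1.differentiableAt (by simp)) (hα.differentiableAt x)
  rw [chartRep_self, fderiv_comp_extChartAt_symm (hu.mdifferentiable (by simp) x)] at h2
  simp only [extChartAt_to_inv] at h2
  exact h2

end Operations

/-! ### Stokes' theorem on the simplex -/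

section Stokes

open MeasureTheory

/-- The simplex in the coordinates `t₁, …, t_k`. -/
def corner (k : ℕ) : Set (Fin k → ℝ) := {t | (∀ i, 0 ≤ t i) ∧ ∑ i, t i ≤ 1}

theorem isClosed_corner (k : ℕ) : IsClosed (corner k) := by
  have h : corner k = (⋂ i, {t : Fin k → ℝ | 0 ≤ t i}) ∩ {t | ∑ i, t i ≤ 1} := by
    ext t; simp [corner]
  rw [h]
  exact (isClosed_iInter fun i => isClosed_le continuous_const (continuous_apply i)).inter
    (isClosed_le (continuous_finsetSum _ fun i _ => continuous_apply i) continuous_const)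

theorem corner_subset (k : ℕ) : corner k ⊆ Set.Icc 0 1 := fun _ ht =>
  ⟨ht.1, fun i => (Finset.single_le_sum (fun j _ => ht.1 j) (Finset.mem_univ i)).trans ht.2⟩

theorem isCompact_corner (k : ℕ) : IsCompact (corner k) :=
  isCompact_Icc.of_isClosed_subset (isClosed_corner k) (corner_subset k)

theorem convex_corner (k : ℕ) : Convex ℝ (corner k) := by
  intro s hs t ht a b ha hb hab
  refine ⟨fun i => add_nonneg (mul_nonneg ha (hs.1 i)) (mul_nonneg hb (ht.1 i)), ?_⟩
  simp only [Pi.add_apply, Pi.smul_apply, smul_eq_mul, Finset.sum_add_distrib, ← Finset.mul_sum]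
  nlinarith [hs.2, ht.2]

theorem measurableSet_corner (k : ℕ) : MeasurableSet (corner k) := (isClosed_corner k).measurableSet

theorem insertNth_mem_corner {k : ℕ} (j : Fin (k + 1)) (u : ℝ) (s : Fin k → ℝ) :
    (j.insertNth u s : Fin (k + 1) → ℝ) ∈ corner (k + 1) ↔
      s ∈ corner k ∧ u ∈ Set.Icc 0 (1 - ∑ i, s i) := by
  simp only [corner, Set.mem_ofPred_eq, Fin.forall_iff_succAbove j, Fin.insertNth_apply_same,
    Fin.insertNth_apply_succAbove, Fin.sum_univ_succAbove _ j, Set.mem_Icc]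
  constructor
  · rintro ⟨⟨h1, h2⟩, h3⟩
    exact ⟨⟨h2, by linarith⟩, h1, by linarith⟩
  · rintro ⟨⟨h1, _⟩, h3, h4⟩
    exact ⟨⟨h3, h1⟩, by linarith⟩

theorem hasFDerivAt_insertNth {k : ℕ} (j : Fin (k + 1)) (s : Fin k → ℝ) (u : ℝ) :
    HasDerivAt (fun u : ℝ => (j.insertNth u s : Fin (k + 1) → ℝ)) (Pi.single j 1) u := by
  rw [hasDerivAt_pi]
  intro i
  refine Fin.succAboveCases j ?_ (fun i => ?_) i
  · simp only [Fin.insertNth_apply_same, Pi.single_eq_same]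
    exact hasDerivAt_id u
  · simpa [Fin.succAbove_ne] using hasDerivAt_const u (s i)

/-- Fubini with the coordinate j innermost, then the fundamental theorem of calculus on the interval
from 0 to 1 - ∑ sᵢ. -/
theorem setIntegral_corner_fderiv {k : ℕ} (j : Fin (k + 1)) {F : (Fin (k + 1) → ℝ) → ℂ}
    (hF : ∀ t ∈ corner (k + 1), ContDiffAt ℝ ∞ F t) :
    ∫ t in corner (k + 1), fderiv ℝ F t (Pi.single j 1) =
      ∫ s in corner k, (F (j.insertNth (1 - ∑ i, s i) s) - F (j.insertNth 0 s)) := by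
  set G : (Fin (k + 1) → ℝ) → ℂ := fun t => fderiv ℝ F t (Pi.single j 1) with hG
  have hGc : ContinuousOn G (corner (k + 1)) := fun t ht => by
    have h1 : ContDiffAt ℝ ∞ (fderiv ℝ F) t := (hF t ht).fderiv_right (m := ∞) (by simp)
    exact (h1.continuousAt.clm_apply continuousAt_const).continuousWithinAt
  have hint : Integrable (Set.indicator (corner (k + 1)) G) :=
    (hGc.integrableOn_compact (isCompact_corner _)).integrable_indicator (measurableSet_corner _)
  have hmp := (volume_preserving_piFinSuccAbove (fun _ : Fin (k + 1) => ℝ) j).symm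
  let e := (MeasurableEquiv.piFinSuccAbove (fun _ : Fin (k + 1) => ℝ) j).symm
  have he : ∀ z, e z = (j.insertNth z.1 z.2 : Fin (k + 1) → ℝ) := fun z => rfl
  rw [← integral_indicator (measurableSet_corner _), ← hmp.integral_comp']
  have hint' : Integrable (fun z : ℝ × (Fin k → ℝ) => Set.indicator (corner (k + 1)) G (e z))
      ((volume : Measure ℝ).prod volume) :=
    hmp.integrable_comp_of_integrable hint
  have h1 : ∫ z : ℝ × (Fin k → ℝ), Set.indicator (corner (k + 1)) G (e z) =
      ∫ s : Fin k → ℝ, ∫ u : ℝ, Set.indicator (corner (k + 1)) G (e (u, s)) :=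
    integral_prod_symm _ hint'
  refine h1.trans ?_
  rw [← integral_indicator (measurableSet_corner _)]
  congr 1
  funext s
  by_cases hs : s ∈ corner k
  · have hle : 0 ≤ 1 - ∑ i, s i := by linarith [hs.2]
    have h2 : (fun u : ℝ => Set.indicator (corner (k + 1)) G (e (u, s))) =
        Set.indicator (Set.Icc 0 (1 - ∑ i, s i)) fun u => G (j.insertNth u s) := by
      funext u
      rw [he]
      by_cases hu : u ∈ Set.Icc 0 (1 - ∑ i, s i)
      · rw [Set.indicator_of_mem hu, Set.indicator_of_mem ((insertNth_mem_corner j u s).2 ⟨hs, hu⟩)]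
      · rw [Set.indicator_of_notMem hu,
          Set.indicator_of_notMem fun h => hu ((insertNth_mem_corner j u s).1 h).2]
    rw [h2, Set.indicator_of_mem hs, integral_indicator measurableSet_Icc,
      integral_Icc_eq_integral_Ioc, ← intervalIntegral.integral_of_le hle]
    refine intervalIntegral.integral_eq_sub_of_hasDerivAt
      (f := fun u => F (j.insertNth u s)) (fun u hu => ?_) ?_
    · rw [Set.uIcc_of_le hle] at hu
      exact ((hF _ ((insertNth_mem_corner j u s).2 ⟨hs, hu⟩)).differentiableAt
        (by simp)).hasFDerivAt.comp_hasDerivAt u (hasFDerivAt_insertNth j s u)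
    · refine ContinuousOn.intervalIntegrable ?_
      rw [Set.uIcc_of_le hle]
      refine hGc.comp (fun u _ =>
        (hasFDerivAt_insertNth j s u).continuousAt.continuousWithinAt) fun u hu => ?_
      exact (insertNth_mem_corner j u s).2 ⟨hs, hu⟩
  · rw [Set.indicator_of_notMem hs]
    refine (integral_congr_ae (Filter.Eventually.of_forall fun u => ?_)).trans (integral_zero _ _)
    exact Set.indicator_of_notMem (fun h => hs ((insertNth_mem_corner j u s).1 h).1) _

/-- The measure-preserving involution `(u, r) ↦ (1 - ∑ r - u, r)`. -/
def reflectEquiv (k : ℕ) : ℝ × (Fin k → ℝ) ≃ᵐ ℝ × (Fin k → ℝ) where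
  toFun z := (1 - ∑ i, z.2 i - z.1, z.2)
  invFun z := (1 - ∑ i, z.2 i - z.1, z.2)
  left_inv z := by simp
  right_inv z := by simp
  measurable_toFun := by
    have h : Continuous fun z : ℝ × (Fin k → ℝ) => (1 - ∑ i, z.2 i - z.1, z.2) := by fun_prop
    exact h.measurable
  measurable_invFun := by
    have h : Continuous fun z : ℝ × (Fin k → ℝ) => (1 - ∑ i, z.2 i - z.1, z.2) := by fun_prop
    exact h.measurable

theorem measurePreserving_reflectEquiv (k : ℕ) :
    MeasurePreserving (reflectEquiv k) (volume : Measure (ℝ × (Fin k → ℝ))) volume := by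
  have h1 : MeasurePreserving (fun z : (Fin k → ℝ) × ℝ => (z.1, 1 - ∑ i, z.1 i - z.2))
      ((volume : Measure (Fin k → ℝ)).prod (volume : Measure ℝ))
      ((volume : Measure (Fin k → ℝ)).prod (volume : Measure ℝ)) := by
    refine (MeasurePreserving.id volume).skew_product
      (g := fun (r : Fin k → ℝ) u => 1 - ∑ i, r i - u) ?_ (Filter.Eventually.of_forall fun r => ?_)
    · refine Continuous.measurable ?_
      unfold Function.uncurry
      fun_prop
    · exact (Measure.measurePreserving_sub_left volume (1 - ∑ i, r i)).map_eq
  have h2 := (Measure.measurePreserving_swap (μ := (volume : Measure (Fin k → ℝ)))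
    (ν := (volume : Measure ℝ))).comp (h1.comp (Measure.measurePreserving_swap
    (μ := (volume : Measure ℝ)) (ν := (volume : Measure (Fin k → ℝ)))))
  exact h2

/-- The slanted face ∑ t = 1 is parametrised once by forgetting the coordinate j and once by
forgetting the coordinate 0. The change of parameters is a coordinate permutation combined with the
reflection `reflectEquiv`, so it preserves the measure and the corner. -/
theorem setIntegral_corner_insertNth {k : ℕ} (j : Fin (k + 1)) (F : (Fin (k + 1) → ℝ) → ℂ) :
    ∫ s in corner k, F (j.insertNth (1 - ∑ i, s i) s) =
      ∫ s in corner k, F (Fin.cons (1 - ∑ i, s i) s) := by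
  refine Fin.cases ?_ (fun i => ?_) j
  · simp
  · cases k with
    | zero => exact i.elim0
    | succ k =>
      let T : (Fin (k + 1) → ℝ) ≃ᵐ (Fin (k + 1) → ℝ) :=
        (MeasurableEquiv.piFinSuccAbove (fun _ : Fin (k + 1) => ℝ) 0).trans
          ((reflectEquiv k).trans (MeasurableEquiv.piFinSuccAbove (fun _ : Fin (k + 1) => ℝ) i).symm)
      have hT : MeasurePreserving T volume volume :=
        (((volume_preserving_piFinSuccAbove (fun _ : Fin (k + 1) => ℝ) i).symm).comp
          (measurePreserving_reflectEquiv k)).comp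
          (volume_preserving_piFinSuccAbove (fun _ : Fin (k + 1) => ℝ) 0)
      have hTs : ∀ s, T s = (i.insertNth (1 - ∑ l, s l) (Fin.tail s) : Fin (k + 1) → ℝ) := by
        intro s
        have : T s = (i.insertNth (1 - ∑ l, Fin.tail s l - s 0) (Fin.tail s) : Fin (k + 1) → ℝ) :=
          rfl
        rw [this, Fin.sum_univ_succ]
        congr 1
        simp only [Fin.tail]
        ring
      have hsum : ∀ s, 1 - ∑ l, T s l = s 0 := by
        intro s
        rw [hTs, Fin.sum_univ_succAbove _ i, Fin.insertNth_apply_same]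
        simp only [Fin.insertNth_apply_succAbove]
        rw [Fin.sum_univ_succ]
        simp only [Fin.tail]
        ring
      have hpre : T ⁻¹' corner (k + 1) = corner (k + 1) := by
        ext s
        rw [Set.mem_preimage, hTs, insertNth_mem_corner]
        conv_rhs => rw [← Fin.cons_self_tail s, ← Fin.insertNth_zero', insertNth_mem_corner]
        rw [Fin.sum_univ_succ]
        simp only [Fin.tail, Set.mem_Icc]
        constructor
        · rintro ⟨h1, h2, h3⟩; exact ⟨h1, by linarith, by linarith⟩
        · rintro ⟨h1, h2, h3⟩; exact ⟨h1, by linarith, by linarith⟩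
      have h := hT.setIntegral_preimage_emb T.measurableEmbedding
        (fun s => F (Fin.cons (1 - ∑ i, s i) s)) (corner (k + 1))
      rw [hpre] at h
      rw [← h]
      congr 1
      funext s
      congr 1
      rw [hsum, hTs]
      funext l
      refine Fin.cases ?_ (fun l => ?_) l
      · rw [Fin.cons_zero]
        have : (0 : Fin (k + 2)) = i.succ.succAbove 0 := by simp
        rw [this, Fin.insertNth_apply_succAbove]
      · rw [Fin.cons_succ]
        refine Fin.succAboveCases i ?_ (fun l => ?_) l
        · simp
        · rw [Fin.insertNth_apply_succAbove, ← Fin.succ_succAbove_succ,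
            Fin.insertNth_apply_succAbove]
          rfl

/-- Evaluate the alternating form c ∧ f. Replacing eᵢ by eᵢ - e₀ for i ≥ 1 does not change its
value; afterwards c vanishes on every vector but the first, and a single term of the expansion
remains. -/
theorem map_sub_first {X : Type*} [NormedAddCommGroup X] [NormedSpace ℝ X] {k : ℕ}
    (f : X [⋀^Fin k]→L[ℝ] ℂ) (e : Fin (k + 1) → X) (c : X →L[ℝ] ℝ) (hc : ∀ i, c (e i) = 1) :
    f (fun l => e l.succ - e 0) = ∑ j : Fin (k + 1), (-1 : ℂ) ^ (j : ℕ) * f (j.removeNth e) := by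
  have key : ∀ s : Finset (Fin (k + 1)), 0 ∉ s →
      wedge c f (fun i => if i ∈ s then e i - e 0 else e i) = wedge c f e := by
    intro s
    induction s using Finset.induction_on with
    | empty => simp
    | insert a s ha ih =>
      intro h0
      have h0s : (0 : Fin (k + 1)) ∉ s := fun h => h0 (Finset.mem_insert_of_mem h)
      have ha0 : a ≠ 0 := fun h => h0 (h ▸ Finset.mem_insert_self a s)
      rw [← ih h0s]
      set v : Fin (k + 1) → X := fun i => if i ∈ s then e i - e 0 else e i with hv
      have hv0 : v 0 = e 0 := by simp [hv, h0s]
      have hva : v a = e a := by simp [hv, ha]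
      have : (fun i => if i ∈ insert a s then e i - e 0 else e i) =
          Function.update v a (v a - v 0) := by
        funext i
        by_cases hi : i = a
        · subst hi; simp [hva, hv0]
        · simp [hi, hv]
      rw [this]
      have h2 := (wedge c f).toAlternatingMap.map_update_sub v a (v a) (v 0)
      have h3 := (wedge c f).toAlternatingMap.map_update_self v ha0
      rw [h3, Function.update_eq_self, sub_zero] at h2
      exact h2
  have h1 := key (Finset.univ.erase 0) (by simp)
  rw [wedge_apply, wedge_apply, Fin.sum_univ_succ] at h1
  have hz : ∑ i : Fin k, (-1 : ℤ) ^ (i.succ : ℕ) •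
      (c ((fun i => if i ∈ Finset.univ.erase 0 then e i - e 0 else e i) i.succ) •
        f (i.succ.removeNth (fun i => if i ∈ Finset.univ.erase 0 then e i - e 0 else e i))) = 0 :=
    Finset.sum_eq_zero fun i _ => by simp [hc]
  rw [hz, add_zero] at h1
  have h2 : ((0 : Fin (k + 1)).removeNth
      (fun i => if i ∈ Finset.univ.erase 0 then e i - e 0 else e i)) =
      fun l => e l.succ - e 0 := by
    funext l
    simp [Fin.removeNth]
  rw [h2] at h1
  simp only [hc, Fin.val_zero, pow_zero, one_smul] at h1
  simp only [Finset.mem_erase, ne_eq, not_true_eq_false, false_and, if_false, hc, one_smul] at h1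
  rw [h1]
  refine Finset.sum_congr rfl fun j _ => ?_
  rw [zsmul_eq_mul]
  push_cast
  rfl

/-- The `i`-th face of the simplex in the coordinates `t₁, …, t_k`. -/
def faceCoord {k : ℕ} (i : Fin (k + 2)) (s : Fin k → ℝ) : Fin (k + 1) → ℝ :=
  Fin.tail (i.insertNth 0 (Fin.cons (1 - ∑ l, s l) s : Fin (k + 1) → ℝ) : Fin (k + 2) → ℝ)

theorem faceCoord_zero {k : ℕ} (s : Fin k → ℝ) :
    faceCoord 0 s = Fin.cons (1 - ∑ l, s l) s := by
  simp [faceCoord]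

theorem faceCoord_succ {k : ℕ} (j : Fin (k + 1)) (s : Fin k → ℝ) :
    faceCoord j.succ s = (j.insertNth 0 s : Fin (k + 1) → ℝ) := by
  funext l
  rw [faceCoord, Fin.tail]
  refine Fin.succAboveCases j ?_ (fun l => ?_) l
  · simp
  · rw [Fin.insertNth_apply_succAbove, ← Fin.succ_succAbove_succ,
      Fin.insertNth_apply_succAbove, Fin.cons_succ]

theorem faceCoord_mem {k : ℕ} (i : Fin (k + 2)) {s : Fin k → ℝ} (hs : s ∈ corner k) :
    faceCoord i s ∈ corner (k + 1) := by
  have h0 : 0 ≤ 1 - ∑ i, s i := by linarith [hs.2]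
  refine Fin.cases ?_ (fun j => ?_) i
  · rw [faceCoord_zero, ← Fin.insertNth_zero', insertNth_mem_corner]
    exact ⟨hs, h0, le_rfl⟩
  · rw [faceCoord_succ, insertNth_mem_corner]
    exact ⟨hs, le_rfl, h0⟩

theorem contDiff_faceCoord {k : ℕ} (i : Fin (k + 2)) : ContDiff ℝ ∞ (faceCoord (k := k) i) := by
  rw [contDiff_pi]
  intro l
  refine Fin.cases ?_ (fun j => ?_) i
  · simp only [faceCoord_zero]
    refine Fin.cases ?_ (fun l => ?_) l
    · simp only [Fin.cons_zero]; fun_prop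
    · simp only [Fin.cons_succ]; fun_prop
  · simp only [faceCoord_succ]
    refine Fin.succAboveCases j ?_ (fun l => ?_) l
    · simp only [Fin.insertNth_apply_same]; fun_prop
    · simp only [Fin.insertNth_apply_succAbove]; fun_prop

theorem fderiv_faceCoord_apply {k : ℕ} (i : Fin (k + 2)) (s : Fin k → ℝ) (l : Fin k)
    {w : Fin (k + 1) → ℝ}
    (hw : ∀ u : ℝ, faceCoord i (s + u • Pi.single l 1) = faceCoord i s + u • w) :
    fderiv ℝ (faceCoord i) s (Pi.single l 1) = w := by
  have h1 := ((contDiff_faceCoord i).differentiable (by simp) s).hasFDerivAt.hasLineDerivAt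
    (Pi.single l 1)
  refine h1.lineDeriv.symm.trans (HasLineDerivAt.lineDeriv ?_)
  rw [HasLineDerivAt]
  simp only [hw]
  simpa using ((hasDerivAt_id (0 : ℝ)).smul_const w).const_add (faceCoord i s)

theorem fderiv_faceCoord_zero {k : ℕ} (s : Fin k → ℝ) (l : Fin k) :
    fderiv ℝ (faceCoord 0) s (Pi.single l 1) = Pi.single l.succ 1 - Pi.single 0 1 := by
  refine fderiv_faceCoord_apply 0 s l fun u => ?_
  rw [faceCoord_zero, faceCoord_zero]
  funext i
  refine Fin.cases ?_ (fun i => ?_) i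
  · simp [Finset.sum_add_distrib, ← Finset.mul_sum]
    ring
  · by_cases hi : i = l
    · subst hi; simp
    · simp [hi]

theorem fderiv_faceCoord_succ {k : ℕ} (j : Fin (k + 1)) (s : Fin k → ℝ) (l : Fin k) :
    fderiv ℝ (faceCoord j.succ) s (Pi.single l 1) = Pi.single (j.succAbove l) 1 := by
  refine fderiv_faceCoord_apply j.succ s l fun u => ?_
  rw [faceCoord_succ, faceCoord_succ]
  funext i
  refine Fin.succAboveCases j ?_ (fun i => ?_) i
  · simp [Fin.ne_succAbove]
  · by_cases hi : i = l
    · subst hi; simp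
    · simp [hi]

theorem integrableOn_corner_of_continuousAt {k : ℕ} {F : (Fin k → ℝ) → ℂ}
    (hF : ∀ t ∈ corner k, ContinuousAt F t) : IntegrableOn F (corner k) :=
  ContinuousOn.integrableOn_compact (isCompact_corner k) fun t ht => (hF t ht).continuousWithinAt

/-- Each partial derivative in dη integrates to a slanted face minus a coordinate face. The
coordinate faces are the faces 1, …, k + 1, with the right signs. The slanted terms are brought to a
common parametrisation and add up to the face 0, whose tangent vectors are differences of basis
vectors (`map_sub_first`). -/
theorem setIntegral_corner_extDeriv {k : ℕ}
    {η : (Fin (k + 1) → ℝ) → (Fin (k + 1) → ℝ) [⋀^Fin k]→L[ℝ] ℂ}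
    (hη : ∀ t ∈ corner (k + 1), ContDiffAt ℝ ∞ η t) :
    ∫ t in corner (k + 1), extDeriv η t (fun i => Pi.single i 1) =
      ∑ i : Fin (k + 2), (-1 : ℂ) ^ (i : ℕ) * ∫ s in corner k,
        (η (faceCoord i s)).compContinuousLinearMap (fderiv ℝ (faceCoord i) s)
          (fun l => Pi.single l 1) := by
  set e : Fin (k + 1) → Fin (k + 1) → ℝ := fun i => Pi.single i 1 with he
  let F : Fin (k + 1) → (Fin (k + 1) → ℝ) → ℂ := fun j t => η t (j.removeNth e)
  have hF : ∀ j, ∀ t ∈ corner (k + 1), ContDiffAt ℝ ∞ (F j) t := fun j t ht =>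
    contDiffAt_alternating_iff.1 (hη t ht) _
  have h1 : ∀ t ∈ corner (k + 1), extDeriv η t e =
      ∑ j : Fin (k + 1), (-1 : ℂ) ^ (j : ℕ) * fderiv ℝ (F j) t (Pi.single j 1) := by
    intro t ht
    have hd : DifferentiableAt ℝ η t := (hη t ht).differentiableAt (by simp)
    rw [extDeriv_apply hd]
    refine Finset.sum_congr rfl fun j _ => ?_
    have : fderiv ℝ (F j) t = (ContinuousAlternatingMap.apply ℝ (Fin (k + 1) → ℝ) ℂ
        (j.removeNth e)).comp (fderiv ℝ η t) :=
      ((ContinuousAlternatingMap.apply ℝ (Fin (k + 1) → ℝ) ℂ (j.removeNth e)).hasFDerivAt.comp t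
        hd.hasFDerivAt).fderiv
    rw [this, zsmul_eq_mul]
    push_cast
    rfl
  have hc1 : ∀ j : Fin (k + 1), ∀ s ∈ corner k,
      ContinuousAt (fun s : Fin k → ℝ => F j (j.insertNth 0 s)) s := fun j s hs => by
    have := ((hF j _ (faceCoord_mem j.succ hs)).continuousAt).comp
      ((contDiff_faceCoord j.succ).continuous.continuousAt (x := s))
    simpa only [Function.comp_def, faceCoord_succ] using this
  have hc0 : ∀ j : Fin (k + 1), IntegrableOn
      (fun s : Fin k → ℝ => F j (j.insertNth (1 - ∑ i, s i) s)) (corner k) := fun j => by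
    refine ContinuousOn.integrableOn_compact (isCompact_corner k) ?_
    have hcont : Continuous fun s : Fin k → ℝ =>
        (j.insertNth (1 - ∑ i, s i) s : Fin (k + 1) → ℝ) := by
      refine continuous_pi fun i => ?_
      refine Fin.succAboveCases j ?_ (fun i => ?_) i
      · simp only [Fin.insertNth_apply_same]; fun_prop
      · simp only [Fin.insertNth_apply_succAbove]; fun_prop
    intro s hs
    have hm : (j.insertNth (1 - ∑ i, s i) s : Fin (k + 1) → ℝ) ∈ corner (k + 1) :=
      (insertNth_mem_corner _ _ _).2 ⟨hs, by linarith [hs.2], le_rfl⟩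
    exact ((hF j _ hm).continuousAt.comp_of_eq hcont.continuousAt rfl).continuousWithinAt
  have hcz : ∀ j : Fin (k + 1), IntegrableOn
      (fun s : Fin k → ℝ => F j (Fin.cons (1 - ∑ i, s i) s)) (corner k) := fun j =>
    integrableOn_corner_of_continuousAt fun s hs => by
      have := ((hF j _ (faceCoord_mem 0 hs)).continuousAt).comp
        ((contDiff_faceCoord 0).continuous.continuousAt (x := s))
      simpa only [Function.comp_def, faceCoord_zero] using this
  have hint : ∀ j : Fin (k + 1), IntegrableOn
      (fun t => (-1 : ℂ) ^ (j : ℕ) * fderiv ℝ (F j) t (Pi.single j 1)) (corner (k + 1)) := fun j =>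
    (integrableOn_corner_of_continuousAt fun t ht => by
      have h1 : ContDiffAt ℝ ∞ (fderiv ℝ (F j)) t := (hF j t ht).fderiv_right (m := ∞) (by simp)
      exact h1.continuousAt.clm_apply continuousAt_const).const_mul _
  rw [setIntegral_congr_fun (measurableSet_corner _) h1, integral_finsetSum _ fun j _ => hint j,
    Fin.sum_univ_succ (n := k + 1)]
  have hz : ∫ s in corner k, (η (faceCoord 0 s)).compContinuousLinearMap
      (fderiv ℝ (faceCoord 0) s) (fun l => Pi.single l 1) =
      ∑ j : Fin (k + 1), (-1 : ℂ) ^ (j : ℕ) *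
        ∫ s in corner k, F j (Fin.cons (1 - ∑ i, s i) s) := by
    simp only [← integral_const_mul]
    rw [← integral_finsetSum _ fun j _ => (hcz j).const_mul _]
    congr 1
    funext s
    let c : (Fin (k + 1) → ℝ) →L[ℝ] ℝ := ∑ i, ContinuousLinearMap.proj i
    have := map_sub_first (η (faceCoord 0 s)) e c (fun i => by simp [c, he])
    rw [faceCoord_zero] at this ⊢
    rw [← this, ContinuousAlternatingMap.compContinuousLinearMap_apply]
    congr 1
    funext l
    exact fderiv_faceCoord_zero s l
  have hsucc : ∀ j : Fin (k + 1), ∫ s in corner k,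
      (η (faceCoord j.succ s)).compContinuousLinearMap (fderiv ℝ (faceCoord j.succ) s)
        (fun l => Pi.single l 1) = ∫ s in corner k, F j (j.insertNth 0 s) := by
    intro j
    congr 1
    funext s
    rw [ContinuousAlternatingMap.compContinuousLinearMap_apply, faceCoord_succ]
    simp only [F]
    congr 1
    funext l
    exact fderiv_faceCoord_succ j s l
  rw [hz]
  simp only [hsucc, Fin.val_zero, pow_zero, one_mul, Fin.val_succ]
  rw [← Finset.sum_add_distrib]
  refine Finset.sum_congr rfl fun j _ => ?_
  rw [integral_const_mul, setIntegral_corner_fderiv j (hF j), integral_sub (hc0 j)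
    (integrableOn_corner_of_continuousAt (hc1 j)), setIntegral_corner_insertNth]
  ring

end Stokes

/-! ### Integration over smooth simplices -/

section SmoothSimplices

open MeasureTheory

variable {n : ℕ} {M : Type*} [TopologicalSpace M] [ChartedSpace (EuclideanSpace ℝ (Fin n)) M]

/-- Barycentric coordinates from the coordinates `t₁, …, t_k`. -/
def baryCoord {k : ℕ} (t : Fin k → ℝ) : Fin (k + 1) → ℝ := Fin.cons (1 - ∑ i, t i) t

theorem baryCoord_mem {k : ℕ} {t : Fin k → ℝ} :
    baryCoord t ∈ stdSimplex ℝ (Fin (k + 1)) ↔ t ∈ corner k := by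
  simp only [stdSimplex, corner, baryCoord, Set.mem_ofPred_eq, Fin.forall_fin_succ, Fin.cons_zero,
    Fin.cons_succ, Fin.sum_univ_succ]
  constructor
  · rintro ⟨⟨h1, h2⟩, _⟩; exact ⟨h2, by linarith⟩
  · rintro ⟨h1, h2⟩; exact ⟨⟨by linarith, h1⟩, by ring⟩

theorem contDiff_baryCoord {k : ℕ} : ContDiff ℝ ∞ (baryCoord (k := k)) := by
  rw [contDiff_pi]
  intro i
  refine Fin.cases ?_ (fun i => ?_) i
  · simp only [baryCoord, Fin.cons_zero]; fun_prop
  · simp only [baryCoord, Fin.cons_succ]; fun_prop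

theorem simplexCoord_of_mem {X : Type*} {k : ℕ} (σ : Simplex k → X) {t : Fin k → ℝ}
    (ht : t ∈ corner k) : simplexCoord σ t = σ ⟨baryCoord t, baryCoord_mem.2 ht⟩ :=
  dif_pos (baryCoord_mem.2 ht)

/-- The function `G` is smooth near the simplex and equals `σ` there, in the coordinates
`t₁, …, t_k`. -/
def IsParam (n : ℕ) [ChartedSpace (EuclideanSpace ℝ (Fin n)) M] {k : ℕ} (σ : Simplex k → M)
    (G : (Fin k → ℝ) → M) : Prop :=
  ∀ t ∈ corner k, ContMDiffAt 𝓘(ℝ, Fin k → ℝ) (𝓡 n) ∞ G t ∧ G t = simplexCoord σ t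

/-- `simplexCoord` has a junk value outside the simplex, so its derivative is that of G only in the
interior. The boundary of a convex set is a null set. -/
theorem integrate_eq {k : ℕ} {σ : Simplex k → M} {G : (Fin k → ℝ) → M} (hG : IsParam n σ G)
    (α : DForm n M k) :
    integrate α σ = ∫ t in corner k, pullForm G α t (fun i => Pi.single i 1) := by
  have h0 : integrate α σ = ∫ t in corner k, pullForm (simplexCoord σ) α t
    (fun i => Pi.single i 1) := rfl
  rw [h0]
  refine setIntegral_congr_ae (measurableSet_corner k) ?_
  have hfr : ∀ᵐ t : Fin k → ℝ, t ∉ frontier (corner k) :=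
    measure_eq_zero_iff_ae_notMem.1 ((convex_corner k).addHaar_frontier volume)
  filter_upwards [hfr] with t ht htc
  have hint : t ∈ interior (corner k) := by
    rw [frontier, (isClosed_corner k).closure_eq] at ht
    by_contra h
    exact ht ⟨htc, h⟩
  have heq : simplexCoord σ =ᶠ[𝓝 t] G := by
    filter_upwards [mem_interior_iff_mem_nhds.1 hint] with s hs
    exact (hG s hs).2.symm
  have hm : mfderiv 𝓘(ℝ, Fin k → ℝ) (𝓡 n) (simplexCoord σ) t =
      mfderiv 𝓘(ℝ, Fin k → ℝ) (𝓡 n) G t := heq.mfderiv_eq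
  have hv : simplexCoord σ t = G t := heq.eq_of_nhds
  simp only [pullForm, hm, hv]

theorem pullForm_comp [IsManifold (𝓡 n) ∞ M] {X Y : Type*} [NormedAddCommGroup X] [NormedSpace ℝ X]
    [NormedAddCommGroup Y] [NormedSpace ℝ Y] {p : ℕ} {G : Y → M} {a : X → Y} {x : X}
    (α : DForm n M p)
    (hG : MDifferentiableAt 𝓘(ℝ, Y) (𝓡 n) G (a x)) (ha : DifferentiableAt ℝ a x) :
    pullForm (fun z => G (a z)) α x =
      (pullForm G α (a x)).compContinuousLinearMap (fderiv ℝ a x) := by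
  have h := mfderiv_comp x hG ha.mdifferentiableAt
  rw [mfderiv_eq_fderiv] at h
  ext v
  simp only [pullForm, ContinuousAlternatingMap.compContinuousLinearMap_apply]
  have h' : mfderiv 𝓘(ℝ, X) (𝓡 n) (fun z => G (a z)) x =
    (mfderiv 𝓘(ℝ, Y) (𝓡 n) G (a x)).comp (fderiv ℝ a x) := h
  rw [h']
  rfl

/-- The map induced on coordinates `t₁, …, t_k` by a map of vertices. -/
def vertexMapCoord {a b : ℕ} (θ : Fin (a + 1) → Fin (b + 1)) (t : Fin a → ℝ) : Fin b → ℝ :=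
  Fin.tail (FunOnFinite.linearMap ℝ ℝ θ (baryCoord t))

theorem baryCoord_vertexMapCoord {a b : ℕ} (θ : Fin (a + 1) → Fin (b + 1)) (t : Fin a → ℝ) :
    baryCoord (vertexMapCoord θ t) = FunOnFinite.linearMap ℝ ℝ θ (baryCoord t) := by
  classical
  have hsum : ∑ j, FunOnFinite.linearMap ℝ ℝ θ (baryCoord t) j = 1 := by
    simp only [FunOnFinite.linearMap_apply_apply]
    rw [Finset.sum_fiberwise]
    simp [baryCoord, Fin.sum_univ_succ]
  rw [Fin.sum_univ_succ] at hsum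
  funext j
  refine Fin.cases ?_ (fun j => ?_) j
  · simp only [baryCoord, Fin.cons_zero, vertexMapCoord, Fin.tail] at hsum ⊢
    linarith
  · simp [baryCoord, vertexMapCoord, Fin.tail]

theorem vertexMapCoord_mem {a b : ℕ} (θ : Fin (a + 1) → Fin (b + 1)) {t : Fin a → ℝ}
    (ht : t ∈ corner a) : vertexMapCoord θ t ∈ corner b := by
  rw [← baryCoord_mem, baryCoord_vertexMapCoord]
  exact (stdSimplex.map θ ⟨_, baryCoord_mem.2 ht⟩).2

theorem contDiff_vertexMapCoord {a b : ℕ} (θ : Fin (a + 1) → Fin (b + 1)) :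
    ContDiff ℝ ∞ (vertexMapCoord θ) := by
  have h1 : ContDiff ℝ ∞ fun t : Fin a → ℝ => FunOnFinite.linearMap ℝ ℝ θ (baryCoord t) :=
    (LinearMap.toContinuousLinearMap (FunOnFinite.linearMap ℝ ℝ θ)).contDiff.comp
      contDiff_baryCoord
  rw [contDiff_pi] at h1 ⊢
  exact fun j => h1 j.succ

theorem simplexCoord_comp_map {X : Type*} {a b : ℕ} (θ : Fin (a + 1) → Fin (b + 1))
    (σ : Simplex b → X)
    {t : Fin a → ℝ} (ht : t ∈ corner a) :
    simplexCoord (σ ∘ stdSimplex.map θ) t = simplexCoord σ (vertexMapCoord θ t) := by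
  rw [simplexCoord_of_mem _ ht, simplexCoord_of_mem _ (vertexMapCoord_mem θ ht)]
  simp only [Function.comp]
  congr 1
  exact Subtype.ext (baryCoord_vertexMapCoord θ t).symm

theorem IsParam.map {a b : ℕ} {σ : Simplex b → M} {G : (Fin b → ℝ) → M} (hG : IsParam n σ G)
    (θ : Fin (a + 1) → Fin (b + 1)) :
    IsParam n (σ ∘ stdSimplex.map θ) (fun t => G (vertexMapCoord θ t)) := fun t ht => by
  have h := hG _ (vertexMapCoord_mem θ ht)
  refine ⟨h.1.comp t (contDiff_vertexMapCoord θ).contMDiff.contMDiffAt, ?_⟩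
  rw [simplexCoord_comp_map θ σ ht, ← h.2]

theorem vertexMapCoord_succAbove {k : ℕ} (i : Fin (k + 2)) :
    vertexMapCoord i.succAbove = faceCoord (k := k) i := by
  classical
  funext t
  have : FunOnFinite.linearMap ℝ ℝ i.succAbove (baryCoord t) =
      (i.insertNth 0 (baryCoord t) : Fin (k + 2) → ℝ) := by
    funext j
    rw [FunOnFinite.linearMap_apply_apply]
    refine Fin.succAboveCases i ?_ (fun j => ?_) j
    · rw [Fin.insertNth_apply_same, Finset.filter_false_of_mem, Finset.sum_empty]
      exact fun l _ => Fin.succAbove_ne i l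
    · rw [Fin.insertNth_apply_succAbove]
      have : (Finset.univ.filter fun l => i.succAbove l = i.succAbove j) = {j} := by
        ext l; simp
      rw [this, Finset.sum_singleton]
  rw [vertexMapCoord, this]
  rfl

theorem IsParam.face {k : ℕ} {σ : Simplex (k + 1) → M} {G : (Fin (k + 1) → ℝ) → M}
    (hG : IsParam n σ G) (i : Fin (k + 2)) :
    IsParam n (σ ∘ face i) (fun t => G (faceCoord i t)) := by
  rw [← vertexMapCoord_succAbove]
  exact hG.map i.succAbove

/-- Stokes' theorem for smooth singular simplices. -/
theorem integrate_extd [IsManifold (𝓡 n) ∞ M] {k : ℕ} {σ : Simplex (k + 1) → M}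
    {G : (Fin (k + 1) → ℝ) → M} (hG : IsParam n σ G) {η : DForm n M k} (hη : IsSmoothForm η) :
    integrate (extd η) σ =
      ∑ i : Fin (k + 2), (-1 : ℂ) ^ (i : ℕ) * integrate η (σ ∘ face i) := by
  rw [integrate_eq hG, setIntegral_congr_fun (measurableSet_corner _)
    (g := fun t => extDeriv (pullForm G η) t (fun i => Pi.single i 1))
    (fun t ht => congrArg (fun β => β fun i => Pi.single i 1)
      (extDeriv_pullForm hη (hG t ht).1).symm),
    setIntegral_corner_extDeriv fun t ht => hη.pullForm (hG t ht).1]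
  refine Finset.sum_congr rfl fun i _ => ?_
  rw [integrate_eq (hG.face i)]
  congr 1
  refine setIntegral_congr_fun (measurableSet_corner _) fun s hs => ?_
  rw [pullForm_comp η ((hG _ (faceCoord_mem i hs)).1.mdifferentiableAt (by simp))
    ((contDiff_faceCoord i).differentiable (by simp) s)]

theorem integrate_zero {k : ℕ} (σ : Simplex k → M) : integrate (0 : DForm n M k) σ = 0 := by
  rw [integrate]
  change (∫ _ in _, (0 : ℂ)) = 0
  simp

theorem integrate_add [IsManifold (𝓡 n) ∞ M] {k : ℕ} {σ : Simplex k → M} {G : (Fin k → ℝ) → M}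
    (hG : IsParam n σ G) {α β : DForm n M k} (hα : IsSmoothForm α) (hβ : IsSmoothForm β) :
    integrate (α + β) σ = integrate α σ + integrate β σ := by
  rw [integrate_eq hG, integrate_eq hG, integrate_eq hG, ← integral_add]
  · rfl
  · exact integrableOn_corner_of_continuousAt fun t ht =>
      (contDiffAt_alternating_iff.1 (hα.pullForm (hG t ht).1) _).continuousAt
  · exact integrableOn_corner_of_continuousAt fun t ht =>
      (contDiffAt_alternating_iff.1 (hβ.pullForm (hG t ht).1) _).continuousAt

theorem integrate_const_smul {k : ℕ} (σ : Simplex k → M) (c : ℂ) (α : DForm n M k) :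
    integrate (c • α) σ = c * integrate α σ := by
  rw [integrate, integrate, ← integral_const_mul]
  rfl

/-- A thickening of the convex compact simplex is open and convex. Convexity is what allows the
extension itself, not just the simplex, to be lifted to a covering. -/
theorem IsSmoothSimplex.exists_convex {k : ℕ} {σ : Simplex k → M} (hσ : IsSmoothSimplex n σ) :
    ∃ (V : Set (Fin k → ℝ)) (G : (Fin k → ℝ) → M), IsOpen V ∧ Convex ℝ V ∧ corner k ⊆ V ∧
      (∀ t ∈ V, ContMDiffAt 𝓘(ℝ, Fin k → ℝ) (𝓡 n) ∞ G t) ∧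
      ∀ t ∈ corner k, G t = simplexCoord σ t := by
  obtain ⟨U, F, hU, hsub, hF, heq⟩ := hσ
  have hW : IsOpen (baryCoord (k := k) ⁻¹' U) := hU.preimage contDiff_baryCoord.continuous
  have hcW : corner k ⊆ baryCoord (k := k) ⁻¹' U := fun t ht => hsub (baryCoord_mem.2 ht)
  obtain ⟨δ, hδ, hsubδ⟩ := (isCompact_corner k).exists_thickening_subset_open hW hcW
  refine ⟨Metric.thickening δ (corner k), fun t => F (baryCoord t), Metric.isOpen_thickening,
    (convex_corner k).thickening δ, Metric.self_subset_thickening hδ _, fun t ht => ?_,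
    fun t ht => ?_⟩
  · exact (hF.contMDiffAt (hU.mem_nhds (hsubδ ht))).comp t
      contDiff_baryCoord.contMDiff.contMDiffAt
  · rw [simplexCoord_of_mem σ ht, ← heq]
    rfl

theorem zero_mem_corner (k : ℕ) : (0 : Fin k → ℝ) ∈ corner k := by simp [corner]

theorem tail_mem_corner {k : ℕ} (x : Simplex k) : Fin.tail x.1 ∈ corner k := by
  have h := x.2.2
  rw [Fin.sum_univ_succ] at h
  exact ⟨fun i => x.2.1 i.succ, by have := x.2.1 0; simp only [Fin.tail]; linarith⟩

theorem baryCoord_tail {k : ℕ} (x : Simplex k) :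
    baryCoord (Fin.tail x.1) = x.1 := by
  have h := x.2.2
  rw [Fin.sum_univ_succ] at h
  funext i
  refine Fin.cases ?_ (fun i => ?_) i
  · simp only [baryCoord, Fin.cons_zero, Fin.tail]; linarith
  · rfl

end SmoothSimplices

/-! ### The connection in terms of suffix products -/

section SuffixConnection

variable {Γ : Type*} {V : Type*} [AddCommGroup V] [Module ℂ V]

/-- The part of `∇^{0,1}` that repeats an entry, in terms of suffix products. -/
def repeatDiff {q : ℕ} (w : Chain Γ V q) : Chain Γ V (q + 1) :=
  open Classical in fun y => ∑ i : Fin (q + 1),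
    if y i.castSucc = y i.succ then (-1 : ℂ) ^ (i : ℕ) • w (fun j => y (i.castSucc.succAbove j))
    else 0

theorem castSucc_succAbove_last {q : ℕ} (i : Fin (q + 1)) :
    i.castSucc.succAbove (Fin.last q) = Fin.last (q + 1) := by
  rw [Fin.succAbove_of_le_castSucc _ _ (Fin.castSucc_le_castSucc_iff.2 (Fin.le_last i))]
  rfl

theorem castSucc_succAbove_castSucc {q : ℕ} (i : Fin (q + 1)) (j : Fin q) :
    i.castSucc.succAbove j.castSucc = (i.succAbove j).castSucc :=
  Fin.castSucc_succAbove_castSucc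

open Classical in
-- Splitting off the last entry isolates the one term in which it is the repeated entry; this is the
-- recursion behind the inductions below.
theorem repeatDiff_snoc {q : ℕ} (w : Chain Γ V (q + 1)) (y : Fin (q + 2) → Γ) (z : Γ) :
    repeatDiff w (Fin.snoc y z) =
      repeatDiff (fun y' : Fin (q + 1) → Γ => w (Fin.snoc y' z)) y +
      if y (Fin.last _) = z then (-1 : ℂ) ^ (q + 1) • w y else 0 := by
  rw [repeatDiff, Fin.sum_univ_castSucc]
  congr 1
  · refine Finset.sum_congr rfl fun i _ => ?_
    have e : (fun j => (Fin.snoc y z : Fin (q + 3) → Γ) (i.castSucc.castSucc.succAbove j)) =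
        (Fin.snoc (fun j => y (i.castSucc.succAbove j)) z : Fin (q + 2) → Γ) := by
      funext j
      refine Fin.lastCases ?_ (fun j => ?_) j
      · rw [castSucc_succAbove_last, Fin.snoc_last, Fin.snoc_last]
      · rw [castSucc_succAbove_castSucc, Fin.snoc_castSucc, Fin.snoc_castSucc]
    rw [e, Fin.snoc_castSucc, Fin.succ_castSucc, Fin.snoc_castSucc]
    rfl
  · have e0 : (Fin.snoc y z : Fin (q + 3) → Γ) (Fin.last (q + 1)).succ = z := by
      rw [Fin.succ_last, Fin.snoc_last]
    rw [Fin.snoc_castSucc, e0]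
    split_ifs with h
    · congr 2
      funext j
      refine Fin.lastCases ?_ (fun j => ?_) j
      · rw [castSucc_succAbove_last, Fin.snoc_last, h]
      · rw [castSucc_succAbove_castSucc, Fin.snoc_castSucc, Fin.succAbove_last]
    · rfl

open Classical in
theorem repeatDiff_zero_apply (w : Chain Γ V 0) (y : Fin 2 → Γ) :
    repeatDiff w y = if y 0 = y 1 then w (fun _ => y 1) else 0 := by
  have e : (fun j : Fin 1 => y ((0 : Fin 2).succAbove j)) = fun _ => y 1 := by
    funext j; fin_cases j; rfl
  rw [repeatDiff]
  refine (Fin.sum_univ_one _).trans ?_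
  change (if y 0 = y 1 then (-1 : ℂ) ^ 0 • w (fun j : Fin 1 => y ((0 : Fin 2).succAbove j)) else 0)
    = _
  rw [e, pow_zero, one_smul]

theorem repeatDiff_add {q : ℕ} (w w' : Chain Γ V q) :
    repeatDiff (w + w') = repeatDiff w + repeatDiff w' := by
  classical
  funext y
  simp only [repeatDiff, Pi.add_apply, smul_add, ← Finset.sum_add_distrib]
  refine Finset.sum_congr rfl fun i _ => ?_
  split_ifs <;> simp

theorem repeatDiff_map {V' : Type*} [AddCommGroup V'] [Module ℂ V'] (L : V →ₗ[ℂ] V') {q : ℕ}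
    (w : Chain Γ V q) (y : Fin (q + 2) → Γ) :
    repeatDiff (fun y => L (w y)) y = L (repeatDiff w y) := by
  classical
  simp only [repeatDiff, map_sum]
  refine Finset.sum_congr rfl fun i _ => ?_
  split_ifs <;> simp

open Classical in
theorem repeatDiff_ite_last {q : ℕ} (w : Chain Γ V q) (z : Γ) (c : ℂ) (y : Fin (q + 2) → Γ) :
    repeatDiff (fun y => if y (Fin.last _) = z then c • w y else 0) y =
      if y (Fin.last _) = z then c • repeatDiff w y else 0 := by
  simp only [repeatDiff, castSucc_succAbove_last]
  by_cases h : y (Fin.last _) = z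
  · simp only [if_pos h, Finset.smul_sum]
    refine Finset.sum_congr rfl fun i _ => ?_
    split_ifs
    · rw [smul_comm]
    · simp
  · simp [if_neg h]

/-- Induction by `repeatDiff_snoc`: the two mixed terms, with the last entry repeated by the inner
or by the outer operator, carry opposite signs. -/
theorem repeatDiff_repeatDiff : ∀ {q : ℕ} (w : Chain Γ V q), repeatDiff (repeatDiff w) = 0 := by
  classical
  intro q
  induction q with
  | zero =>
    intro w
    funext y
    have h := repeatDiff_snoc (repeatDiff w) (Fin.init y) (y (Fin.last _))
    rw [Fin.snoc_init_self] at h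
    rw [h]
    rw [repeatDiff_zero_apply, repeatDiff_zero_apply, repeatDiff_zero_apply]
    have e1 : ∀ u z : Γ, (Fin.snoc (fun _ : Fin 1 => u) z : Fin 2 → Γ) 0 = u := fun _ _ => rfl
    have e2 : ∀ u z : Γ, (Fin.snoc (fun _ : Fin 1 => u) z : Fin 2 → Γ) 1 = z := fun _ _ => rfl
    have e3 : (Fin.init y : Fin 2 → Γ) (Fin.last (0 + 1)) = (Fin.init y : Fin 2 → Γ) 1 := rfl
    rw [e1, e2, e3]
    by_cases h1 : (Fin.init y : Fin 2 → Γ) 0 = (Fin.init y : Fin 2 → Γ) 1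
    · by_cases h2 : (Fin.init y : Fin 2 → Γ) 1 = y (Fin.last 2)
      · rw [if_pos h1, if_pos h2, if_pos h2, if_pos h1, h2]; simp
      · rw [if_pos h1, if_neg h2, if_neg h2]; simp
    · rw [if_neg h1, if_neg h1]; simp
  | succ q ih =>
    intro w
    funext y
    have h := repeatDiff_snoc (repeatDiff w) (Fin.init y) (y (Fin.last _))
    rw [Fin.snoc_init_self] at h
    rw [h]
    set z := y (Fin.last _)
    have h2 : (fun y' : Fin (q + 1 + 1) → Γ => repeatDiff w (Fin.snoc y' z)) =
        repeatDiff (fun y' : Fin (q + 1) → Γ => w (Fin.snoc y' z)) +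
        fun y' => if y' (Fin.last _) = z then (-1 : ℂ) ^ (q + 1) • w y' else 0 := by
      funext y'
      exact repeatDiff_snoc w y' z
    rw [h2, repeatDiff_add, ih, zero_add, repeatDiff_ite_last]
    split_ifs
    · rw [pow_succ _ (q + 1), mul_neg_one, neg_smul, add_neg_cancel]; rfl
    · simp

/-- `∇^{0,1}` in terms of suffix products; `T g` is multiplication by `L_g^* h`. -/
def suffixConn (T : Γ → V →ₗ[ℂ] V) {q : ℕ} (w : Chain Γ V q) : Chain Γ V (q + 1) := fun y =>
  repeatDiff w y - (-1 : ℂ) ^ q • T (y (Fin.last _)) (w (Fin.init y))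

open Classical in
-- The square of `repeatDiff` is zero, and repetitions away from the appended entry cancel in the
-- two mixed terms. What survives is the repetition of an entry just appended, and the double
-- append.
theorem suffixConn_suffixConn (T : Γ → V →ₗ[ℂ] V) {q : ℕ} (w : Chain Γ V q)
    (y : Fin (q + 3) → Γ) :
    suffixConn T (suffixConn T w) y =
      T (y (Fin.last _)) ((if Fin.init y (Fin.last _) = y (Fin.last _) then
        w (Fin.init (Fin.init y)) else 0) - T (Fin.init y (Fin.last _))
          (w (Fin.init (Fin.init y)))) := by
  obtain ⟨x, z, rfl⟩ : ∃ (x : Fin (q + 2) → Γ) (z : Γ), y = Fin.snoc x z :=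
    ⟨Fin.init y, y (Fin.last _), (Fin.snoc_init_self y).symm⟩
  rw [suffixConn, Fin.snoc_last, Fin.init_snoc]
  have h1 : suffixConn T w = repeatDiff w +
      fun y => -((-1 : ℂ) ^ q • T (y (Fin.last _)) (w (Fin.init y))) := by
    funext y; rw [suffixConn, sub_eq_add_neg]; rfl
  have h2 : repeatDiff (suffixConn T w) (Fin.snoc x z) =
      -((-1 : ℂ) ^ q • T z (repeatDiff w x)) +
      if x (Fin.last _) = z then T z (w (Fin.init x)) else 0 := by
    rw [h1, repeatDiff_add, repeatDiff_repeatDiff, zero_add, repeatDiff_snoc]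
    simp only [Fin.snoc_last, Fin.init_snoc]
    have := repeatDiff_map (-((-1 : ℂ) ^ q • T z)) w x
    simp only [LinearMap.neg_apply, LinearMap.smul_apply] at this
    rw [this]
    congr 1
    split_ifs with h
    · rw [h, smul_neg, smul_smul, ← neg_smul, ← pow_add, show q + 1 + q = 2 * q + 1 by ring]
      simp [pow_succ]
    · rfl
  rw [h2, h1]
  simp only [Pi.add_apply, map_add, map_neg, map_smul, map_sub, smul_add, smul_neg, smul_smul]
  rw [show (-1 : ℂ) ^ (q + 1) * (-1) ^ q = -1 by
    rw [← pow_add, show q + 1 + q = 2 * q + 1 by ring]; simp [pow_succ], pow_succ]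
  split_ifs <;> simp only [mul_neg_one, neg_smul, one_smul, map_zero] <;> abel

end SuffixConnection

/-! ### From tensor factors to suffix products -/

section SuffixCoordinates

variable {Γ : Type*} [Group Γ] {V : Type*} [AddCommGroup V] [Module ℂ V]

/-- Two equal consecutive suffix products mean that the factor between them is 1; deleting that
factor is deleting the repetition. -/
theorem fromY_succAbove {q : ℕ} {y : Fin (q + 2) → Γ} {i : Fin (q + 1)}
    (hi : y i.castSucc = y i.succ) :
    (fun j => fromY y (i.castSucc.succAbove j)) = fromY fun j => y (i.castSucc.succAbove j) := by
  funext j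
  refine Fin.lastCases ?_ (fun j => ?_) j
  · rw [fromY_last, castSucc_succAbove_last, fromY_last]
  · rw [castSucc_succAbove_castSucc, fromY_castSucc, fromY_castSucc, castSucc_succAbove_castSucc]
    congr 2
    by_cases h : j.castSucc < i
    · rw [Fin.succAbove_of_castSucc_lt _ _ h]
      by_cases h' : j.succ < i
      · rw [Fin.succAbove_of_castSucc_lt i.castSucc j.succ
          (Fin.castSucc_lt_castSucc_iff.2 h')]
        rfl
      · have e : j.succ = i := le_antisymm (Fin.castSucc_lt_iff_succ_le.1 h) (not_lt.1 h')
        rw [Fin.succAbove_of_le_castSucc i.castSucc j.succ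
          (Fin.castSucc_le_castSucc_iff.2 (not_lt.1 h')), e, ← hi, ← e]
        rfl
    · have h1 : i ≤ j.castSucc := not_lt.1 h
      rw [Fin.succAbove_of_le_castSucc _ _ h1, Fin.succAbove_of_le_castSucc i.castSucc j.succ
        (Fin.castSucc_le_castSucc_iff.2 (h1.trans (Fin.castSucc_lt_succ).le))]

/-- A factor 1 in a place other than the last is a repeated suffix product. The last term of d,
which puts 1 at the end, cancels against the summand 1 ⊗ 1 of the connection form. The other summand
h(g m) g⁻¹ ⊗ g leaves the earlier suffix products as they are and appends g. -/
theorem suffixConn_eq [TopologicalSpace V] [T2Space V] [IsTopologicalAddGroup V]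
    {M' : Type*} [MulAction Γ M'] (h : M' → ℝ) (hh : ∀ m, ∑ᶠ g : Γ, h (g • m) = 1) (m : M')
    {q : ℕ} (w : Chain Γ V q) (γ : Fin (q + 2) → Γ) :
    diff (fun γ => w (toY γ)) γ + (-1 : ℂ) ^ q • mul rfl (fun γ => w (toY γ)) (connForm h m) γ =
      repeatDiff w (toY γ) -
        (-1 : ℂ) ^ q • (h (toY γ (Fin.last _) • m) : ℂ) • w (Fin.init (toY γ)) := by
  classical
  obtain ⟨y, rfl⟩ : ∃ y, γ = fromY y := ⟨_, (fromY_toY γ).symm⟩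
  rw [toY_fromY]
  have hd : diff (fun γ => w (toY γ)) (fromY y) = repeatDiff w y +
      if y (Fin.last _) = 1 then
        (-1 : ℂ) ^ (q + 1) • w (toY fun j => fromY y j.castSucc) else 0 := by
    rw [diff, Fin.sum_univ_castSucc, repeatDiff]
    congr 1
    · refine Finset.sum_congr rfl fun i _ => ?_
      rw [fromY_castSucc]
      by_cases hi : y i.castSucc = y i.succ
      · rw [if_pos (by rw [hi, mul_inv_cancel]), if_pos hi, fromY_succAbove hi, toY_fromY]
        rfl
      · rw [if_neg (fun h => hi (mul_inv_eq_one.1 h)), if_neg hi]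
    · rw [fromY_last]
      simp only [Fin.succAbove_last, Fin.val_last]
  have hm : mul rfl (fun γ => w (toY γ)) (connForm h m) (fromY y) =
      (if y (Fin.last _) = 1 then w (toY fun j => fromY y j.castSucc) else 0) -
        (h (y (Fin.last _) • m) : ℂ) • w (Fin.init y) := by
    have hs : HasSum (fun u : Γ =>
        (if u = y (Fin.last q).castSucc * (y (Fin.last _))⁻¹ then
          (if y (Fin.last _) = 1 then w (toY fun j => fromY y j.castSucc) else 0) else 0) -
        if u = y (Fin.last q).castSucc then (h (y (Fin.last _) • m) : ℂ) • w (Fin.init y) else 0)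
        ((if y (Fin.last _) = 1 then w (toY fun j => fromY y j.castSucc) else 0) -
        (h (y (Fin.last _) • m) : ℂ) • w (Fin.init y)) :=
      (hasSum_ite_eq _ _).sub (hasSum_ite_eq _ _)
    refine Eq.trans ?_ hs.tsum_eq
    rw [mul]
    refine tsum_congr fun u => ?_
    rw [connForm_apply h hh]
    have f0 : fromY y (⟨q, by omega⟩ : Fin (q + 2)) =
        y (Fin.last q).castSucc * (y (Fin.last _))⁻¹ := fromY_castSucc y (Fin.last q)
    have f1 : fromY y (⟨q + ((1 : Fin 2) : ℕ), by simp⟩ : Fin (q + 2)) = y (Fin.last _) :=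
      fromY_last y
    simp only [if_true, one_ne_zero, if_false, f0, f1]
    rw [sub_smul]
    congr 1
    · by_cases a : u = y (Fin.last q).castSucc * (y (Fin.last _))⁻¹
      · by_cases b : y (Fin.last _) = 1
        · rw [if_pos ⟨by rw [a]; group, b⟩, if_pos a, if_pos b, one_smul]
          congr 2
          funext i
          refine Fin.lastCases ?_ (fun i => ?_) i
          · rw [if_pos rfl, a, fromY_castSucc]; rfl
          · rw [if_neg (Fin.castSucc_lt_last i).ne]; rfl
        · rw [if_neg (fun h => b h.2), if_pos a, if_neg b, zero_smul]
      · rw [if_neg (fun h => a (inv_mul_eq_one.1 h.1)), if_neg a, zero_smul]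
    · by_cases a : u = y (Fin.last q).castSucc
      · rw [if_pos (by rw [a]; group), if_pos a]
        congr 2
        apply fromY_injective
        rw [fromY_toY]
        funext i
        refine Fin.lastCases ?_ (fun i => ?_) i
        · rw [if_pos rfl, a, fromY_last]; rfl
        · rw [if_neg (Fin.castSucc_lt_last i).ne, fromY_castSucc]
          exact fromY_castSucc y i.castSucc
      · rw [if_neg, if_neg a, zero_smul]
        rw [mul_assoc, inv_mul_cancel_right, inv_mul_eq_one]
        exact a
  rw [hd, hm]
  split_ifs with hl
  · rw [pow_succ, mul_neg_one, neg_smul, smul_sub]; abel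
  · simp [sub_eq_add_neg]

end SuffixCoordinates

/-! ### The curvature -/

section Curvature

variable {Γ : Type*} [Group Γ] {n : ℕ} {M' : Type*} [TopologicalSpace M']
  [ChartedSpace (EuclideanSpace ℝ (Fin n)) M'] [MulAction Γ M']

/-- The function `L_g^* h`. -/
def translate (h : M' → ℝ) (g : Γ) : M' → ℝ := fun m => h (g • m)

/-- Multiplication of forms by a real function. -/
def mulFun (u : M' → ℝ) {p : ℕ} : DForm n M' p →ₗ[ℂ] DForm n M' p where
  toFun α := fun m => u m • α m
  map_add' α β := by funext m; exact smul_add _ _ _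
  map_smul' c α := by funext m; exact smul_comm (u m) c (α m)

theorem suffixConn_add {V : Type*} [AddCommGroup V] [Module ℂ V] (T : Γ → V →ₗ[ℂ] V) {q : ℕ}
    (w w' : Chain Γ V q) : suffixConn T (w + w') = suffixConn T w + suffixConn T w' := by
  funext y
  simp only [suffixConn, repeatDiff_add, Pi.add_apply, map_add, smul_add]
  abel

theorem suffixConn_zero {V : Type*} [AddCommGroup V] [Module ℂ V] (T : Γ → V →ₗ[ℂ] V) {q : ℕ} :
    suffixConn T (0 : Chain Γ V q) = 0 := by
  have h := suffixConn_add T (0 : Chain Γ V q) 0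
  rw [add_zero] at h
  exact left_eq_add.1 h

/-- The form whose coefficients are given in terms of suffix products. -/
def ofSuffix (W : BForm Γ n M') : BForm Γ n M' := fun p q γ => W p q (toY γ)

/-- `∇^{0,1}` in terms of suffix products. -/
def suffix01 (h : M' → ℝ) (W : BForm Γ n M') : BForm Γ n M' := fun p q =>
  match q with
  | 0 => 0
  | q + 1 => suffixConn (fun g => mulFun (translate h g)) (W p q)

/-- `∇` in terms of suffix products. -/
def suffixNabla (h : M' → ℝ) (W : BForm Γ n M') : BForm Γ n M' := nabla10 W + suffix01 h W

theorem ofReal_smul_alternating {p : ℕ} (r : ℝ) (α : (EuclideanSpace ℝ (Fin n)) [⋀^Fin p]→L[ℝ] ℂ) :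
    (r : ℂ) • α = r • α := by
  ext v
  simp

theorem repeatDiff_apply_point {p q : ℕ} (w : Chain Γ (DForm n M' p) q) (y : Fin (q + 2) → Γ)
    (m : M') : repeatDiff w y m = repeatDiff (fun y => w y m) y :=
  (repeatDiff_map (LinearMap.proj (R := ℂ)
    (φ := fun _ : M' => (EuclideanSpace ℝ (Fin n)) [⋀^Fin p]→L[ℝ] ℂ) m) w y).symm

theorem nabla_ofSuffix {h : M' → ℝ} (hh : ∀ m, ∑ᶠ g : Γ, h (g • m) = 1) (W : BForm Γ n M') :
    nabla h (ofSuffix W) = ofSuffix (suffixNabla h W) := by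
  funext p q γ
  have h1 : nabla10 (ofSuffix W) p q γ = nabla10 W p q (toY γ) := by
    cases p <;> rfl
  have h2 : nabla01 h (ofSuffix W) p q γ = suffix01 h W p q (toY γ) := by
    cases q with
    | zero => rfl
    | succ q =>
      funext m
      refine (suffixConn_eq h hh m (fun y => W p q y m) γ).trans ?_
      rw [ofReal_smul_alternating, ← repeatDiff_apply_point]
      rfl
  change nabla10 (ofSuffix W) p q γ + nabla01 h (ofSuffix W) p q γ = _
  rw [h1, h2]
  rfl

theorem ofSuffix_frame : ofSuffix (frame : BForm Γ n M') = frame := by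
  funext p q γ
  match p, q with
  | 0, 0 =>
    have : toY γ = γ := by
      funext i
      fin_cases i
      simp [toY_zero]
    change frame 0 0 (toY γ) = _
    rw [this]
  | 0, q + 1 => rfl
  | p + 1, q => cases q <;> rfl

/-- The part of the curvature that involves the differential of `h`. -/
def curvD (h : M' → ℝ) (W : BForm Γ n M') : BForm Γ n M' := fun p q =>
  match p, q with
  | p + 1, q + 1 => fun y m => wedge (dfun (translate h (y (Fin.last _))) m) (W p q (Fin.init y) m)
  | _, _ => 0

/-- The part of the curvature that does not involve the differential of `h`. -/
def curvH (h : M' → ℝ) (W : BForm Γ n M') : BForm Γ n M' := fun p q =>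
  match q with
  | q + 2 => open Classical in fun y => mulFun (translate h (y (Fin.last _)))
      ((if Fin.init y (Fin.last _) = y (Fin.last _) then W p q (Fin.init (Fin.init y)) else 0) -
        mulFun (translate h (Fin.init y (Fin.last _))) (W p q (Fin.init (Fin.init y))))
  | _ => 0

/-- All coefficients are smooth. -/
def SmoothCoeff (W : BForm Γ n M') : Prop := ∀ p q y, IsSmoothForm (W p q y)

/-! ### The square of the connection on smooth coefficients -/

section Smooth

variable [IsManifold (𝓡 n) ∞ M'] {h : M' → ℝ}

theorem smoothCoeff_frame : SmoothCoeff (frame : BForm Γ n M') := by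
  intro p q y
  match p, q with
  | 0, 0 =>
    intro x₀
    have : chartRep (frame (Γ := Γ) (n := n) (M' := M') 0 0 y) x₀ = fun _ =>
        ContinuousAlternatingMap.constOfIsEmpty ℝ (EuclideanSpace ℝ (Fin n)) (Fin 0)
          (grp (1 : Γ) y) := by
      funext z; ext v; rfl
    rw [this]
    exact contDiffOn_const
  | 0, q + 1 => exact isSmoothForm_zero
  | p + 1, 0 => exact isSmoothForm_zero
  | p + 1, q + 1 => exact isSmoothForm_zero

theorem isSmoothForm_repeatDiff {p q : ℕ} {w : Chain Γ (DForm n M' p) q}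
    (hw : ∀ y, IsSmoothForm (w y)) (y : Fin (q + 2) → Γ) : IsSmoothForm (repeatDiff w y) := by
  classical
  refine IsSmoothForm.sum _ fun i _ => ?_
  split_ifs
  · exact (hw _).const_smul _
  · exact isSmoothForm_zero

theorem extd_repeatDiff {p q : ℕ} {w : Chain Γ (DForm n M' p) q}
    (hw : ∀ y, IsSmoothForm (w y)) (y : Fin (q + 2) → Γ) :
    extd (repeatDiff w y) = repeatDiff (fun y => extd (w y)) y := by
  classical
  rw [repeatDiff, extd_sum]
  · refine Finset.sum_congr rfl fun i _ => ?_
    split_ifs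
    · exact extd_const_smul _ (hw _)
    · exact extd_zero
  · intro i _
    split_ifs
    · exact (hw _).const_smul _
    · exact isSmoothForm_zero

theorem repeatDiff_const_smul {V : Type*} [AddCommGroup V] [Module ℂ V] {q : ℕ} (c : ℂ)
    (w : Chain Γ V q) (y : Fin (q + 2) → Γ) :
    repeatDiff (fun y => c • w y) y = c • repeatDiff w y :=
  repeatDiff_map (c • LinearMap.id) w y

theorem sub_const_smul_eq {p : ℕ} (α β : DForm n M' p) (c : ℂ) : α - c • β = α + (-c) • β := by
  funext m
  ext v
  exact (sub_eq_add_neg _ _).trans (congrArg _ (neg_mul _ _).symm)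

theorem IsSmoothForm.sub_const_smul {p : ℕ} {α β : DForm n M' p} (hα : IsSmoothForm α) (c : ℂ)
    (hβ : IsSmoothForm β) : IsSmoothForm (α - c • β) := by
  rw [sub_const_smul_eq]
  exact hα.add (hβ.const_smul _)

theorem extd_sub_const_smul {p : ℕ} {α β : DForm n M' p} (hα : IsSmoothForm α) (c : ℂ)
    (hβ : IsSmoothForm β) : extd (α - c • β) = extd α - c • extd β := by
  rw [sub_const_smul_eq, sub_const_smul_eq, extd_add hα (hβ.const_smul _), extd_const_smul _ hβ]

theorem const_smul_zero_form {p : ℕ} (c : ℂ) : c • (0 : DForm n M' p) = 0 := by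
  funext m
  ext v
  exact mul_zero c

theorem SmoothCoeff.nabla10 {W : BForm Γ n M'} (hW : SmoothCoeff W) : SmoothCoeff (nabla10 W) := by
  intro p q y
  cases p with
  | zero => exact isSmoothForm_zero
  | succ p => exact (hW p q y).extd.const_smul _

theorem SmoothCoeff.suffix01 (hs : ∀ g : Γ, ContMDiff (𝓡 n) 𝓘(ℝ, ℝ) ∞ (translate h g))
    {W : BForm Γ n M'} (hW : SmoothCoeff W) : SmoothCoeff (suffix01 h W) := by
  intro p q y
  cases q with
  | zero => exact isSmoothForm_zero
  | succ q =>
    exact (isSmoothForm_repeatDiff (hW p q) y).sub_const_smul ((-1 : ℂ) ^ q)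
      ((hW p q (Fin.init y)).smul (hs (y (Fin.last _))))

theorem SmoothCoeff.add {W W' : BForm Γ n M'} (hW : SmoothCoeff W) (hW' : SmoothCoeff W') :
    SmoothCoeff (W + W') := fun p q y => (hW p q y).add (hW' p q y)

theorem SmoothCoeff.suffixNabla (hs : ∀ g : Γ, ContMDiff (𝓡 n) 𝓘(ℝ, ℝ) ∞ (translate h g))
    {W : BForm Γ n M'} (hW : SmoothCoeff W) : SmoothCoeff (suffixNabla h W) :=
  hW.nabla10.add (hW.suffix01 hs)

theorem nabla10_add {W W' : BForm Γ n M'} (hW : SmoothCoeff W) (hW' : SmoothCoeff W') :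
    nabla10 (W + W') = nabla10 W + nabla10 W' := by
  funext p q y
  cases p with
  | zero => exact (add_zero (0 : DForm n M' 0)).symm
  | succ p =>
    change (-1 : ℂ) ^ q • extd (W p q y + W' p q y) = _
    rw [extd_add (hW p q y) (hW' p q y)]
    exact smul_add (A := DForm n M' (p + 1)) _ _ _

theorem suffix01_add (W W' : BForm Γ n M') :
    suffix01 h (W + W') = suffix01 h W + suffix01 h W' := by
  funext p q
  cases q with
  | zero => exact (add_zero (0 : Chain Γ (DForm n M' p) 0)).symm
  | succ q => exact suffixConn_add (fun g => mulFun (translate h g)) (W p q) (W' p q)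

theorem nabla10_nabla10 {W : BForm Γ n M'} (hW : SmoothCoeff W) : nabla10 (nabla10 W) = 0 := by
  funext p q y
  match p with
  | 0 => rfl
  | 1 =>
    change (-1 : ℂ) ^ q • extd (0 : DForm n M' 0) = 0
    rw [extd_zero, const_smul_zero_form]
  | p + 2 =>
    change (-1 : ℂ) ^ q • extd ((-1 : ℂ) ^ q • extd (W p q y)) = 0
    rw [extd_const_smul _ (hW p q y).extd, extd_extd (hW p q y), const_smul_zero_form,
      const_smul_zero_form]

theorem suffix01_suffix01 (W : BForm Γ n M') : suffix01 h (suffix01 h W) = curvH h W := by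
  funext p q
  match q with
  | 0 => rfl
  | 1 => exact suffixConn_zero (fun g => mulFun (n := n) (p := p) (translate h g))
  | q + 2 =>
    funext y
    exact suffixConn_suffixConn (fun g => mulFun (translate h g)) (W p q) y

/-- Repetition of entries commutes with d and cancels through the sign (-1)^q in ∇^{1,0}. From the
appended factor the Leibniz rule leaves only the term with its differential. -/
theorem nabla10_suffix01 (hs : ∀ g : Γ, ContMDiff (𝓡 n) 𝓘(ℝ, ℝ) ∞ (translate h g))
    {W : BForm Γ n M'} (hW : SmoothCoeff W) :
    nabla10 (suffix01 h W) + suffix01 h (nabla10 W) = curvD h W := by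
  funext p q
  match p, q with
  | 0, 0 => exact add_zero (0 : Chain Γ (DForm n M' 0) 0)
  | 0, q + 1 =>
    refine (zero_add _).trans ?_
    exact suffixConn_zero (fun g => mulFun (n := n) (p := 0) (translate h g))
  | p + 1, 0 =>
    refine (add_zero _).trans ?_
    funext y
    change (-1 : ℂ) ^ 0 • extd (0 : DForm n M' p) = 0
    rw [extd_zero, const_smul_zero_form]
  | p + 1, q + 1 =>
    funext y
    set u := translate h (y (Fin.last _)) with hu
    set β := W p q (Fin.init y) with hβ
    have hβs : IsSmoothForm β := hW p q _
    have hus := hβs.smul (hs (y (Fin.last _)))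
    have e1 : nabla10 (suffix01 h W) (p + 1) (q + 1) y =
        (-1 : ℂ) ^ (q + 1) • (repeatDiff (fun y => extd (W p q y)) y -
          (-1 : ℂ) ^ q • extd (fun m => u m • β m)) := by
      rw [← extd_repeatDiff (hW p q), ← extd_sub_const_smul
        (isSmoothForm_repeatDiff (hW p q) y) _ hus]
      rfl
    have e3 : repeatDiff (fun y => (-1 : ℂ) ^ q • extd (W p q y)) y =
        (-1 : ℂ) ^ q • (repeatDiff (fun y => extd (W p q y)) y) :=
      repeatDiff_const_smul _ (fun y => extd (W p q y)) y
    have e2 : suffix01 h (nabla10 W) (p + 1) (q + 1) y =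
        (-1 : ℂ) ^ q • (repeatDiff (fun y => extd (W p q y)) y) -
          (-1 : ℂ) ^ q • mulFun u ((-1 : ℂ) ^ q • extd β) := by
      rw [← e3]
      rfl
    change nabla10 (suffix01 h W) (p + 1) (q + 1) y + suffix01 h (nabla10 W) (p + 1) (q + 1) y = _
    rw [e1, e2, extd_smul (hs _) hβs]
    have hq : (-1 : ℂ) ^ q * (-1 : ℂ) ^ q = 1 := by rw [← mul_pow]; simp
    funext m
    ext v
    change (-1 : ℂ) ^ (q + 1) * (repeatDiff (fun y => extd (W p q y)) y m v -
      (-1 : ℂ) ^ q * (u m • extd β m v + wedge (dfun u m) (β m) v)) +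
      ((-1 : ℂ) ^ q * repeatDiff (fun y => extd (W p q y)) y m v -
        (-1 : ℂ) ^ q * (u m • ((-1 : ℂ) ^ q * extd β m v))) = wedge (dfun u m) (β m) v
    rw [pow_succ, Complex.real_smul, Complex.real_smul]
    linear_combination (wedge (dfun u m) (β m) v) * hq

theorem suffixNabla_suffixNabla (hs : ∀ g : Γ, ContMDiff (𝓡 n) 𝓘(ℝ, ℝ) ∞ (translate h g))
    {W : BForm Γ n M'} (hW : SmoothCoeff W) :
    suffixNabla h (suffixNabla h W) = curvD h W + curvH h W := by
  rw [suffixNabla, suffixNabla, nabla10_add hW.nabla10 (hW.suffix01 hs), suffix01_add,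
    nabla10_nabla10 hW, suffix01_suffix01, ← nabla10_suffix01 hs hW]
  abel

/-- The curvature in terms of suffix products. -/
def curv (h : M' → ℝ) (W : BForm Γ n M') : BForm Γ n M' := curvD h W + curvH h W

/-- Smoothness is carried through the induction because the formula for the square of the connection
is available only on smooth coefficients. -/
theorem iterate_nabla (hs : ∀ g : Γ, ContMDiff (𝓡 n) 𝓘(ℝ, ℝ) ∞ (translate h g))
    (hh : ∀ m, ∑ᶠ g : Γ, h (g • m) = 1) (j : ℕ) :
    ((fun S => nabla h (nabla h S))^[j] frame : BForm Γ n M') =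
      ofSuffix ((curv h)^[j] frame) ∧ SmoothCoeff ((curv h)^[j] (frame : BForm Γ n M')) := by
  induction j with
  | zero => exact ⟨ofSuffix_frame.symm, smoothCoeff_frame⟩
  | succ j ih =>
    rw [Function.iterate_succ_apply', Function.iterate_succ_apply', ih.1, nabla_ofSuffix hh,
      nabla_ofSuffix hh, suffixNabla_suffixNabla hs ih.2]
    refine ⟨rfl, ?_⟩
    rw [curv, ← suffixNabla_suffixNabla hs ih.2]
    exact (ih.2.suffixNabla hs).suffixNabla hs

end Smooth

end Curvature

/-! ### Sums over tuples -/

section Tuples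

variable {Γ : Type*}

/-- The finite set of tuples with entries in `A`. -/
def tuples (A : Finset Γ) (q : ℕ) : Finset (Fin q → Γ) := Fintype.piFinset fun _ => A

theorem mem_tuples {A : Finset Γ} {q : ℕ} {y : Fin q → Γ} : y ∈ tuples A q ↔ ∀ i, y i ∈ A :=
  Fintype.mem_piFinset

theorem sum_tuples_snoc {R : Type*} [AddCommMonoid R] (A : Finset Γ) {q : ℕ}
    (f : (Fin (q + 1) → Γ) → R) :
    ∑ y ∈ tuples A (q + 1), f y = ∑ x ∈ tuples A q, ∑ z ∈ A, f (Fin.snoc x z) := by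
  rw [← Finset.sum_product']
  refine Finset.sum_bij' (fun y _ => (Fin.init y, y (Fin.last q))) (fun p _ => Fin.snoc p.1 p.2)
    ?_ ?_ ?_ ?_ ?_
  · intro y hy
    rw [mem_tuples] at hy
    exact Finset.mem_product.2 ⟨mem_tuples.2 fun i => hy _, hy _⟩
  · rintro ⟨x, z⟩ h
    obtain ⟨h1, h2⟩ := Finset.mem_product.1 h
    rw [mem_tuples]
    intro i
    refine Fin.lastCases ?_ (fun i => ?_) i
    · simpa using h2
    · simpa using mem_tuples.1 h1 i
  · intro y _; exact Fin.snoc_init_self y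
  · rintro ⟨x, z⟩ _; simp
  · intro y _; simp

theorem sum_tuples_cons {R : Type*} [AddCommMonoid R] (A : Finset Γ) {q : ℕ}
    (f : (Fin (q + 1) → Γ) → R) :
    ∑ y ∈ tuples A (q + 1), f y = ∑ z ∈ A, ∑ x ∈ tuples A q, f (Fin.cons z x) := by
  rw [← Finset.sum_product']
  refine Finset.sum_bij' (fun y _ => (y 0, Fin.tail y)) (fun p _ => Fin.cons p.1 p.2)
    ?_ ?_ ?_ ?_ ?_
  · intro y hy
    rw [mem_tuples] at hy
    exact Finset.mem_product.2 ⟨hy _, mem_tuples.2 fun i => hy _⟩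
  · rintro ⟨z, x⟩ h
    obtain ⟨h1, h2⟩ := Finset.mem_product.1 h
    rw [mem_tuples]
    intro i
    refine Fin.cases ?_ (fun i => ?_) i
    · simpa using h1
    · simpa using mem_tuples.1 h2 i
  · intro y _; exact Fin.cons_self_tail y
  · rintro ⟨z, x⟩ _; simp
  · intro y _; simp

/-- A function of tuples which changes sign under transpositions. -/
def IsAlt {q : ℕ} (T : (Fin q → Γ) → ℂ) : Prop :=
  ∀ (i j : Fin q) (y : Fin q → Γ), i ≠ j → T (y ∘ Equiv.swap i j) = -T y

theorem IsAlt.snoc {q : ℕ} {T : (Fin (q + 1) → Γ) → ℂ} (hT : IsAlt T) (z : Γ) :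
    IsAlt fun x : Fin q → Γ => T (Fin.snoc x z) := by
  intro i j x hij
  rw [← hT i.castSucc j.castSucc _ (fun h => hij (Fin.castSucc_injective _ h))]
  change T _ = T _
  congr 1
  funext l
  refine Fin.lastCases ?_ (fun l => ?_) l
  · rw [Fin.snoc_last, Function.comp, Equiv.swap_apply_of_ne_of_ne, Fin.snoc_last]
    · exact (Fin.castSucc_lt_last i).ne'
    · exact (Fin.castSucc_lt_last j).ne'
  · rw [Fin.snoc_castSucc, Function.comp, Function.comp,
      (Fin.castSucc_injective _).swap_apply, Fin.snoc_castSucc]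

theorem IsAlt.snoc_snoc {q : ℕ} {T : (Fin (q + 2) → Γ) → ℂ} (hT : IsAlt T) (x : Fin q → Γ)
    (u z : Γ) : T (Fin.snoc (Fin.snoc x z : Fin (q + 1) → Γ) u) =
      -T (Fin.snoc (Fin.snoc x u : Fin (q + 1) → Γ) z) := by
  rw [← hT (Fin.last q).castSucc (Fin.last (q + 1)) _ (Fin.castSucc_lt_last _).ne]
  congr 1
  funext l
  refine Fin.lastCases ?_ (fun l => ?_) l
  · rw [Function.comp, Equiv.swap_apply_right, Fin.snoc_last, Fin.snoc_castSucc, Fin.snoc_last]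
  · refine Fin.lastCases ?_ (fun l => ?_) l
    · rw [Function.comp, Equiv.swap_apply_left, Fin.snoc_castSucc, Fin.snoc_last, Fin.snoc_last]
    · rw [Function.comp, Equiv.swap_apply_of_ne_of_ne, Fin.snoc_castSucc, Fin.snoc_castSucc,
        Fin.snoc_castSucc, Fin.snoc_castSucc]
      · exact fun h => (Fin.castSucc_lt_last l).ne (Fin.castSucc_injective _ h)
      · exact (Fin.castSucc_lt_last _).ne

theorem IsCocycle.isAlt [Group Γ] {x : Γ} {k : ℕ} {τ : Chain Γ ℂ k} (hτ : IsCocycle x τ) :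
    IsAlt τ := by
  intro i j y hij
  rw [hτ.skew, Equiv.Perm.sign_swap hij]
  simp

end Tuples

/-! ### Powers of the curvature -/

section Powers

variable {Γ : Type*} [Group Γ] {n : ℕ} {M' : Type*} [TopologicalSpace M']
  [ChartedSpace (EuclideanSpace ℝ (Fin n)) M'] [MulAction Γ M']

/-- Near `m`, the functions `L_g^* h` with `g ∈ A` form a partition of unity to first order, and
the others vanish to first order. -/
structure IsPartitionAt (h : M' → ℝ) (m : M') (A : Finset Γ) : Prop where
  eq_zero : ∀ g ∉ A, translate h g m = 0
  dfun_eq_zero : ∀ g ∉ A, dfun (n := n) (translate h g) m = 0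
  sum_eq : ∑ g ∈ A, translate h g m = 1
  sum_dfun : ∑ g ∈ A, dfun (n := n) (translate h g) m = 0

/-- The form `dh_{y₁} ∧ ⋯ ∧ dh_{y_b}`, up to sign, for `h_g = L_g^* h`. -/
def dhForm (h : M' → ℝ) : ∀ {b : ℕ}, (Fin b → Γ) → DForm n M' b
  | 0, _ => fun _ => ContinuousAlternatingMap.constOfIsEmpty ℝ (EuclideanSpace ℝ (Fin n)) (Fin 0) 1
  | _ + 1, y => fun m => wedge (dfun (translate h (y (Fin.last _))) m) (dhForm h (Fin.init y) m)

/-- The two forms pair equally with all alternating functions of tuples. -/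
def AltEq (A : Finset Γ) (W W' : BForm Γ n M') : Prop :=
  ∀ (p q : ℕ) (T : (Fin (q + 1) → Γ) → ℂ), IsAlt T → ∀ m v,
    ∑ y ∈ tuples A (q + 1), T y * W p q y m v = ∑ y ∈ tuples A (q + 1), T y * W' p q y m v

theorem sum_mul_curvD (h : M' → ℝ) (A : Finset Γ) (W : BForm Γ n M') {p q : ℕ}
    (T : (Fin (q + 2) → Γ) → ℂ) (m : M') (v : Fin (p + 1) → EuclideanSpace ℝ (Fin n)) :
    ∑ y ∈ tuples A (q + 2), T y * curvD h W (p + 1) (q + 1) y m v =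
      ∑ z ∈ A, ∑ i : Fin (p + 1), (-1 : ℤ) ^ (i : ℕ) • (dfun (translate h z) m (v i) •
        ∑ x ∈ tuples A (q + 1), T (Fin.snoc x z) * W p q x m (i.removeNth v)) := by
  rw [sum_tuples_snoc, Finset.sum_comm]
  refine Finset.sum_congr rfl fun z _ => ?_
  simp only [curvD, Fin.snoc_last, Fin.init_snoc, wedge_apply, Finset.mul_sum, Finset.smul_sum]
  rw [Finset.sum_comm]
  refine Finset.sum_congr rfl fun i _ => Finset.sum_congr rfl fun x _ => ?_
  rw [mul_smul_comm, mul_smul_comm]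

/-- For u ≠ z the weight -h_z h_u is symmetric in the last two entries while T is antisymmetric, and
for u = z the value of T is 0. So the sum equals its own negative. -/
theorem sum_mul_curvH (h : M' → ℝ) (A : Finset Γ) (W : BForm Γ n M') {p q : ℕ}
    {T : (Fin (q + 1) → Γ) → ℂ} (hT : IsAlt T) (m : M')
    (v : Fin p → EuclideanSpace ℝ (Fin n)) :
    ∑ y ∈ tuples A (q + 1), T y * curvH h W p q y m v = 0 := by
  classical
  match q with
  | 0 => exact Finset.sum_eq_zero fun y _ => mul_zero _
  | 1 => exact Finset.sum_eq_zero fun y _ => mul_zero _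
  | q + 2 =>
    rw [sum_tuples_snoc, sum_tuples_snoc]
    refine Finset.sum_eq_zero fun x _ => ?_
    have hval : ∀ u z, T (Fin.snoc (Fin.snoc x u : Fin (q + 2) → Γ) z) *
        curvH h W p (q + 2) (Fin.snoc (Fin.snoc x u : Fin (q + 2) → Γ) z) m v =
        -(T (Fin.snoc (Fin.snoc x u : Fin (q + 2) → Γ) z) *
          (translate h z m * translate h u m * W p q x m v)) := by
      intro u z
      have e : curvH h W p (q + 2) (Fin.snoc (Fin.snoc x u : Fin (q + 2) → Γ) z) m v =
          (translate h z m : ℂ) * ((if u = z then W p q x m v else 0) -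
            translate h u m * W p q x m v) := by
        simp only [curvH, Fin.snoc_last, Fin.init_snoc]
        split_ifs <;> rfl
      rw [e]
      by_cases huz : u = z
      · subst huz
        have h0 := hT.snoc_snoc x u u
        have : T (Fin.snoc (Fin.snoc x u : Fin (q + 2) → Γ) u) = 0 := by
          linear_combination h0 / 2
        rw [this]
        simp
      · rw [if_neg huz]
        ring
    have h1 : ∑ u ∈ A, ∑ z ∈ A, T (Fin.snoc (Fin.snoc x u : Fin (q + 2) → Γ) z) *
        curvH h W p (q + 2) (Fin.snoc (Fin.snoc x u : Fin (q + 2) → Γ) z) m v =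
        -∑ u ∈ A, ∑ z ∈ A, T (Fin.snoc (Fin.snoc x u : Fin (q + 2) → Γ) z) *
        curvH h W p (q + 2) (Fin.snoc (Fin.snoc x u : Fin (q + 2) → Γ) z) m v := by
      conv_lhs => rw [Finset.sum_comm]
      simp only [hval, ← Finset.sum_neg_distrib]
      refine Finset.sum_congr rfl fun u _ => Finset.sum_congr rfl fun z _ => ?_
      rw [hT.snoc_snoc x u z]
      ring
    linear_combination h1 / 2

/-- Fixing the last entry of an alternating function leaves an alternating function, so the
equivalence passes through the append of dh. In consequence powers of the curvature may be computed
with `curvD` alone. -/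
theorem AltEq.curv {A : Finset Γ} {W W' : BForm Γ n M'} (hW : AltEq A W W') (h : M' → ℝ) :
    AltEq A (curv h W) (curvD h W') := by
  intro p q T hT m v
  have e : ∀ y, T y * NCChern.curv h W p q y m v =
      T y * curvD h W p q y m v + T y * curvH h W p q y m v := fun y => mul_add _ _ _
  simp only [e, Finset.sum_add_distrib]
  rw [sum_mul_curvH h A W hT, add_zero]
  match p, q with
  | 0, 0 => rfl
  | 0, q + 1 => rfl
  | p + 1, 0 => rfl
  | p + 1, q + 1 =>
    rw [sum_mul_curvD, sum_mul_curvD]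
    refine Finset.sum_congr rfl fun z _ => Finset.sum_congr rfl fun i _ => ?_
    rw [hW p q _ (hT.snoc z)]

theorem altEq_iterate (h : M' → ℝ) (A : Finset Γ) (j : ℕ) :
    AltEq A ((curv h)^[j] frame) ((curvD h)^[j] (frame : BForm Γ n M')) := by
  induction j with
  | zero => exact fun _ _ _ _ _ _ => rfl
  | succ j ih =>
    rw [Function.iterate_succ_apply', Function.iterate_succ_apply']
    exact ih.curv h

/-- Each application of `curvD` raises both degrees by one, starting from bidegree (0, 0). -/
theorem iterate_curvD_of_ne (h : M' → ℝ) : ∀ (j p q : ℕ), ¬ (p = j ∧ q = j) →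
    (curvD h)^[j] (frame : BForm Γ n M') p q = 0
  | 0, 0, 0, hne => absurd ⟨rfl, rfl⟩ hne
  | 0, 0, q + 1, _ => rfl
  | 0, p + 1, 0, _ => rfl
  | 0, p + 1, q + 1, _ => rfl
  | j + 1, 0, 0, _ => by rw [Function.iterate_succ_apply']; rfl
  | j + 1, 0, q + 1, _ => by rw [Function.iterate_succ_apply']; rfl
  | j + 1, p + 1, 0, _ => by rw [Function.iterate_succ_apply']; rfl
  | j + 1, p + 1, q + 1, hne => by
    rw [Function.iterate_succ_apply']
    funext y m
    change wedge _ ((curvD h)^[j] frame p q (Fin.init y) m) = 0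
    rw [iterate_curvD_of_ne h j p q fun hh => hne ⟨by rw [hh.1], by rw [hh.2]⟩]
    exact map_zero (wedgeHom _ p _)

open Classical in
theorem iterate_curvD (h : M' → ℝ) : ∀ (j : ℕ) (y : Fin (j + 1) → Γ) (m : M')
    (v : Fin j → EuclideanSpace ℝ (Fin n)),
    (curvD h)^[j] (frame : BForm Γ n M') j j y m v =
      if y 0 = 1 then dhForm h (Fin.tail y) m v else 0
  | 0, y, m, v => by
    change grp (1 : Γ) y = if y 0 = 1 then 1 else 0
    rfl
  | j + 1, y, m, v => by
    rw [Function.iterate_succ_apply']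
    change wedge (dfun (translate h (y (Fin.last _))) m)
      ((curvD h)^[j] frame j j (Fin.init y) m) v = _
    rw [wedge_apply]
    simp only [iterate_curvD h j]
    have e0 : (Fin.init y : Fin (j + 1) → Γ) 0 = y 0 := rfl
    rw [e0]
    split_ifs with h1
    · exact (wedge_apply _ _ _).symm
    · simp

/-- The coefficients at `m` vanish unless the first entry is `1` and the others are in `A`. -/
def SupportedAt (A : Finset Γ) (m : M') (W : BForm Γ n M') : Prop :=
  ∀ p q (y : Fin (q + 1) → Γ), (y 0 ≠ 1 ∨ ∃ i : Fin q, y i.succ ∉ A) → W p q y m = 0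

/-- The curvature only appends entries at the end, so the first entry keeps the value 1 it has in
the frame, and appended entries carry weights h or dh that vanish outside A. -/
theorem SupportedAt.curv {h : M' → ℝ} {A : Finset Γ} {m : M'} (hA : IsPartitionAt (n := n) h m A)
    {W : BForm Γ n M'} (hW : SupportedAt A m W) : SupportedAt A m (curv h W) := by
  classical
  have h0 : ∀ {p : ℕ} (ℓ : EuclideanSpace ℝ (Fin n) →L[ℝ] ℝ)
      (α : (EuclideanSpace ℝ (Fin n)) [⋀^Fin p]→L[ℝ] ℂ), ℓ = 0 ∨ α = 0 → wedge ℓ α = 0 := by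
    rintro p ℓ α (rfl | rfl)
    · exact congrFun (congrArg DFunLike.coe (map_zero (wedgeHom _ p))) α
    · exact map_zero (wedgeHom _ p ℓ)
  have hD : SupportedAt A m (curvD h W) := by
    intro p q y hy
    match p, q with
    | 0, 0 => rfl
    | 0, q + 1 => rfl
    | p + 1, 0 => rfl
    | p + 1, q + 1 =>
      refine h0 _ _ ?_
      rcases hy with hy | ⟨i, hi⟩
      · exact Or.inr (hW p q _ (Or.inl hy))
      · revert hi
        refine Fin.lastCases (fun hi => ?_) (fun i hi => ?_) i
        · exact Or.inl (hA.dfun_eq_zero _ hi)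
        · exact Or.inr (hW p q _ (Or.inr ⟨i, hi⟩))
  have hH : SupportedAt A m (curvH h W) := by
    intro p q y hy
    match q with
    | 0 => rfl
    | 1 => rfl
    | q + 2 =>
      ext v
      have e : curvH h W p (q + 2) y m v = (translate h (y (Fin.last _)) m : ℂ) *
          ((if Fin.init y (Fin.last _) = y (Fin.last _) then
            W p q (Fin.init (Fin.init y)) m v else 0) -
            translate h (Fin.init y (Fin.last _)) m * W p q (Fin.init (Fin.init y)) m v) := by
        simp only [curvH]
        split_ifs <;> rfl
      rw [e]
      change _ = (0 : ℂ)
      have hw0 : W p q (Fin.init (Fin.init y)) m = 0 → W p q (Fin.init (Fin.init y)) m v = 0 := by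
        intro hh; rw [hh]; rfl
      rcases hy with hy | ⟨i, hi⟩
      · rw [hw0 (hW p q _ (Or.inl hy))]; simp
      · revert hi
        refine Fin.lastCases (fun hi => ?_) (fun i => ?_) i
        · rw [Fin.succ_last] at hi
          rw [hA.eq_zero _ hi]; simp
        · refine Fin.lastCases (fun hi => ?_) (fun i hi => ?_) i
          · have hi' : (Fin.init y : Fin (q + 2) → Γ) (Fin.last _) ∉ A := hi
            -- The Kronecker term has no factor h at the next-to-last entry, but there the last
            -- entry is the same one and the outer factor vanishes.
            by_cases hc : (Fin.init y : Fin (q + 2) → Γ) (Fin.last _) = y (Fin.last _)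
            · rw [hA.eq_zero _ (hc ▸ hi')]; simp
            · rw [if_neg hc, hA.eq_zero _ hi']; simp
          · rw [hw0 (hW p q _ (Or.inr ⟨i, hi⟩))]; simp
  intro p q y hy
  change curvD h W p q y m + curvH h W p q y m = 0
  rw [hD p q y hy, hH p q y hy, add_zero]

theorem supportedAt_frame (A : Finset Γ) (m : M') : SupportedAt A m (frame : BForm Γ n M') := by
  intro p q y hy
  match p, q with
  | 0, 0 =>
    rcases hy with hy | ⟨i, _⟩
    · ext v
      exact if_neg hy
    · exact i.elim0
  | 0, q + 1 => rfl
  | p + 1, 0 => rfl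
  | p + 1, q + 1 => rfl

theorem supportedAt_iterate {h : M' → ℝ} {A : Finset Γ} {m : M'}
    (hA : IsPartitionAt (n := n) h m A) (j : ℕ) :
    SupportedAt A m ((curv h)^[j] (frame : BForm Γ n M')) := by
  induction j with
  | zero => exact supportedAt_frame A m
  | succ j ih => rw [Function.iterate_succ_apply']; exact ih.curv hA

/-- The sums over an entry other than the first vanish at `m`. -/
def ReducedAt (A : Finset Γ) (m : M') (W : BForm Γ n M') : Prop :=
  ∀ p q (i : Fin q) (y : Fin (q + 1) → Γ) (v : Fin p → EuclideanSpace ℝ (Fin n)),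
    ∑ u ∈ A, W p q (Function.update y i.succ u) m v = 0

theorem reducedAt_frame (A : Finset Γ) (m : M') : ReducedAt A m (frame : BForm Γ n M') := by
  intro p q i y v
  match p, q with
  | _, 0 => exact i.elim0
  | 0, q + 1 => exact Finset.sum_eq_zero fun _ _ => rfl
  | p + 1, q + 1 => exact Finset.sum_eq_zero fun _ _ => rfl

/-- ∑ dh_g = 0 settles an entry appended with dh. For a pair (u, z) with weight h_z (δ_{uz} - h_u),
summing over z gives h_u - h_u because ∑ h_g = 1, and summing over u gives h_z (1 - 1). This is why
the Chern character takes values in Ω_*. -/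
theorem ReducedAt.curv {h : M' → ℝ} {A : Finset Γ} {m : M'} (hA : IsPartitionAt (n := n) h m A)
    {W : BForm Γ n M'} (hW : ReducedAt A m W) : ReducedAt A m (curv h W) := by
  classical
  have hne : ∀ {q : ℕ} (i : Fin q) (y : Fin (q + 2) → Γ) (u : Γ),
      Function.update y i.castSucc.succ u (Fin.last _) = y (Fin.last _) := fun i y u =>
    Function.update_of_ne (by
      rw [Fin.succ_castSucc]; exact (Fin.castSucc_lt_last _).ne') _ _
  have hinit : ∀ {q : ℕ} (i : Fin q) (y : Fin (q + 2) → Γ) (u : Γ),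
      (Fin.init (Function.update y i.castSucc.succ u) : Fin (q + 1) → Γ) =
        Function.update (Fin.init y) i.succ u := fun i y u => by
    rw [Fin.succ_castSucc, Fin.init_update_castSucc]
  have hlast : ∀ {q : ℕ} (y : Fin (q + 2) → Γ) (u : Γ),
      (Fin.init (Function.update y (Fin.last q).succ u) : Fin (q + 1) → Γ) =
        Fin.init y := fun y u => by
    rw [Fin.succ_last, Fin.init_update_last]
  have hD : ReducedAt A m (curvD h W) := by
    intro p q i y v
    match p, q with
    | _, 0 => exact i.elim0
    | 0, q + 1 => exact Finset.sum_eq_zero fun _ _ => rfl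
    | p + 1, q + 1 =>
      simp only [curvD, wedge_apply]
      rw [Finset.sum_comm]
      refine Finset.sum_eq_zero fun l _ => ?_
      revert i
      refine fun i => Fin.lastCases ?_ (fun i => ?_) i
      · have e : ∀ u, Function.update y (Fin.last q).succ u (Fin.last (q + 1)) = u := fun u => by
          rw [Fin.succ_last, Function.update_self]
        simp only [e, hlast]
        rw [← Finset.smul_sum, ← Finset.sum_smul]
        have := congrArg (fun ℓ => ℓ (v l)) hA.sum_dfun
        simp only [_root_.sum_apply, _root_.zero_apply] at this
        rw [this, zero_smul, smul_zero]
      · simp only [hne, hinit]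
        rw [← Finset.smul_sum, ← Finset.smul_sum, hW p q i, smul_zero, smul_zero]
  have hH : ReducedAt A m (curvH h W) := by
    intro p q i y v
    match q with
    | 0 => exact i.elim0
    | 1 => exact Finset.sum_eq_zero fun _ _ => rfl
    | q + 2 =>
      have e : ∀ y, curvH h W p (q + 2) y m v = (translate h (y (Fin.last _)) m : ℂ) *
          ((if Fin.init y (Fin.last _) = y (Fin.last _) then
            W p q (Fin.init (Fin.init y)) m v else 0) -
            translate h (Fin.init y (Fin.last _)) m * W p q (Fin.init (Fin.init y)) m v) := by
        intro y
        simp only [curvH]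
        split_ifs <;> rfl
      simp only [e]
      have hsum : ∑ u ∈ A, (translate h u m : ℂ) = 1 := by
        exact_mod_cast congrArg (fun r : ℝ => (r : ℂ)) hA.sum_eq
      have hδ : ∀ z c, ∑ u ∈ A, (translate h u m : ℂ) * (if z = u then c else 0) =
          translate h z m * c := by
        intro z c
        simp only [mul_ite, mul_zero]
        rw [Finset.sum_ite_eq]
        split_ifs with hz
        · rfl
        · rw [hA.eq_zero z hz]; simp
      refine Fin.lastCases ?_ (fun i => ?_) i
      · have e : ∀ u, Function.update y (Fin.last (q + 1)).succ u (Fin.last (q + 2)) = u :=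
          fun u => by rw [Fin.succ_last, Function.update_self]
        simp only [e, hlast, mul_sub, Finset.sum_sub_distrib, hδ]
        rw [← Finset.sum_mul, hsum, one_mul, sub_self]
      · simp only [hne, hinit]
        rw [← Finset.mul_sum]
        refine Fin.lastCases ?_ (fun i => ?_) i
        · have e : ∀ u, Function.update (Fin.init y : Fin (q + 2) → Γ) (Fin.last q).succ u
              (Fin.last (q + 1)) = u := fun u => by rw [Fin.succ_last, Function.update_self]
          simp only [e, hlast, Finset.sum_sub_distrib]
          rw [← Finset.sum_mul, hsum, one_mul, Finset.sum_ite_eq']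
          split_ifs with hz
          · rw [sub_self, mul_zero]
          · rw [hA.eq_zero _ hz]; simp
        · simp only [hne, hinit, Finset.sum_sub_distrib]
          rw [← Finset.mul_sum, hW p q i]
          split_ifs
          · rw [hW p q i]; simp
          · simp
  intro p q i y v
  have e : ∀ y, NCChern.curv h W p q y m v = curvD h W p q y m v + curvH h W p q y m v :=
    fun y => rfl
  simp only [e, Finset.sum_add_distrib]
  rw [hD p q i y v, hH p q i y v, add_zero]

theorem reducedAt_iterate {h : M' → ℝ} {A : Finset Γ} {m : M'}
    (hA : IsPartitionAt (n := n) h m A) (j : ℕ) :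
    ReducedAt A m ((curv h)^[j] (frame : BForm Γ n M')) := by
  induction j with
  | zero => exact reducedAt_frame A m
  | succ j ih => rw [Function.iterate_succ_apply']; exact ih.curv hA

end Powers

/-! ### The Chern character and its pairing with cyclic cocycles -/

section ChernPairing

variable {Γ : Type*} [Group Γ] {n : ℕ} {M' : Type*} [TopologicalSpace M']
  [ChartedSpace (EuclideanSpace ℝ (Fin n)) M'] [MulAction Γ M'] [IsManifold (𝓡 n) ∞ M']
  {h : M' → ℝ} {A : Finset Γ} {m : M'}

theorem chernAt_fromY (hs : ∀ g : Γ, ContMDiff (𝓡 n) 𝓘(ℝ, ℝ) ∞ (translate h g))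
    (hh : ∀ m, ∑ᶠ g : Γ, h (g • m) = 1) (p q : ℕ) (m : M')
    (v : Fin p → EuclideanSpace ℝ (Fin n)) (y : Fin (q + 1) → Γ) :
    chernAt h p q m v (fromY y) = ∑ j ∈ Finset.range (p + q + 1),
      ((-1 : ℂ) ^ j / (j.factorial : ℂ)) * (curv h)^[j] frame p q y m v := by
  have e : ∀ j, ((fun S => nabla h (nabla h S))^[j] (frame : BForm Γ n M')) p q (fromY y) m v =
      (curv h)^[j] frame p q y m v := by
    intro j
    rw [(iterate_nabla hs hh j).1]
    change (curv h)^[j] frame p q (toY (fromY y)) m v = _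
    rw [toY_fromY]
  simp only [← e, chernAt, chern]
  rw [Finset.sum_apply, Finset.sum_apply, ContinuousAlternatingMap.sum_apply]
  rfl

theorem chernAt_eq_zero (hs : ∀ g : Γ, ContMDiff (𝓡 n) 𝓘(ℝ, ℝ) ∞ (translate h g))
    (hh : ∀ m, ∑ᶠ g : Γ, h (g • m) = 1) (hA : IsPartitionAt (n := n) h m A) {p q : ℕ}
    (v : Fin p → EuclideanSpace ℝ (Fin n)) {y : Fin (q + 1) → Γ}
    (hy : y 0 ≠ 1 ∨ ∃ i : Fin q, y i.succ ∉ A) : chernAt h p q m v (fromY y) = 0 := by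
  rw [chernAt_fromY hs hh]
  refine Finset.sum_eq_zero fun j _ => ?_
  rw [supportedAt_iterate hA j p q y hy]
  exact mul_zero _

theorem chernAt_eq_zero_of_notMem (hs : ∀ g : Γ, ContMDiff (𝓡 n) 𝓘(ℝ, ℝ) ∞ (translate h g))
    (hh : ∀ m, ∑ᶠ g : Γ, h (g • m) = 1) (hA : IsPartitionAt (n := n) h m A) (h1 : (1 : Γ) ∈ A)
    {p q : ℕ} (v : Fin p → EuclideanSpace ℝ (Fin n)) {y : Fin (q + 1) → Γ}
    (hy : y ∉ tuples A (q + 1)) : chernAt h p q m v (fromY y) = 0 := by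
  refine chernAt_eq_zero hs hh hA v ?_
  by_contra! hc
  refine hy (mem_tuples.2 fun i => ?_)
  refine Fin.cases ?_ (fun i => ?_) i
  · rw [hc.1]; exact h1
  · exact hc.2 i

/-- At a given point only tuples with entries in the finite set A contribute, so rapid decay is
automatic; the remaining condition is `reducedAt_iterate`. -/
theorem isForm_chernAt (S : Set Γ) (hs : ∀ g : Γ, ContMDiff (𝓡 n) 𝓘(ℝ, ℝ) ∞ (translate h g))
    (hh : ∀ m, ∑ᶠ g : Γ, h (g • m) = 1) (hA : IsPartitionAt (n := n) h m A) (h1 : (1 : Γ) ∈ A)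
    (p q : ℕ) (v : Fin p → EuclideanSpace ℝ (Fin n)) :
    IsForm S (chernAt (Γ := Γ) h p q m v) := by
  rw [isForm_iff]
  constructor
  · intro r
    refine ⟨∑ y ∈ tuples A (q + 1), Real.exp (r * totalLength S (fromY y)) *
      ‖chernAt h p q m v (fromY y)‖, fun γ => ?_⟩
    obtain ⟨y, rfl⟩ : ∃ y, γ = fromY y := ⟨_, (fromY_toY γ).symm⟩
    by_cases hy : y ∈ tuples A (q + 1)
    · exact Finset.single_le_sum (f := fun y => Real.exp (r * totalLength S (fromY y)) *
        ‖chernAt h p q m v (fromY y)‖) (fun y _ => by positivity) hy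
    · rw [chernAt_eq_zero_of_notMem hs hh hA h1 v hy, norm_zero, mul_zero]
      exact Finset.sum_nonneg fun y _ => by positivity
  · intro i y
    rw [tsum_eq_sum (s := A)]
    · simp only [chernAt_fromY hs hh]
      rw [Finset.sum_comm]
      refine Finset.sum_eq_zero fun j _ => ?_
      rw [← Finset.mul_sum, reducedAt_iterate hA j p q i y v, mul_zero]
    · intro u hu
      refine chernAt_eq_zero hs hh hA v (Or.inr ⟨i, ?_⟩)
      rwa [Function.update_self]

theorem evalCochain_eq_sum (hs : ∀ g : Γ, ContMDiff (𝓡 n) 𝓘(ℝ, ℝ) ∞ (translate h g))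
    (hh : ∀ m, ∑ᶠ g : Γ, h (g • m) = 1) (hA : IsPartitionAt (n := n) h m A) (h1 : (1 : Γ) ∈ A)
    {p q : ℕ} (v : Fin p → EuclideanSpace ℝ (Fin n)) (Z : Chain Γ ℂ q) :
    evalCochain Z (chernAt h p q m v) =
      ∑ y ∈ tuples A (q + 1), Z (fromY y) * chernAt h p q m v (fromY y) := by
  rw [evalCochain, ← (suffixEquiv Γ q).tsum_eq, tsum_eq_sum (s := tuples A (q + 1))]
  · rfl
  · intro y hy
    change Z (fromY y) * chernAt h p q m v (fromY y) = 0
    rw [chernAt_eq_zero_of_notMem hs hh hA h1 v hy, mul_zero]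

/-- Every nonzero coefficient sits at total product 1, which is not conjugate to x. -/
theorem evalCochain_of_ne_one (hs : ∀ g : Γ, ContMDiff (𝓡 n) 𝓘(ℝ, ℝ) ∞ (translate h g))
    (hh : ∀ m, ∑ᶠ g : Γ, h (g • m) = 1) (hA : IsPartitionAt (n := n) h m A) (h1 : (1 : Γ) ∈ A)
    {x : Γ} (hx : x ≠ 1) {p k : ℕ} (v : Fin p → EuclideanSpace ℝ (Fin n)) (τ : Chain Γ ℂ k) :
    evalCochain (cyclicCocycle x τ) (chernAt h p k m v) = 0 := by
  rw [evalCochain_eq_sum hs hh hA h1]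
  refine Finset.sum_eq_zero fun y _ => ?_
  by_cases hy : y 0 = 1
  · rw [cyclicCocycle_eq_zero, zero_mul]
    rintro ⟨g, hg⟩
    rw [toY_fromY, hy] at hg
    exact hx (conj_eq_one_iff.1 hg.symm)
  · rw [chernAt_eq_zero hs hh hA v (Or.inl hy), mul_zero]

/-- At total product 1 the conjugator can be taken to be 1, so the cyclic cocycle is τ in suffix
coordinates; as τ is alternating, `altEq_iterate` discards `curvH`. -/
theorem evalCochain_one (hs : ∀ g : Γ, ContMDiff (𝓡 n) 𝓘(ℝ, ℝ) ∞ (translate h g))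
    (hh : ∀ m, ∑ᶠ g : Γ, h (g • m) = 1) (hA : IsPartitionAt (n := n) h m A) (h1 : (1 : Γ) ∈ A)
    {p k : ℕ} (v : Fin p → EuclideanSpace ℝ (Fin n)) {τ : Chain Γ ℂ k} (hτ : IsCocycle 1 τ) :
    evalCochain (cyclicCocycle 1 τ) (chernAt h p k m v) =
      ∑ j ∈ Finset.range (p + k + 1), ((-1 : ℂ) ^ j / (j.factorial : ℂ)) *
        ∑ y ∈ tuples A (k + 1), τ y * (curvD h)^[j] frame p k y m v := by
  rw [evalCochain_eq_sum hs hh hA h1]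
  have e : ∀ y, cyclicCocycle 1 τ (fromY y) * chernAt h p k m v (fromY y) =
      τ y * chernAt h p k m v (fromY y) := by
    intro y
    by_cases hy : y 0 = 1
    · rw [cyclicCocycle_eq hτ (g := 1) (by rw [toY_fromY, hy]; simp), toY_fromY]
      simp
    · rw [chernAt_eq_zero hs hh hA v (Or.inl hy), mul_zero, mul_zero]
  rw [Finset.sum_congr rfl fun y _ => e y]
  simp only [chernAt_fromY hs hh, Finset.mul_sum]
  rw [Finset.sum_comm]
  refine Finset.sum_congr rfl fun j _ => ?_
  have := altEq_iterate (n := n) h A j p k τ hτ.isAlt m v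
  simp only [← mul_assoc, mul_comm (τ _)] at this ⊢
  simp only [mul_assoc]
  rw [← Finset.mul_sum, ← Finset.mul_sum]
  exact congrArg _ this

theorem evalCochain_one_of_ne (hs : ∀ g : Γ, ContMDiff (𝓡 n) 𝓘(ℝ, ℝ) ∞ (translate h g))
    (hh : ∀ m, ∑ᶠ g : Γ, h (g • m) = 1) (hA : IsPartitionAt (n := n) h m A) (h1 : (1 : Γ) ∈ A)
    {p k : ℕ} (hpk : p ≠ k) (v : Fin p → EuclideanSpace ℝ (Fin n)) {τ : Chain Γ ℂ k}
    (hτ : IsCocycle 1 τ) : evalCochain (cyclicCocycle 1 τ) (chernAt h p k m v) = 0 := by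
  rw [evalCochain_one hs hh hA h1 v hτ]
  refine Finset.sum_eq_zero fun j _ => ?_
  rw [Finset.sum_eq_zero, mul_zero]
  intro y _
  rw [iterate_curvD_of_ne h j p k fun hj => hpk (hj.1.trans hj.2.symm)]
  exact mul_zero _

/-- Bidegree (k, k) is reached only by the k-th power, whence the coefficient of the exponential
series. -/
theorem evalCochain_one_self (hs : ∀ g : Γ, ContMDiff (𝓡 n) 𝓘(ℝ, ℝ) ∞ (translate h g))
    (hh : ∀ m, ∑ᶠ g : Γ, h (g • m) = 1) (hA : IsPartitionAt (n := n) h m A) (h1 : (1 : Γ) ∈ A)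
    {k : ℕ} (v : Fin k → EuclideanSpace ℝ (Fin n)) {τ : Chain Γ ℂ k} (hτ : IsCocycle 1 τ) :
    evalCochain (cyclicCocycle 1 τ) (chernAt h k k m v) =
      ((-1 : ℂ) ^ k / (k.factorial : ℂ)) *
        ∑ y ∈ tuples A k, τ (Fin.cons 1 y) * dhForm h y m v := by
  classical
  rw [evalCochain_one hs hh hA h1 v hτ, Finset.sum_eq_single k]
  · congr 1
    rw [sum_tuples_cons, Finset.sum_eq_single 1]
    · refine Finset.sum_congr rfl fun y _ => ?_
      rw [iterate_curvD, Fin.cons_zero, if_pos rfl, Fin.tail_cons]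
    · intro z _ hz
      refine Finset.sum_eq_zero fun y _ => ?_
      rw [iterate_curvD, Fin.cons_zero, if_neg hz, mul_zero]
    · exact fun h => absurd h1 h
  · intro j _ hj
    rw [Finset.sum_eq_zero, mul_zero]
    intro y _
    rw [iterate_curvD_of_ne h j k k fun hk => hj hk.1.symm]
    exact mul_zero _
  · intro hk
    exact absurd (Finset.mem_range.2 (by omega)) hk

end ChernPairing

/-! ### Pull-back of forms by smooth maps -/

section PullBack

variable {n : ℕ} {N M : Type*} [TopologicalSpace N] [ChartedSpace (EuclideanSpace ℝ (Fin n)) N]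
  [TopologicalSpace M] [ChartedSpace (EuclideanSpace ℝ (Fin n)) M]

/-- The pull-back of a form by a map of manifolds. -/
def pullBack (f : N → M) {p : ℕ} (α : DForm n M p) : DForm n N p := fun x =>
  (α (f x)).compContinuousLinearMap
    (show EuclideanSpace ℝ (Fin n) →L[ℝ] EuclideanSpace ℝ (Fin n) from mfderiv (𝓡 n) (𝓡 n) f x)

theorem pullForm_pullBack {X : Type*} [NormedAddCommGroup X] [NormedSpace ℝ X] {p : ℕ}
    {f : N → M} {s : X → N} {x : X} (α : DForm n M p)
    (hf : MDifferentiableAt (𝓡 n) (𝓡 n) f (s x)) (hs : MDifferentiableAt 𝓘(ℝ, X) (𝓡 n) s x) :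
    pullForm (fun z => f (s z)) α x = pullForm s (pullBack f α) x := by
  have h : mfderiv 𝓘(ℝ, X) (𝓡 n) (fun z => f (s z)) x =
    (mfderiv (𝓡 n) (𝓡 n) f (s x)).comp (mfderiv 𝓘(ℝ, X) (𝓡 n) s x) := mfderiv_comp x hf hs
  ext v
  simp only [pullForm, pullBack]
  rw [h]
  rfl

theorem IsParam.comp {k : ℕ} {σ : Simplex k → N} {G : (Fin k → ℝ) → N} (hG : IsParam n σ G)
    {f : N → M} (hf : ContMDiff (𝓡 n) (𝓡 n) ∞ f) : IsParam n (f ∘ σ) (fun t => f (G t)) :=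
  fun t ht => by
    refine ⟨(hf _).comp t (hG t ht).1, ?_⟩
    rw [simplexCoord_of_mem _ ht, Function.comp, ← simplexCoord_of_mem σ ht, ← (hG t ht).2]

theorem integrate_comp {k : ℕ} {σ : Simplex k → N} {G : (Fin k → ℝ) → N} (hG : IsParam n σ G)
    {f : N → M} (hf : ContMDiff (𝓡 n) (𝓡 n) ∞ f) (α : DForm n M k) :
    integrate α (f ∘ σ) = integrate (pullBack f α) σ := by
  rw [integrate_eq (hG.comp hf), integrate_eq hG]
  refine MeasureTheory.setIntegral_congr_fun (measurableSet_corner _) fun t ht => ?_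
  rw [pullForm_pullBack α (hf.mdifferentiable (by simp) _) ((hG t ht).1.mdifferentiableAt (by simp))]

theorem IsSmoothForm.congr_of_eventuallyEq [IsManifold (𝓡 n) ∞ M] {p : ℕ} {α : DForm n M p}
    (h : ∀ x, ∃ β : DForm n M p, IsSmoothForm β ∧ α =ᶠ[𝓝 x] β) : IsSmoothForm α := by
  refine isSmoothForm_of_contDiffAt fun x₀ y hy => ?_
  obtain ⟨β, hβ, he⟩ := h ((extChartAt (𝓡 n) x₀).symm y)
  refine (hβ.contDiffAt hy).congr_of_eventuallyEq ?_
  filter_upwards [(contMDiffAt_extChartAt_symm hy).continuousAt.eventually he] with z hz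
  simp only [chartRep, hz]

theorem extd_congr_of_eventuallyEq {p : ℕ} {α β : DForm n M p} {x : M} (he : α =ᶠ[𝓝 x] β) :
    extd α x = extd β x := by
  have : chartRep α x =ᶠ[𝓝 (extChartAt (𝓡 n) x x)] chartRep β x := by
    have hc : ContinuousAt (extChartAt (𝓡 n) x).symm (extChartAt (𝓡 n) x x) :=
      continuousAt_extChartAt_symm x
    have h2 : ∀ᶠ z in 𝓝 ((extChartAt (𝓡 n) x).symm (extChartAt (𝓡 n) x x)), α z = β z := by
      rw [extChartAt_to_inv]; exact he
    filter_upwards [hc.eventually h2] with z hz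
    simp only [chartRep, hz]
  rw [extd, extd, extDeriv, extDeriv, this.fderiv_eq]

theorem dfun_sum [IsManifold (𝓡 n) ∞ M] {ι : Type*} (A : Finset ι) {u : ι → M → ℝ} {x : M}
    (hu : ∀ i ∈ A, MDifferentiableAt (𝓡 n) 𝓘(ℝ, ℝ) (u i) x)
    (hs : MDifferentiableAt (𝓡 n) 𝓘(ℝ, ℝ) (fun z => ∑ i ∈ A, u i z) x) :
    dfun (n := n) (fun z => ∑ i ∈ A, u i z) x = ∑ i ∈ A, dfun (n := n) (u i) x := by
  rw [← fderiv_comp_extChartAt_symm hs]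
  have hd : ∀ i ∈ A, DifferentiableAt ℝ (fun y => u i ((extChartAt (𝓡 n) x).symm y))
      (extChartAt (𝓡 n) x x) := by
    intro i hi
    have h1 : MDifferentiableAt (𝓡 n) 𝓘(ℝ, ℝ) (u i)
        ((extChartAt (𝓡 n) x).symm (extChartAt (𝓡 n) x x)) := by
      rw [extChartAt_to_inv]; exact hu i hi
    have h2 := (contMDiffAt_extChartAt_symm (mem_extChartAt_target (I := 𝓡 n) x)).mdifferentiableAt
      (by simp)
    exact mdifferentiableAt_iff_differentiableAt.1 (h1.comp _ h2)
  rw [fderiv_fun_sum hd]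
  exact Finset.sum_congr rfl fun i hi => fderiv_comp_extChartAt_symm (hu i hi)

theorem dfun_congr {u w : M → ℝ} {x : M} (he : u =ᶠ[𝓝 x] w) :
    dfun (n := n) u x = dfun (n := n) w x := he.mfderiv_eq

theorem dfun_const (c : ℝ) (x : M) : dfun (n := n) (fun _ : M => c) x = 0 := mfderiv_const

end PullBack

/-! ### Normal coverings -/

section Coverings

/-- A covering transformation matches the two lifts at one point, and lifts from a connected space
that agree at a point agree everywhere. -/
theorem IsNormalCovering.exists_smul_eq {Γ : Type*} [Group Γ] {E B X : Type*} [TopologicalSpace E]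
    [TopologicalSpace B] [MulAction Γ E] [TopologicalSpace X] [PreconnectedSpace X] [Nonempty X]
    {π : E → B} (hπ : IsNormalCovering Γ π) {f₁ f₂ : X → E} (h₁ : Continuous f₁)
    (h₂ : Continuous f₂) (he : π ∘ f₁ = π ∘ f₂) : ∃ g : Γ, ∀ x, g • f₁ x = f₂ x := by
  obtain ⟨x₀⟩ := ‹Nonempty X›
  obtain ⟨g, hg⟩ := (hπ.fiber _ _).1 (congrFun he x₀)
  refine ⟨g, congrFun (hπ.covering.eq_of_comp_eq ((hπ.continuous_smul g).comp h₁) h₂ ?_ x₀ hg)⟩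
  funext x
  rw [← he]
  exact ((hπ.fiber _ _).2 ⟨g, rfl⟩).symm

variable {Γ : Type*} [Group Γ] {n : ℕ} {M M' : Type*}
  [TopologicalSpace M] [ChartedSpace (EuclideanSpace ℝ (Fin n)) M]
  [TopologicalSpace M'] [ChartedSpace (EuclideanSpace ℝ (Fin n)) M'] [MulAction Γ M'] {π : M' → M}

theorem IsNormalCovering.map_smul (hπ : IsNormalCovering Γ π) (g : Γ) (m : M') :
    π (g • m) = π m := ((hπ.fiber _ _).2 ⟨g, rfl⟩).symm

/-- A continuous lift of a smooth map to the covering is smooth. -/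
theorem contMDiffAt_of_comp {H F N : Type*} [NormedAddCommGroup F] [NormedSpace ℝ F]
    [TopologicalSpace H] {I : ModelWithCorners ℝ F H} [TopologicalSpace N] [ChartedSpace H N]
    (hd : IsLocalDiffeomorph (𝓡 n) (𝓡 n) ∞ π) {f : N → M'} {x : N} (hc : ContinuousAt f x)
    (hf : ContMDiffAt I (𝓡 n) ∞ (fun z => π (f z)) x) : ContMDiffAt I (𝓡 n) ∞ f x := by
  have hl := hd (f x)
  have h1 : ContMDiffAt I (𝓡 n) ∞ (fun z => hl.localInverse (π (f z))) x :=
    hl.localInverse_contMDiffAt.comp x hf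
  refine h1.congr_of_eventuallyEq ?_
  filter_upwards [hc.eventually hl.localInverse_eventuallyEq_left] with z hz
  exact hz.symm

theorem IsNormalCovering.contMDiff_smul (hπ : IsNormalCovering Γ π)
    (hd : IsLocalDiffeomorph (𝓡 n) (𝓡 n) ∞ π) (g : Γ) :
    ContMDiff (𝓡 n) (𝓡 n) ∞ fun m : M' => g • m := fun m => by
  refine contMDiffAt_of_comp hd (hπ.continuous_smul g).continuousAt ?_
  simp only [hπ.map_smul]
  exact hd.contMDiff m

/-- Compactness reduces this to a neighbourhood of each k in K. If k lies over the same point as m₀,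
a sheet around k admits a single group element, since π is injective on it and the action is free.
Otherwise the images of k and m₀ have disjoint neighbourhoods, as M is Hausdorff. -/
theorem IsNormalCovering.finite_smul_mem [T2Space M] (hπ : IsNormalCovering Γ π) (m₀ : M')
    {K : Set M'} (hK : IsCompact K) : ∃ U ∈ 𝓝 m₀, {g : Γ | ∃ m ∈ U, g • m ∈ K}.Finite := by
  have hcont : Continuous π := hπ.covering.continuous
  refine hK.induction_on (p := fun K => ∃ U ∈ 𝓝 m₀, {g : Γ | ∃ m ∈ U, g • m ∈ K}.Finite)
    ⟨Set.univ, Filter.univ_mem, by simp⟩ ?_ ?_ ?_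
  · rintro s t hst ⟨U, hU, hf⟩
    exact ⟨U, hU, hf.subset fun g ⟨m, hm, hg⟩ => ⟨m, hm, hst hg⟩⟩
  · rintro s t ⟨U, hU, hf⟩ ⟨U', hU', hf'⟩
    refine ⟨U ∩ U', Filter.inter_mem hU hU', (hf.union hf').subset ?_⟩
    rintro g ⟨m, hm, hg | hg⟩
    · exact Or.inl ⟨m, hm.1, hg⟩
    · exact Or.inr ⟨m, hm.2, hg⟩
  · intro k _
    by_cases hk : π k = π m₀
    · obtain ⟨g₀, hg₀⟩ := (hπ.fiber m₀ k).1 hk.symm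
      obtain ⟨e, hke, he⟩ := hπ.covering.isLocalHomeomorph k
      have hN : e.source ∈ 𝓝 k := e.open_source.mem_nhds hke
      refine ⟨e.source, mem_nhdsWithin_of_mem_nhds hN, (fun m => g₀ • m) ⁻¹' e.source,
        (hπ.continuous_smul g₀).continuousAt.preimage_mem_nhds (by rwa [hg₀]), ?_⟩
      refine (Set.finite_singleton g₀).subset ?_
      rintro g ⟨m, hm, hg⟩
      have h1 : g • m = g₀ • m := by
        refine e.injOn hg hm ?_
        rw [← he, hπ.map_smul, hπ.map_smul]
      have h2 := hπ.free (g₀⁻¹ * g) m (by rw [mul_smul, h1, inv_smul_smul])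
      exact (inv_mul_eq_one.1 h2).symm
    · obtain ⟨V, U, hV, hU, hkV, hmU, hdis⟩ := t2_separation hk
      refine ⟨π ⁻¹' V, mem_nhdsWithin_of_mem_nhds (hcont.continuousAt.preimage_mem_nhds
        (hV.mem_nhds hkV)), π ⁻¹' U, hcont.continuousAt.preimage_mem_nhds (hU.mem_nhds hmU), ?_⟩
      refine Set.finite_empty.subset ?_
      rintro g ⟨m, hm, hg⟩
      have hg' : π (g • m) ∈ V := hg
      rw [hπ.map_smul] at hg'
      exact hdis.le_bot ⟨hg', hm⟩

theorem IsNormalCovering.exists_partition [T2Space M] [IsManifold (𝓡 n) ∞ M']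
    (hπ : IsNormalCovering Γ π)
    (hd : IsLocalDiffeomorph (𝓡 n) (𝓡 n) ∞ π) {h : M' → ℝ} (hsm : ContMDiff (𝓡 n) 𝓘(ℝ, ℝ) ∞ h)
    (hK : HasCompactSupport h) (hh : ∀ m, ∑ᶠ g : Γ, h (g • m) = 1) (m₀ : M') :
    ∃ A : Finset Γ, 1 ∈ A ∧ ∀ᶠ m in 𝓝 m₀, IsPartitionAt (n := n) h m A := by
  classical
  obtain ⟨U, hU, hfin⟩ := hπ.finite_smul_mem m₀ hK
  -- The first entry of every nonzero coefficient is 1, so A has to contain 1 even where h itself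
  -- vanishes near m₀.
  set A : Finset Γ := insert 1 hfin.toFinset with hA
  have hz : ∀ m ∈ U, ∀ g ∉ A, translate h g m = 0 := by
    intro m hm g hg
    by_contra hc
    refine hg (Finset.mem_insert_of_mem (hfin.mem_toFinset.2 ⟨m, hm, ?_⟩))
    exact subset_tsupport _ hc
  have hs : ∀ m ∈ U, ∑ g ∈ A, translate h g m = 1 := by
    intro m hm
    rw [← hh m]
    symm
    refine finsum_eq_sum_of_support_subset _ fun g hg => ?_
    by_contra hc
    exact hg (hz m hm g hc)
  have hsg : ∀ g, MDifferentiable (𝓡 n) 𝓘(ℝ, ℝ) (translate h g : M' → ℝ) := fun g =>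
    (hsm.comp (hπ.contMDiff_smul hd g)).mdifferentiable (by simp)
  refine ⟨A, Finset.mem_insert_self _ _, ?_⟩
  filter_upwards [eventually_mem_nhds_iff.2 hU] with m hm
  refine ⟨hz m (mem_of_mem_nhds hm), fun g hg => ?_, hs m (mem_of_mem_nhds hm), ?_⟩
  · rw [dfun_congr (w := fun _ => 0), dfun_const]
    filter_upwards [hm] with z hz' using hz z hz' g hg
  -- The same finite A serves a whole neighbourhood, so the sum is locally constant and its
  -- differential vanishes.
  · have he : (fun z => ∑ g ∈ A, translate h g z) =ᶠ[𝓝 m] fun _ => 1 := by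
      filter_upwards [hm] with z hz' using hs z hz'
    rw [← dfun_sum A (fun g _ => hsg g m), dfun_congr he, dfun_const]
    exact (mdifferentiableAt_const (c := (1 : ℝ))).congr_of_eventuallyEq he

/-- A convex open set is contractible and locally path connected, so the lifting criterion for
coverings applies. -/
theorem exists_lift {X : Type*} [NormedAddCommGroup X] [NormedSpace ℝ X] (hπ : IsNormalCovering Γ π)
    {V : Set X} (hV : IsOpen V) (hcv : Convex ℝ V) {t₀ : X} (ht₀ : t₀ ∈ V) {G : X → M}
    (hG : ContinuousOn G V) : ∃ G' : X → M', ContinuousOn G' V ∧ ∀ t ∈ V, π (G' t) = G t := by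
  classical
  have : ContractibleSpace V := hcv.contractibleSpace ⟨t₀, ht₀⟩
  have : LocallyPathConnectedSpace V := hV.locallyPathConnectedSpace
  obtain ⟨e₀, he₀⟩ := hπ.surjective (G t₀)
  obtain ⟨F, ⟨-, hF⟩, -⟩ := hπ.covering.existsUnique_continuousMap_lifts
    ⟨V.domRestrict G, hG.domRestrict⟩ ⟨t₀, ht₀⟩ e₀ he₀
  refine ⟨fun t => if ht : t ∈ V then F ⟨t, ht⟩ else e₀, ?_, fun t ht => ?_⟩
  · rw [continuousOn_iff_continuous_domRestrict]
    have : V.domRestrict (fun t => if ht : t ∈ V then F ⟨t, ht⟩ else e₀) = F := by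
      funext t
      exact dif_pos t.2
    rw [this]
    exact F.continuous
  · simp only [dif_pos ht]
    exact congrFun hF ⟨t, ht⟩

theorem IsSmoothSimplex.exists_lift (hπ : IsNormalCovering Γ π)
    (hd : IsLocalDiffeomorph (𝓡 n) (𝓡 n) ∞ π) {k : ℕ} {σ : Simplex k → M}
    (hσ : IsSmoothSimplex n σ) :
    ∃ (σ' : Simplex k → M') (G' : (Fin k → ℝ) → M'), IsParam n σ' G' ∧ π ∘ σ' = σ := by
  obtain ⟨V, G, hV, hcv, hsub, hG, hGσ⟩ := hσ.exists_convex
  obtain ⟨G', hc, hG'⟩ := NCChern.exists_lift hπ hV hcv (hsub (zero_mem_corner k))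
    fun t ht => (hG t ht).continuousAt.continuousWithinAt
  refine ⟨fun x => G' (Fin.tail x.1), G', fun t ht => ⟨?_, ?_⟩, ?_⟩
  · refine contMDiffAt_of_comp hd (hc.continuousAt (hV.mem_nhds (hsub ht))) ?_
    refine (hG t (hsub ht)).congr_of_eventuallyEq ?_
    filter_upwards [hV.mem_nhds (hsub ht)] with z hz using hG' z hz
  · rw [simplexCoord_of_mem _ ht]
    rfl
  · funext x
    have hx := tail_mem_corner x
    change π (G' (Fin.tail x.1)) = σ x
    rw [hG' _ (hsub hx), hGσ _ hx, simplexCoord_of_mem _ hx]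
    congr 1
    exact Subtype.ext (baryCoord_tail x)

theorem IsParam.continuous {k : ℕ} {σ : Simplex k → M} {G : (Fin k → ℝ) → M}
    (hG : IsParam n σ G) : Continuous σ := by
  have h1 : ∀ x : Simplex k, σ x = G (Fin.tail x.1) := by
    intro x
    have hx := tail_mem_corner x
    rw [(hG _ hx).2, simplexCoord_of_mem _ hx]
    congr 1
    exact Subtype.ext (baryCoord_tail x).symm
  rw [continuous_iff_continuousAt]
  intro x
  have h2 : ContinuousAt (fun x : Simplex k => G (Fin.tail x.1)) x := by
    refine ContinuousAt.comp (f := fun x : Simplex k => (Fin.tail x.1 : Fin k → ℝ))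
      (hG _ (tail_mem_corner x)).1.continuousAt ?_
    refine Continuous.continuousAt ?_
    exact continuous_pi fun i => (continuous_apply i.succ).comp continuous_subtype_val
  exact h2.congr (Filter.Eventually.of_forall fun x => (h1 x).symm)

instance (k : ℕ) : PreconnectedSpace (Simplex k) :=
  isPreconnected_iff_preconnectedSpace.1 (convex_stdSimplex ℝ _).isPreconnected

instance (k : ℕ) : Nonempty (Simplex k) := ⟨vertex 0⟩

end Coverings

/-! ### Invariant forms built from a partition of unity -/

section PartitionForms

theorem sum_tuples_eq_zero {Γ R : Type*} [AddCommMonoid R] (A : Finset Γ) {q : ℕ}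
    {f : (Fin q → Γ) → R} (i : Fin q) (hf : ∀ y, ∑ u ∈ A, f (Function.update y i u) = 0) :
    ∑ y ∈ tuples A q, f y = 0 := by
  classical
  match q with
  | 0 => exact i.elim0
  | q + 1 =>
    have key : ∑ y ∈ tuples A (q + 1), f y =
        ∑ p ∈ tuples A q ×ˢ A, f (i.insertNth p.2 p.1) := by
      refine Finset.sum_bij' (fun y _ => (i.removeNth y, y i)) (fun p _ => i.insertNth p.2 p.1)
        ?_ ?_ ?_ ?_ ?_
      · intro y hy
        rw [mem_tuples] at hy
        exact Finset.mem_product.2 ⟨mem_tuples.2 fun j => hy _, hy _⟩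
      · rintro ⟨x, z⟩ h
        obtain ⟨h1, h2⟩ := Finset.mem_product.1 h
        rw [mem_tuples]
        intro j
        refine Fin.succAboveCases i ?_ (fun j => ?_) j
        · simpa using h2
        · simpa using mem_tuples.1 h1 j
      · intro y _; exact Fin.insertNth_self_removeNth i y
      · rintro ⟨x, z⟩ _; simp
      · intro y _; simp
    rw [key, Finset.sum_product]
    refine Finset.sum_eq_zero fun x _ => ?_
    rcases A.eq_empty_or_nonempty with rfl | ⟨u₀, _⟩
    · rfl
    · refine Eq.trans (Finset.sum_congr rfl fun u _ => ?_) (hf (i.insertNth u₀ x))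
      rw [Fin.update_insertNth]

variable {Γ : Type*} [Group Γ] {n : ℕ} {M' : Type*} [TopologicalSpace M']
  [ChartedSpace (EuclideanSpace ℝ (Fin n)) M'] [MulAction Γ M']
  {h : M' → ℝ} {A : Finset Γ} {m : M'}

/-- The translates of `h` form a smooth locally finite partition of unity. -/
structure IsPartition (Γ : Type*) [Group Γ] (n : ℕ) [ChartedSpace (EuclideanSpace ℝ (Fin n)) M']
    [MulAction Γ M'] (h : M' → ℝ) : Prop where
  smooth : ∀ g : Γ, ContMDiff (𝓡 n) 𝓘(ℝ, ℝ) ∞ (translate h g)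
  exists_finset : ∀ m₀ : M', ∃ A : Finset Γ, 1 ∈ A ∧ ∀ᶠ m in 𝓝 m₀, IsPartitionAt (n := n) h m A

theorem IsPartition.exists_at (hP : IsPartition Γ n h) (m : M') :
    ∃ A : Finset Γ, 1 ∈ A ∧ IsPartitionAt (n := n) h m A := by
  obtain ⟨A, h1, hA⟩ := hP.exists_finset m
  exact ⟨A, h1, hA.self_of_nhds⟩

/-- `∑_y T(y) dh_{y₁} ∧ ⋯ ∧ dh_{y_b}`, up to sign. -/
def dhSum (h : M' → ℝ) {b : ℕ} (T : (Fin b → Γ) → ℂ) : DForm n M' b := fun m =>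
  ∑ᶠ y, T y • dhForm h y m

/-- `∑_y T(y) h_{y_{b + 1}} dh_{y₁} ∧ ⋯ ∧ dh_{y_b}`, up to sign. -/
def hSum (h : M' → ℝ) {b : ℕ} (T : (Fin (b + 1) → Γ) → ℂ) : DForm n M' b := fun m =>
  ∑ᶠ y, T y • translate h (y (Fin.last b)) m • dhForm h (Fin.init y) m

theorem wedge_eq_zero {p : ℕ} {ℓ : EuclideanSpace ℝ (Fin n) →L[ℝ] ℝ}
    {α : (EuclideanSpace ℝ (Fin n)) [⋀^Fin p]→L[ℝ] ℂ} (h0 : ℓ = 0 ∨ α = 0) : wedge ℓ α = 0 := by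
  rcases h0 with rfl | rfl
  · exact congrFun (congrArg DFunLike.coe (map_zero (wedgeHom _ p))) α
  · exact map_zero (wedgeHom _ p ℓ)

theorem dhForm_eq_zero (hA : IsPartitionAt (n := n) h m A) : ∀ {b : ℕ} {y : Fin b → Γ},
    y ∉ tuples A b → dhForm (n := n) h y m = 0
  | 0, y, hy => absurd (mem_tuples.2 fun i => i.elim0) hy
  | b + 1, y, hy => by
    refine wedge_eq_zero ?_
    by_cases hl : y (Fin.last b) ∈ A
    · refine Or.inr (dhForm_eq_zero hA fun hi => hy (mem_tuples.2 fun i => ?_))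
      exact Fin.lastCases hl (fun i => mem_tuples.1 hi i) i
    · exact Or.inl (hA.dfun_eq_zero _ hl)

theorem translate_smul_dhForm_eq_zero (hA : IsPartitionAt (n := n) h m A) {b : ℕ}
    {y : Fin (b + 1) → Γ} (hy : y ∉ tuples A (b + 1)) :
    translate h (y (Fin.last b)) m • dhForm (n := n) h (Fin.init y) m = 0 := by
  by_cases hl : y (Fin.last b) ∈ A
  · rw [dhForm_eq_zero hA fun hi => hy (mem_tuples.2 fun i => ?_)]
    · ext v; exact smul_zero _
    · exact Fin.lastCases hl (fun i => mem_tuples.1 hi i) i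
  · rw [hA.eq_zero _ hl]
    ext v; exact zero_smul ℝ _

theorem smul_form_zero {p : ℕ} (c : ℂ) :
    c • (0 : (EuclideanSpace ℝ (Fin n)) [⋀^Fin p]→L[ℝ] ℂ) = 0 := by
  ext v; exact mul_zero c

theorem dhSum_eq (hA : IsPartitionAt (n := n) h m A) {b : ℕ} (T : (Fin b → Γ) → ℂ) :
    dhSum (n := n) h T m = ∑ y ∈ tuples A b, T y • dhForm h y m :=
  finsum_eq_sum_of_support_subset _ fun y hy => by
    by_contra hc
    exact hy (by simp only [dhForm_eq_zero hA hc, smul_form_zero])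

theorem hSum_eq (hA : IsPartitionAt (n := n) h m A) {b : ℕ} (T : (Fin (b + 1) → Γ) → ℂ) :
    hSum (n := n) h T m = ∑ y ∈ tuples A (b + 1),
      T y • translate h (y (Fin.last b)) m • dhForm h (Fin.init y) m :=
  finsum_eq_sum_of_support_subset _ fun y hy => by
    by_contra hc
    exact hy (by simp only [translate_smul_dhForm_eq_zero hA hc, smul_form_zero])

theorem dhSum_apply (hA : IsPartitionAt (n := n) h m A) {b : ℕ} (T : (Fin b → Γ) → ℂ)
    (v : Fin b → EuclideanSpace ℝ (Fin n)) :
    dhSum (n := n) h T m v = ∑ y ∈ tuples A b, T y * dhForm h y m v := by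
  rw [dhSum_eq hA, ContinuousAlternatingMap.sum_apply]
  rfl

theorem hSum_apply (hA : IsPartitionAt (n := n) h m A) {b : ℕ} (T : (Fin (b + 1) → Γ) → ℂ)
    (v : Fin b → EuclideanSpace ℝ (Fin n)) :
    hSum (n := n) h T m v = ∑ y ∈ tuples A (b + 1),
      T y * (translate h (y (Fin.last b)) m • dhForm h (Fin.init y) m v) := by
  rw [hSum_eq hA, ContinuousAlternatingMap.sum_apply]
  rfl

/-- The form is multilinear in the differentials, and these sum to zero over A. -/
theorem sum_dhForm_update (hA : IsPartitionAt (n := n) h m A) : ∀ {b : ℕ} (i : Fin b)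
    (y : Fin b → Γ) (v : Fin b → EuclideanSpace ℝ (Fin n)),
    ∑ u ∈ A, dhForm (n := n) h (Function.update y i u) m v = 0
  | 0, i, _, _ => i.elim0
  | b + 1, i, y, v => by
    simp only [dhForm, wedge_apply]
    rw [Finset.sum_comm]
    refine Finset.sum_eq_zero fun l _ => ?_
    refine Fin.lastCases ?_ (fun i => ?_) i
    · simp only [Function.update_self, Fin.init_update_last]
      rw [← Finset.smul_sum, ← Finset.sum_smul]
      have := congrArg (fun ℓ => ℓ (v l)) hA.sum_dfun
      simp only [_root_.sum_apply, _root_.zero_apply] at this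
      rw [this, zero_smul, smul_zero]
    · have hne : ∀ u, Function.update y i.castSucc u (Fin.last b) = y (Fin.last b) := fun u =>
        Function.update_of_ne (Fin.castSucc_lt_last _).ne' _ _
      simp only [hne, Fin.init_update_castSucc]
      rw [← Finset.smul_sum, ← Finset.smul_sum, sum_dhForm_update hA i, smul_zero, smul_zero]

/-- Sums of functions that do not depend on one of the entries vanish. -/
theorem dhSum_eq_zero (hP : IsPartition Γ n h) {b : ℕ} {T : (Fin b → Γ) → ℂ} (i : Fin b)
    (hT : ∀ y u, T (Function.update y i u) = T y) : dhSum (n := n) h T = 0 := by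
  funext m
  ext v
  obtain ⟨A, -, hA⟩ := hP.exists_at m
  rw [dhSum_apply hA]
  refine sum_tuples_eq_zero A i fun y => ?_
  simp only [hT]
  rw [← Finset.mul_sum, sum_dhForm_update hA, mul_zero]

theorem hSum_eq_zero (hP : IsPartition Γ n h) {b : ℕ} {T : (Fin (b + 1) → Γ) → ℂ} (i : Fin b)
    (hT : ∀ y u, T (Function.update y i.castSucc u) = T y) : hSum (n := n) h T = 0 := by
  funext m
  ext v
  obtain ⟨A, -, hA⟩ := hP.exists_at m
  rw [hSum_apply hA]
  refine sum_tuples_eq_zero A i.castSucc fun y => ?_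
  have hne : ∀ u, Function.update y i.castSucc u (Fin.last b) = y (Fin.last b) := fun u =>
    Function.update_of_ne (Fin.castSucc_lt_last _).ne' _ _
  simp only [hT, hne, Fin.init_update_castSucc]
  rw [← Finset.mul_sum, ← Finset.smul_sum, sum_dhForm_update hA, smul_zero, mul_zero]

/-- The last entry enters only through its weight h, and these weights sum to 1. -/
theorem hSum_eq_dhSum (hP : IsPartition Γ n h) {b : ℕ} {T : (Fin (b + 1) → Γ) → ℂ}
    {T' : (Fin b → Γ) → ℂ} (hT : ∀ y z, T (Fin.snoc y z) = T' y) :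
    hSum (n := n) h T = dhSum (n := n) h T' := by
  funext m
  ext v
  obtain ⟨A, -, hA⟩ := hP.exists_at m
  rw [hSum_apply hA, dhSum_apply hA, sum_tuples_snoc]
  refine Finset.sum_congr rfl fun x _ => ?_
  simp only [hT, Fin.snoc_last, Fin.init_snoc]
  rw [← Finset.mul_sum, ← Finset.sum_smul, hA.sum_eq, one_smul]

theorem hSum_sum_apply (hP : IsPartition Γ n h) {b : ℕ} {ι : Type*} (s : Finset ι) (c : ι → ℂ)
    (T : ι → (Fin (b + 1) → Γ) → ℂ) (m : M') (v : Fin b → EuclideanSpace ℝ (Fin n)) :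
    hSum (n := n) h (fun y => ∑ i ∈ s, c i * T i y) m v =
      ∑ i ∈ s, c i * hSum (n := n) h (T i) m v := by
  obtain ⟨A, -, hA⟩ := hP.exists_at m
  simp only [hSum_apply hA, Finset.sum_mul, Finset.mul_sum]
  rw [Finset.sum_comm]
  simp only [mul_assoc]

theorem dhSum_sum_apply (hP : IsPartition Γ n h) {b : ℕ} {ι : Type*} (s : Finset ι) (c : ι → ℂ)
    (T : ι → (Fin b → Γ) → ℂ) (m : M') (v : Fin b → EuclideanSpace ℝ (Fin n)) :
    dhSum (n := n) h (fun y => ∑ i ∈ s, c i * T i y) m v =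
      ∑ i ∈ s, c i * dhSum (n := n) h (T i) m v := by
  obtain ⟨A, -, hA⟩ := hP.exists_at m
  simp only [dhSum_apply hA, Finset.sum_mul, Finset.mul_sum]
  rw [Finset.sum_comm]
  simp only [mul_assoc]

/-! ### Exterior derivative and translates of the partition forms -/

section Smooth

variable [IsManifold (𝓡 n) ∞ M']

/-- For a closed form β, dh_g ∧ β is d(h_g β), so smoothness and closedness follow together by
induction. -/
theorem dhForm_smooth_closed (hP : IsPartition Γ n h) : ∀ {b : ℕ} (y : Fin b → Γ),
    IsSmoothForm (dhForm (n := n) h y) ∧ extd (dhForm (n := n) h y) = 0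
  | 0, y => by
    have hc : ∀ x, chartRep (dhForm (n := n) h y) x = fun _ =>
        ContinuousAlternatingMap.constOfIsEmpty ℝ (EuclideanSpace ℝ (Fin n)) (Fin 0) 1 := by
      intro x; funext z; ext v; rfl
    constructor
    · intro x₀
      rw [hc]
      exact contDiffOn_const
    · funext x
      rw [extd, hc, extDeriv]
      ext v
      rw [ContinuousAlternatingMap.alternatizeUncurryFin_apply]
      simp
  | b + 1, y => by
    obtain ⟨h1, h2⟩ := dhForm_smooth_closed hP (Fin.init y)
    have e : dhForm h y = extd (fun m => translate h (y (Fin.last b)) m •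
        dhForm (n := n) h (Fin.init y) m) := by
      rw [extd_smul (hP.smooth _) h1, h2]
      funext m
      ext v
      simp [dhForm]
    have h3 := h1.smul (hP.smooth (y (Fin.last b)))
    rw [e]
    exact ⟨h3.extd, extd_extd h3⟩

theorem extd_translate_smul_dhForm (hP : IsPartition Γ n h) {b : ℕ} (y : Fin (b + 1) → Γ) :
    extd (fun m => translate h (y (Fin.last b)) m • dhForm (n := n) h (Fin.init y) m) =
      dhForm h y := by
  obtain ⟨h1, h2⟩ := dhForm_smooth_closed hP (Fin.init y)
  rw [extd_smul (hP.smooth _) h1, h2]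
  funext m
  ext v
  simp [dhForm]

theorem dhSum_eventuallyEq {m₀ : M'} (hA : ∀ᶠ m in 𝓝 m₀, IsPartitionAt (n := n) h m A) {b : ℕ}
    (T : (Fin b → Γ) → ℂ) :
    dhSum (n := n) h T =ᶠ[𝓝 m₀] ∑ y ∈ tuples A b, T y • dhForm h y := by
  filter_upwards [hA] with m hm
  rw [dhSum_eq hm, Finset.sum_apply]
  rfl

theorem hSum_eventuallyEq {m₀ : M'} (hA : ∀ᶠ m in 𝓝 m₀, IsPartitionAt (n := n) h m A) {b : ℕ}
    (T : (Fin (b + 1) → Γ) → ℂ) :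
    hSum (n := n) h T =ᶠ[𝓝 m₀] ∑ y ∈ tuples A (b + 1), T y •
      (fun m => translate h (y (Fin.last b)) m • dhForm h (Fin.init y) m) := by
  filter_upwards [hA] with m hm
  rw [hSum_eq hm, Finset.sum_apply]
  rfl

theorem isSmoothForm_dhSum (hP : IsPartition Γ n h) {b : ℕ} (T : (Fin b → Γ) → ℂ) :
    IsSmoothForm (dhSum (n := n) h T) := by
  refine IsSmoothForm.congr_of_eventuallyEq fun m₀ => ?_
  obtain ⟨A, -, hA⟩ := hP.exists_finset m₀
  exact ⟨_, IsSmoothForm.sum _ fun y _ => (dhForm_smooth_closed hP y).1.const_smul _,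
    dhSum_eventuallyEq hA T⟩

theorem isSmoothForm_hSum (hP : IsPartition Γ n h) {b : ℕ} (T : (Fin (b + 1) → Γ) → ℂ) :
    IsSmoothForm (hSum (n := n) h T) := by
  refine IsSmoothForm.congr_of_eventuallyEq fun m₀ => ?_
  obtain ⟨A, -, hA⟩ := hP.exists_finset m₀
  exact ⟨_, IsSmoothForm.sum _ fun y _ =>
    ((dhForm_smooth_closed hP _).1.smul (hP.smooth _)).const_smul _, hSum_eventuallyEq hA T⟩

theorem extd_hSum (hP : IsPartition Γ n h) {b : ℕ} (T : (Fin (b + 1) → Γ) → ℂ) :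
    extd (hSum (n := n) h T) = dhSum (n := n) h T := by
  funext m
  obtain ⟨A, -, hA⟩ := hP.exists_finset m
  have hsm : ∀ y : Fin (b + 1) → Γ, IsSmoothForm
      (fun m => translate h (y (Fin.last b)) m • dhForm (n := n) h (Fin.init y) m) := fun y =>
    (dhForm_smooth_closed hP _).1.smul (hP.smooth _)
  rw [extd_congr_of_eventuallyEq (hSum_eventuallyEq hA T),
    extd_sum _ fun y _ => (hsm y).const_smul _, (dhSum_eventuallyEq hA T).eq_of_nhds]
  rw [Finset.sum_apply, Finset.sum_apply]
  refine Finset.sum_congr rfl fun y _ => ?_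
  rw [extd_const_smul _ (hsm y), extd_translate_smul_dhForm hP]

theorem extd_dhSum (hP : IsPartition Γ n h) {b : ℕ} (T : (Fin b → Γ) → ℂ) :
    extd (dhSum (n := n) h T) = 0 := by
  funext m
  obtain ⟨A, -, hA⟩ := hP.exists_finset m
  have hsm : ∀ y : Fin b → Γ, IsSmoothForm (dhForm (n := n) h y) := fun y =>
    (dhForm_smooth_closed hP _).1
  rw [extd_congr_of_eventuallyEq (dhSum_eventuallyEq hA T),
    extd_sum _ fun y _ => (hsm y).const_smul _, Finset.sum_eq_zero]
  intro y _
  rw [extd_const_smul _ (hsm y), (dhForm_smooth_closed hP y).2, const_smul_zero_form]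

theorem dfun_translate_mul (hL : ∀ g : Γ, ContMDiff (𝓡 n) (𝓡 n) ∞ fun m : M' => g • m)
    (hP : IsPartition Γ n h) (a g : Γ) (m : M') :
    dfun (n := n) (translate h (a * g)) m = (dfun (n := n) (translate h a) (g • m)).comp
      (show EuclideanSpace ℝ (Fin n) →L[ℝ] EuclideanSpace ℝ (Fin n) from
        mfderiv (𝓡 n) (𝓡 n) (fun m : M' => g • m) m) := by
  have e : translate h (a * g) = translate h a ∘ fun m : M' => g • m := by
    funext m; simp [translate, mul_smul]
  rw [e]
  exact mfderiv_comp m ((hP.smooth a).mdifferentiable (by simp) _)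
    ((hL g).mdifferentiable (by simp) m)

theorem pullBack_dhForm (hL : ∀ g : Γ, ContMDiff (𝓡 n) (𝓡 n) ∞ fun m : M' => g • m)
    (hP : IsPartition Γ n h) (g : Γ) : ∀ {b : ℕ} (y : Fin b → Γ),
    pullBack (fun m : M' => g • m) (dhForm (n := n) h y) = dhForm h (fun i => y i * g)
  | 0, y => by funext m; ext v; rfl
  | b + 1, y => by
    funext m
    have ih := congrFun (pullBack_dhForm hL hP g (Fin.init y)) m
    change (wedge _ _).compContinuousLinearMap _ = wedge _ _
    rw [wedge_comp, dfun_translate_mul hL hP]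
    exact congrArg _ ih

theorem dhSum_apply_finsum (hP : IsPartition Γ n h) {b : ℕ} (T : (Fin b → Γ) → ℂ) (m : M')
    (v : Fin b → EuclideanSpace ℝ (Fin n)) :
    dhSum (n := n) h T m v = ∑ᶠ y, T y * dhForm h y m v := by
  obtain ⟨A, -, hA⟩ := hP.exists_at m
  rw [dhSum_apply hA]
  refine (finsum_eq_sum_of_support_subset _ fun y hy => ?_).symm
  by_contra hc
  refine hy ?_
  change T y * dhForm h y m v = 0
  rw [dhForm_eq_zero hA hc]
  exact mul_zero _

theorem hSum_apply_finsum (hP : IsPartition Γ n h) {b : ℕ} (T : (Fin (b + 1) → Γ) → ℂ) (m : M')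
    (v : Fin b → EuclideanSpace ℝ (Fin n)) :
    hSum (n := n) h T m v =
      ∑ᶠ y, T y * (translate h (y (Fin.last b)) m • dhForm h (Fin.init y) m v) := by
  obtain ⟨A, -, hA⟩ := hP.exists_at m
  rw [hSum_apply hA]
  refine (finsum_eq_sum_of_support_subset _ fun y hy => ?_).symm
  by_contra hc
  refine hy ?_
  have := congrArg (fun α => α v) (translate_smul_dhForm_eq_zero hA hc)
  change T y * _ = 0
  rw [show translate h (y (Fin.last b)) m • dhForm (n := n) h (Fin.init y) m v = 0 from this,
    mul_zero]

/-- Translation by g multiplies every entry by g on the right. The definition sums over all tuples,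
not over a finite set adapted to a point, so the change can be undone by reindexing. -/
theorem pullBack_dhSum (hL : ∀ g : Γ, ContMDiff (𝓡 n) (𝓡 n) ∞ fun m : M' => g • m)
    (hP : IsPartition Γ n h) (g : Γ) {b : ℕ} (T : (Fin b → Γ) → ℂ) :
    pullBack (fun m : M' => g • m) (dhSum (n := n) h T) =
      dhSum h (fun y => T fun i => y i * g⁻¹) := by
  funext m
  ext v
  rw [dhSum_apply_finsum hP]
  refine (dhSum_apply_finsum hP T (g • m) _).trans ?_
  refine Eq.trans (finsum_congr fun y => ?_)
    (finsum_comp_equiv (Equiv.arrowCongr (Equiv.refl (Fin b)) (Equiv.mulRight g)))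
  have e : (fun i => (Equiv.arrowCongr (Equiv.refl (Fin b)) (Equiv.mulRight g)) y i * g⁻¹) = y := by
    funext i; simp [Equiv.arrowCongr]
  rw [e]
  exact congrArg (fun α => T y * α v) (congrFun (pullBack_dhForm hL hP g y) m)

theorem pullBack_hSum (hL : ∀ g : Γ, ContMDiff (𝓡 n) (𝓡 n) ∞ fun m : M' => g • m)
    (hP : IsPartition Γ n h) (g : Γ) {b : ℕ} (T : (Fin (b + 1) → Γ) → ℂ) :
    pullBack (fun m : M' => g • m) (hSum (n := n) h T) =
      hSum h (fun y => T fun i => y i * g⁻¹) := by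
  funext m
  ext v
  rw [hSum_apply_finsum hP]
  refine (hSum_apply_finsum hP T (g • m) _).trans ?_
  refine Eq.trans (finsum_congr fun y => ?_)
    (finsum_comp_equiv (Equiv.arrowCongr (Equiv.refl (Fin (b + 1))) (Equiv.mulRight g)))
  have e : (fun i => (Equiv.arrowCongr (Equiv.refl (Fin (b + 1))) (Equiv.mulRight g)) y i * g⁻¹) =
      y := by
    funext i; simp [Equiv.arrowCongr]
  rw [e]
  have e2 : translate h (y (Fin.last b)) (g • m) = translate h (y (Fin.last b) * g) m := by
    simp [translate, mul_smul]
  rw [e2]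
  exact congrArg (fun α => T y * (translate h (y (Fin.last b) * g) m • α v))
    (congrFun (pullBack_dhForm hL hP g (Fin.init y)) m)

end Smooth

end PartitionForms

/-! ### Descent of invariant forms -/

section Descent

variable {Γ : Type*} [Group Γ] {n : ℕ} {M M' : Type*}
  [TopologicalSpace M] [ChartedSpace (EuclideanSpace ℝ (Fin n)) M] [IsManifold (𝓡 n) ∞ M]
  [TopologicalSpace M'] [ChartedSpace (EuclideanSpace ℝ (Fin n)) M'] [IsManifold (𝓡 n) ∞ M']
  [MulAction Γ M'] {π : M' → M}

theorem pullForm_congr {X : Type*} [NormedAddCommGroup X] [NormedSpace ℝ X] {p : ℕ} {f f' : X → M}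
    {x : X} (α : DForm n M p) (he : f =ᶠ[𝓝 x] f') : pullForm f α x = pullForm f' α x := by
  have h1 : mfderiv 𝓘(ℝ, X) (𝓡 n) f x = mfderiv 𝓘(ℝ, X) (𝓡 n) f' x := he.mfderiv_eq
  have h2 : f x = f' x := he.eq_of_nhds
  simp only [pullForm, h1, h2]

/-- In a chart, a form on the base is a pull-back of its pull-back to the covering. -/
theorem chartRep_eventuallyEq (hd : IsLocalDiffeomorph (𝓡 n) (𝓡 n) ∞ π)
    (hsurj : Function.Surjective π) {p : ℕ} (P : DForm n M p) {x₀ : M}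
    {y : EuclideanSpace ℝ (Fin n)} (hy : y ∈ (extChartAt (𝓡 n) x₀).target) :
    ∃ s : EuclideanSpace ℝ (Fin n) → M',
      ContMDiffAt 𝓘(ℝ, EuclideanSpace ℝ (Fin n)) (𝓡 n) ∞ s y ∧
      chartRep P x₀ =ᶠ[𝓝 y] pullForm s (pullBack π P) := by
  obtain ⟨m, hm⟩ := hsurj ((extChartAt (𝓡 n) x₀).symm y)
  have hl := hd m
  set ψ := hl.localInverse
  have hsy := contMDiffAt_extChartAt_symm hy
  have h1 : ContMDiffAt (𝓡 n) (𝓡 n) ∞ ψ ((extChartAt (𝓡 n) x₀).symm y) := by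
    rw [← hm]; exact hl.localInverse_contMDiffAt
  have hs : ContMDiffAt 𝓘(ℝ, EuclideanSpace ℝ (Fin n)) (𝓡 n) ∞
      (fun z => ψ ((extChartAt (𝓡 n) x₀).symm z)) y := h1.comp y hsy
  refine ⟨_, hs, ?_⟩
  have hsrc : ∀ᶠ z in 𝓝 y, (extChartAt (𝓡 n) x₀).symm z ∈ ψ.source := by
    refine hsy.continuousAt.eventually (hl.localInverse_open_source.mem_nhds ?_)
    rw [← hm]; exact hl.localInverse_mem_source
  filter_upwards [hsrc.eventually_nhds, eventually_contMDiffAt hs] with z hz hz'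
  rw [chartRep_eq_pullForm, ← pullForm_pullBack P (hd.mdifferentiable (by simp) _)
    hz']
  refine pullForm_congr P ?_
  filter_upwards [hz] with z' hz''
  exact (hl.localInverse_right_inv hz'').symm

theorem isSmoothForm_of_pullBack (hd : IsLocalDiffeomorph (𝓡 n) (𝓡 n) ∞ π)
    (hsurj : Function.Surjective π) {p : ℕ} {P : DForm n M p}
    (hP : IsSmoothForm (pullBack π P)) : IsSmoothForm P := by
  refine isSmoothForm_of_contDiffAt fun x₀ y hy => ?_
  obtain ⟨s, hs, he⟩ := chartRep_eventuallyEq hd hsurj P hy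
  exact (hP.pullForm hs).congr_of_eventuallyEq he

theorem extd_eq_zero_of_pullBack (hd : IsLocalDiffeomorph (𝓡 n) (𝓡 n) ∞ π)
    (hsurj : Function.Surjective π) {p : ℕ} {P : DForm n M p}
    (hP : IsSmoothForm (pullBack π P)) (h0 : extd (pullBack π P) = 0) : extd P = 0 := by
  funext x
  obtain ⟨s, hs, he⟩ := chartRep_eventuallyEq hd hsurj P (mem_extChartAt_target (I := 𝓡 n) x)
  have h1 : extd P x = extDeriv (pullForm s (pullBack π P)) (extChartAt (𝓡 n) x x) := by
    rw [extd, extDeriv, extDeriv, he.fderiv_eq]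
  rw [h1, extDeriv_pullForm hP hs, h0]
  ext v
  rfl

/-- Transport α from a chosen preimage of each point by the inverse of dπ. Two preimages differ by
some g with π ∘ g = π, and invariance of α removes the dependence on the choice. -/
theorem exists_pullBack_eq (hπ : IsNormalCovering Γ π) (hd : IsLocalDiffeomorph (𝓡 n) (𝓡 n) ∞ π)
    {p : ℕ} {α : DForm n M' p} (hα : ∀ g : Γ, pullBack (fun m : M' => g • m) α = α) :
    ∃ P : DForm n M p, pullBack π P = α := by
  have hn : (∞ : WithTop ℕ∞) ≠ 0 := by simp
  set r := Function.surjInv hπ.surjective with hr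
  refine ⟨fun x => (α (r x)).compContinuousLinearMap
    (show EuclideanSpace ℝ (Fin n) →L[ℝ] EuclideanSpace ℝ (Fin n) from
      ((hd (r x)).mfderivToContinuousLinearEquiv hn).symm.toContinuousLinearMap), ?_⟩
  funext m
  ext v
  change α (r (π m)) (fun i => ((hd (r (π m))).mfderivToContinuousLinearEquiv hn).symm
    (mfderiv (𝓡 n) (𝓡 n) π m (v i))) = α m v
  have hrm : π (r (π m)) = π m := Function.surjInv_eq hπ.surjective _
  obtain ⟨g, hg⟩ := (hπ.fiber m (r (π m))).1 hrm.symm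
  have key : ∀ m₁, g • m = m₁ → ∀ w : EuclideanSpace ℝ (Fin n),
      ((hd m₁).mfderivToContinuousLinearEquiv hn).symm (mfderiv (𝓡 n) (𝓡 n) π m w) =
        mfderiv (𝓡 n) (𝓡 n) (fun m : M' => g • m) m w := by
    rintro m₁ rfl w
    have hc : mfderiv (𝓡 n) (𝓡 n) (fun m : M' => π (g • m)) m =
        (mfderiv (𝓡 n) (𝓡 n) π (g • m)).comp (mfderiv (𝓡 n) (𝓡 n) (fun m : M' => g • m) m) :=
      mfderiv_comp m (hd.mdifferentiable hn _) ((hπ.contMDiff_smul hd g).mdifferentiable hn m)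
    have hf : ∀ f : M' → M, f = π → ∀ L : EuclideanSpace ℝ (Fin n) →L[ℝ] EuclideanSpace ℝ (Fin n),
        mfderiv (𝓡 n) (𝓡 n) f m = L → mfderiv (𝓡 n) (𝓡 n) π m w = L w := by
      rintro f rfl L hL
      exact congrArg (fun L : EuclideanSpace ℝ (Fin n) →L[ℝ] EuclideanSpace ℝ (Fin n) => L w) hL
    refine (ContinuousLinearEquiv.symm_apply_eq _).2 ?_
    exact hf _ (funext fun m => hπ.map_smul g m) _ hc
  have h2 := congrArg (fun β => β v) (congrFun (hα g) m)
  refine Eq.trans ?_ h2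
  have h3 : (fun i => ((hd (r (π m))).mfderivToContinuousLinearEquiv hn).symm
      (mfderiv (𝓡 n) (𝓡 n) π m (v i))) =
      fun i => mfderiv (𝓡 n) (𝓡 n) (fun m : M' => g • m) m (v i) :=
    funext fun i => key _ hg (v i)
  have h4 : ∀ m₁, g • m = m₁ → ∀ w : Fin p → EuclideanSpace ℝ (Fin n),
      α m₁ w = α (g • m) w := by
    rintro m₁ rfl w; rfl
  refine (congrArg (α (r (π m))) h3).trans ?_
  exact h4 _ hg _

end Descent

/-! ### Gluing tuples -/

section Glue

variable {Γ : Type*}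

/-- The increasing map of the natural numbers that omits `j`. -/
def skip (j i : ℕ) : ℕ := if i < j then i else i + 1

theorem val_succAbove {k : ℕ} (j : Fin (k + 1)) (i : Fin k) :
    ((j.succAbove i : Fin (k + 1)) : ℕ) = skip j i := by
  rw [Fin.succAbove, skip]
  simp only [Fin.lt_def, Fin.val_castSucc]
  split_ifs <;> rfl

/-- The tuple `(g₀, …, g_a, y₁, …, y_b)`. -/
def glue {a b k : ℕ} (hab : a + b = k) (g : ℕ → Γ) (y : Fin b → Γ) : Fin (k + 1) → Γ := fun i =>
  if hi : (i : ℕ) ≤ a then g i else y ⟨i - (a + 1), by have := i.2; omega⟩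

theorem glue_of_le {a b k : ℕ} (hab : a + b = k) (g : ℕ → Γ) (y : Fin b → Γ) {i : Fin (k + 1)}
    (hi : (i : ℕ) ≤ a) : glue hab g y i = g i := dif_pos hi

theorem glue_of_eq {a b k : ℕ} (hab : a + b = k) (g : ℕ → Γ) (y : Fin b → Γ) {i : Fin (k + 1)}
    (l : Fin b) (hi : (i : ℕ) = a + 1 + l) : glue hab g y i = y l := by
  rw [glue, dif_neg (by omega)]
  congr 1
  ext
  simp only
  omega

theorem glue_congr {a b k : ℕ} (hab : a + b = k) {g g' : ℕ → Γ} (h : ∀ i ≤ a, g i = g' i)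
    (y : Fin b → Γ) : glue hab g y = glue hab g' y := by
  funext i
  rw [glue, glue]
  split_ifs with hi
  · exact h _ hi
  · rfl

theorem glue_succAbove_of_le {a b k : ℕ} (hab : a + (b + 1) = k) (g : ℕ → Γ) (y : Fin (b + 1) → Γ)
    (j : Fin (k + 2)) (hj : (j : ℕ) ≤ a + 1) :
    (fun i => glue (show a + 1 + (b + 1) = k + 1 by omega) g y (j.succAbove i)) =
      glue hab (fun i => g (skip j i)) y := by
  funext i
  have hv := val_succAbove j i
  by_cases hi : (i : ℕ) ≤ a
  · rw [glue_of_le hab _ _ hi, glue_of_le _ _ _ (by rw [hv, skip]; split_ifs <;> omega), hv]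
  · have hi2 := i.2
    rw [glue_of_eq hab _ _ (⟨i - (a + 1), by omega⟩ : Fin (b + 1)) (by simp only; omega),
      glue_of_eq _ _ _ (⟨i - (a + 1), by omega⟩ : Fin (b + 1))]
    rw [hv, skip, if_neg (by omega)]
    simp only
    omega

theorem glue_update {a b k : ℕ} (hab : a + b = k) (g : ℕ → Γ) (y : Fin b → Γ) (l : Fin b) (u : Γ)
    {i : Fin (k + 1)} (hi : (i : ℕ) ≠ a + 1 + l) :
    glue hab g (Function.update y l u) i = glue hab g y i := by
  rw [glue, glue]
  split_ifs with h
  · rfl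
  · rw [Function.update_of_ne]
    intro hc
    have := congrArg Fin.val hc
    simp only at this
    omega

theorem glue_snoc {a b k : ℕ} (hab : a + 1 + b = k) (g : ℕ → Γ) (y : Fin b → Γ) (z : Γ) :
    (fun i => glue (show a + 1 + (b + 1) = k + 1 by omega) g (Fin.snoc y z : Fin (b + 1) → Γ)
      ((Fin.last (k + 1)).succAbove i)) = glue hab g y := by
  funext i
  rw [Fin.succAbove_last]
  have hi2 := i.2
  by_cases hi : (i : ℕ) ≤ a + 1
  · rw [glue_of_le hab _ _ hi, glue_of_le _ _ _ (by simpa using hi)]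
    rfl
  · rw [glue_of_eq hab _ _ (⟨i - (a + 2), by omega⟩ : Fin b) (by simp only; omega),
      glue_of_eq _ _ _ (Fin.castSucc (⟨i - (a + 2), by omega⟩ : Fin b))
        (by simp only [Fin.val_castSucc]; omega), Fin.snoc_castSucc]

theorem sum_fin_eq_sum_range_dite {R : Type*} [AddCommMonoid R] {N N' : ℕ} (hN : N' = N)
    (f : Fin N → R) : ∑ j, f j = ∑ j ∈ Finset.range N', if hj : j < N then f ⟨j, hj⟩ else 0 := by
  subst hN
  rw [← Fin.sum_univ_eq_sum_range]
  exact Finset.sum_congr rfl fun j _ => by rw [dif_pos j.2]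

end Glue

/-! ### The cocycle identity for forms with group labels -/

section Zigzag

variable {Γ : Type*} [Group Γ] {n : ℕ} {M' : Type*} [TopologicalSpace M']
  [ChartedSpace (EuclideanSpace ℝ (Fin n)) M'] [MulAction Γ M'] {h : M' → ℝ}

/-- This is the cocycle identity at (g₀, …, g_{a+1}, y₁, …, y_{b+1}), summed against h_{y_{b+1}}
dh_{y_b} ∧ ⋯ ∧ dh_{y₁}. Omitting a label gives the left side. Omitting y_l with l ≤ b gives 0,
because ∑ dh_g = 0. Omitting y_{b+1} gives the right side, because ∑ h_g = 1. -/
theorem sum_hSum_glue (hP : IsPartition Γ n h) {a b k : ℕ} (hab : a + (b + 1) = k)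
    (hab' : a + 1 + b = k) {τ : Chain Γ ℂ k} (hτ : IsCocycle 1 τ) (g : ℕ → Γ) (m : M')
    (v : Fin b → EuclideanSpace ℝ (Fin n)) :
    ∑ j ∈ Finset.range (a + 2), (-1 : ℂ) ^ j *
      hSum (n := n) h (fun y => τ (glue hab (fun i => g (skip j i)) y)) m v =
    (-1 : ℂ) ^ k * dhSum (n := n) h (fun y => τ (glue hab' g y)) m v := by
  have hk : a + 1 + (b + 1) = k + 1 := by omega
  set T : Fin (k + 2) → (Fin (b + 1) → Γ) → ℂ := fun j y =>
    τ (fun i => glue hk g y (j.succAbove i)) with hT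
  have h0 : ∑ j : Fin (k + 2), (-1 : ℂ) ^ (j : ℕ) * hSum (n := n) h (T j) m v = 0 := by
    rw [← hSum_sum_apply hP]
    obtain ⟨A, -, hA⟩ := hP.exists_at m
    rw [hSum_apply hA]
    refine Finset.sum_eq_zero fun y _ => ?_
    rw [hτ.closed (glue hk g y), zero_mul]
  rw [sum_fin_eq_sum_range_dite (show a + 2 + b + 1 = k + 2 by omega), Finset.sum_range_succ,
    Finset.sum_range_add] at h0
  have h1 : ∀ j ∈ Finset.range (a + 2), (if hj : j < k + 2 then
      (-1 : ℂ) ^ j * hSum (n := n) h (T ⟨j, hj⟩) m v else 0) =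
      (-1 : ℂ) ^ j * hSum (n := n) h (fun y => τ (glue hab (fun i => g (skip j i)) y)) m v := by
    intro j hj
    rw [Finset.mem_range] at hj
    rw [dif_pos (by omega)]
    have : T ⟨j, by omega⟩ = fun y => τ (glue hab (fun i => g (skip j i)) y) := by
      funext y
      exact congrArg τ (glue_succAbove_of_le hab g y ⟨j, by omega⟩ (by simp only; omega))
    rw [this]
  have h2 : ∀ l ∈ Finset.range b, (if hj : a + 2 + l < k + 2 then
      (-1 : ℂ) ^ (a + 2 + l) * hSum (n := n) h (T ⟨a + 2 + l, hj⟩) m v else 0) = 0 := by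
    intro l hl
    rw [Finset.mem_range] at hl
    rw [dif_pos (by omega), hSum_eq_zero hP ⟨l, hl⟩]
    · exact mul_zero _
    · intro y u
      refine congrArg τ (funext fun i => glue_update hk g y _ u ?_)
      intro hc
      refine Fin.succAbove_ne (⟨a + 2 + l, by omega⟩ : Fin (k + 2)) i (Fin.ext ?_)
      rw [hc]
      simp only [Fin.val_castSucc]
  have h3 : (if hj : a + 2 + b < k + 2 then
      (-1 : ℂ) ^ (a + 2 + b) * hSum (n := n) h (T ⟨a + 2 + b, hj⟩) m v else 0) =
      (-1 : ℂ) ^ (k + 1) * dhSum (n := n) h (fun y => τ (glue hab' g y)) m v := by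
    rw [dif_pos (by omega)]
    have e : (⟨a + 2 + b, by omega⟩ : Fin (k + 2)) = Fin.last (k + 1) := by
      ext; simp only [Fin.val_last]; omega
    rw [e, hSum_eq_dhSum hP (T' := fun y => τ (glue hab' g y)), show a + 2 + b = k + 1 by omega]
    intro y z
    exact congrArg τ (glue_snoc hab' g y z)
  rw [Finset.sum_congr rfl h1, Finset.sum_eq_zero h2, h3, add_zero, pow_succ] at h0
  linear_combination h0

/-- The form does not depend on the first entry of the cocycle. -/
theorem dhSum_cons (hP : IsPartition Γ n h) {k : ℕ} {τ : Chain Γ ℂ k} (hτ : IsCocycle 1 τ)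
    (g g' : Γ) : dhSum (n := n) h (fun y : Fin k → Γ => τ (Fin.cons g y)) =
      dhSum h (fun y => τ (Fin.cons g' y)) := by
  funext m
  ext v
  set c : (Fin k → Γ) → Fin (k + 2) → Γ := fun y =>
    Fin.cons g (Fin.cons g' y : Fin (k + 1) → Γ) with hc
  have h0 : ∑ j : Fin (k + 2), (-1 : ℂ) ^ (j : ℕ) *
      dhSum (n := n) h (fun y => τ fun i => c y (j.succAbove i)) m v = 0 := by
    rw [← dhSum_sum_apply hP]
    obtain ⟨A, -, hA⟩ := hP.exists_at m
    rw [dhSum_apply hA]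
    refine Finset.sum_eq_zero fun y _ => ?_
    rw [hτ.closed (c y), zero_mul]
  -- The faces 0 and 1 omit g and g'. Every other face omits some y_l and then no longer depends on
  -- it.
  rw [Fin.sum_univ_succ, Fin.sum_univ_succ, Finset.sum_eq_zero] at h0
  · have e0 : ∀ y, (fun i => c y ((0 : Fin (k + 2)).succAbove i)) = Fin.cons g' y := by
      intro y; funext i; simp [hc]
    have e1 : ∀ y, (fun i => c y ((Fin.succ (0 : Fin (k + 1))).succAbove i)) = Fin.cons g y := by
      intro y; funext i
      refine Fin.cases ?_ (fun i => ?_) i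
      · simp [hc]
      · rw [Fin.succ_succAbove_succ, Fin.zero_succAbove]
        simp [hc]
    simp only [e0, e1] at h0
    simp only [Fin.val_zero, pow_zero, one_mul, Fin.val_succ, zero_add, pow_one, add_zero] at h0
    linear_combination -h0
  · intro l _
    rw [dhSum_eq_zero hP l]
    · exact mul_zero _
    · intro y u
      refine congrArg τ (funext fun i => ?_)
      have hne := Fin.succAbove_ne l.succ.succ i
      have hup : c (Function.update y l u) = Function.update (c y) l.succ.succ u := by
        simp only [hc, Fin.cons_update]
      rw [hup, Function.update_of_ne hne]

end Zigzag

/-! ### Integrals over back faces -/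

section BackFaces

/-- The inclusion of the last `b + 1` vertices. -/
def back {a b k : ℕ} (hab : a + b = k) (i : Fin (b + 1)) : Fin (k + 1) :=
  ⟨a + i, by have := i.2; omega⟩

theorem succAbove_comp_back_of_le {a b k : ℕ} (hab : a + b = k) {j : Fin (k + 2)}
    (hj : (j : ℕ) ≤ a) :
    j.succAbove ∘ back hab = back (show a + 1 + b = k + 1 by omega) := by
  funext i
  ext
  rw [Function.comp, val_succAbove, skip, if_neg (by simp only [back]; omega)]
  simp only [back]
  omega

theorem succAbove_comp_back_of_eq {a b k : ℕ} (hab : a + b = k) {j : Fin (k + 2)}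
    {l : Fin (b + 2)} (hj : (j : ℕ) = a + l) :
    j.succAbove ∘ back hab = back (show a + (b + 1) = k + 1 by omega) ∘ l.succAbove := by
  funext i
  ext
  simp only [Function.comp, val_succAbove, skip, back]
  split_ifs <;> omega

theorem back_comp_succAbove_zero {a b k : ℕ} (hab : a + (b + 1) = k) :
    back hab ∘ (0 : Fin (b + 2)).succAbove = back (show a + 1 + b = k by omega) := by
  funext i
  ext
  simp only [Function.comp, Fin.succAbove_zero, back, Fin.val_succ]
  omega

theorem comp_face_comp_map {X : Type*} {a k : ℕ} (σ : Simplex (k + 1) → X) (j : Fin (k + 2))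
    (θ : Fin (a + 1) → Fin (k + 1)) :
    (σ ∘ face j) ∘ stdSimplex.map θ = σ ∘ stdSimplex.map (j.succAbove ∘ θ) := by
  funext t
  simp only [Function.comp, face]
  rw [stdSimplex.map_comp_apply]

theorem comp_map_comp_face {X : Type*} {a k : ℕ} (σ : Simplex k → X)
    (θ : Fin (a + 2) → Fin (k + 1)) (l : Fin (a + 2)) :
    (σ ∘ stdSimplex.map θ) ∘ face l = σ ∘ stdSimplex.map (θ ∘ l.succAbove) := by
  funext t
  simp only [Function.comp, face]
  rw [stdSimplex.map_comp_apply]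

theorem map_vertex {a b : ℕ} (θ : Fin (a + 1) → Fin (b + 1)) (i : Fin (a + 1)) :
    stdSimplex.map θ (vertex i) = vertex (θ i) := stdSimplex.map_vertex θ i

variable {Γ : Type*} [Group Γ] {n : ℕ} {M' : Type*} [TopologicalSpace M']
  [ChartedSpace (EuclideanSpace ℝ (Fin n)) M'] [MulAction Γ M'] {h : M' → ℝ}

/-- The values of `Φ` at the vertices of a simplex. -/
def vertexLabel {X : Type*} (Φ : X → Γ) {k : ℕ} (σ : Simplex k → X) (i : ℕ) : Γ :=
  if hi : i < k + 1 then Φ (σ (vertex ⟨i, hi⟩)) else 1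

theorem vertexLabel_face {X : Type*} (Φ : X → Γ) {k : ℕ} (σ : Simplex (k + 1) → X)
    (j : Fin (k + 2)) {i : ℕ} (hi : i < k + 1) :
    vertexLabel Φ (σ ∘ face j) i = vertexLabel Φ σ (skip j i) := by
  have h2 : skip j i = (j.succAbove ⟨i, hi⟩ : Fin _) := (val_succAbove j ⟨i, hi⟩).symm
  have h3 : skip j i < k + 1 + 1 := h2 ▸ (j.succAbove ⟨i, hi⟩).2
  rw [vertexLabel, vertexLabel, dif_pos hi, dif_pos h3, Function.comp, face, map_vertex]
  congr 3
  ext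
  exact h2.symm

theorem vertexLabel_smul {Φ : M' → Γ} (hΦ : ∀ (g : Γ) m, Φ (g • m) = Φ m * g⁻¹) (g : Γ) {k : ℕ}
    (σ : Simplex k → M') {i : ℕ} (hi : i < k + 1) :
    vertexLabel Φ ((fun m => g • m) ∘ σ) i = vertexLabel Φ σ i * g⁻¹ := by
  rw [vertexLabel, vertexLabel, dif_pos hi, dif_pos hi, Function.comp, hΦ]

theorem glue_mul {a b k : ℕ} (hab : a + b = k) (l : ℕ → Γ) (y : Fin b → Γ) (g : Γ) :
    glue hab (fun i => l i * g) (fun i => y i * g) = fun i => glue hab l y i * g := by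
  funext i
  rw [glue, glue]
  split_ifs <;> rfl

/-- The integral of `∑_y τ(g₀, …, g_a, y) dh_y` over the face spanned by the last vertices, the `g_i`
being the labels of the first vertices. -/
def dhIntegral (n : ℕ) [ChartedSpace (EuclideanSpace ℝ (Fin n)) M'] (h : M' → ℝ) (Φ : M' → Γ)
    {a b k : ℕ} (hab : a + b = k) (τ : Chain Γ ℂ k) (σ : Simplex k → M') : ℂ :=
  integrate (dhSum (n := n) h fun y => τ (glue hab (vertexLabel Φ σ) y))
    (σ ∘ stdSimplex.map (back hab))

/-- As `dhIntegral`, for the primitive `∑_y τ(g₀, …, g_a, y) h_{y_{b + 1}} dh_{y₁} ⋯ dh_{y_b}`. -/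
def hIntegral (n : ℕ) [ChartedSpace (EuclideanSpace ℝ (Fin n)) M'] (h : M' → ℝ) (Φ : M' → Γ)
    {a b k : ℕ} (hab : a + b = k) (τ : Chain Γ ℂ (k + 1)) (σ : Simplex k → M') : ℂ :=
  integrate (hSum (n := n) h fun y => τ (glue (show a + (b + 1) = k + 1 by omega)
    (vertexLabel Φ σ) y)) (σ ∘ stdSimplex.map (back hab))

variable [IsManifold (𝓡 n) ∞ M']

theorem integrate_sum_smul {ι : Type*} {k : ℕ} {σ : Simplex k → M'} {G : (Fin k → ℝ) → M'}
    (hG : IsParam n σ G) (s : Finset ι) (c : ι → ℂ) {α : ι → DForm n M' k}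
    (hα : ∀ i, IsSmoothForm (α i)) :
    integrate (∑ i ∈ s, c i • α i) σ = ∑ i ∈ s, c i * integrate (α i) σ := by
  classical
  induction s using Finset.induction_on with
  | empty => exact integrate_zero σ
  | insert i s hi ih =>
    rw [Finset.sum_insert hi, Finset.sum_insert hi, ← ih, ← integrate_const_smul]
    exact integrate_add hG ((hα i).const_smul _) (IsSmoothForm.sum _ fun j _ => (hα j).const_smul _)

/-- Both the labels and, after reindexing, the summed entries are multiplied by g⁻¹ on the right,
and τ is invariant under that. -/
theorem hIntegral_smul (hL : ∀ g : Γ, ContMDiff (𝓡 n) (𝓡 n) ∞ fun m : M' => g • m)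
    (hP : IsPartition Γ n h) {Φ : M' → Γ} (hΦ : ∀ (g : Γ) m, Φ (g • m) = Φ m * g⁻¹)
    {a b k : ℕ} (hab : a + b = k) {τ : Chain Γ ℂ (k + 1)} (hτ : IsCocycle 1 τ)
    {σ : Simplex k → M'} {G : (Fin k → ℝ) → M'} (hG : IsParam n σ G) (g : Γ) :
    hIntegral n h Φ hab τ ((fun m => g • m) ∘ σ) = hIntegral n h Φ hab τ σ := by
  rw [hIntegral, hIntegral, Function.comp_assoc, integrate_comp (hG.map (back hab)) (hL g),
    pullBack_hSum hL hP]
  congr 2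
  funext y
  rw [glue_congr _ (g' := fun i => vertexLabel Φ σ i * g⁻¹)
    (fun i hi => vertexLabel_smul hΦ g σ (by omega)), glue_mul]
  exact hτ.right_invariant g⁻¹ (by simp) _

/-- One step of the zigzag. The integrand is d of the form with h in place of the last dh, so
Stokes' theorem on the back face (v_a, …, v_{k+1}) applies. The faces of σ opposite v_{a+1}, …,
v_{k+1} give the same boundary terms. The remaining ones all live on the smaller back face ρ and are
combined by `sum_hSum_glue`. -/
theorem dhIntegral_eq (hP : IsPartition Γ n h) (Φ : M' → Γ) {a b k : ℕ} (hab : a + b = k)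
    {τ : Chain Γ ℂ (k + 1)} (hτ : IsCocycle 1 τ) {σ : Simplex (k + 1) → M'}
    {G : (Fin (k + 1) → ℝ) → M'} (hG : IsParam n σ G) :
    dhIntegral n h Φ (show a + (b + 1) = k + 1 by omega) τ σ =
      (-1 : ℂ) ^ a * coboundary (hIntegral n h Φ hab τ) σ +
        (-1 : ℂ) ^ b * dhIntegral n h Φ (show a + 1 + b = k + 1 by omega) τ σ := by
  have hab1 : a + (b + 1) = k + 1 := by omega
  have hab2 : a + 1 + b = k + 1 := by omega
  set L := vertexLabel Φ σ with hL
  set η : ℕ → DForm n M' b := fun j => hSum h fun y => τ (glue hab1 (fun i => L (skip j i)) y)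
    with hη
  set ρ := σ ∘ stdSimplex.map (back hab2) with hρ
  -- Omitting a label with index beyond a does not affect the labels g₀, …, g_a that enter the
  -- integrand.
  have hη0 : ∀ j, a + 1 ≤ j → η j = hSum h fun y => τ (glue hab1 L y) := by
    intro j hj
    simp only [hη]
    congr 1
    funext y
    rw [glue_congr hab1 (g' := L) fun i hi => by rw [skip, if_pos (by omega)]]
  have hJ : ∀ j : Fin (k + 2), hIntegral n h Φ hab τ (σ ∘ face j) =
      integrate (η j) (σ ∘ stdSimplex.map (j.succAbove ∘ back hab)) := by
    intro j
    rw [hIntegral, comp_face_comp_map]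
    congr 2
    funext y
    rw [glue_congr hab1 fun i hi => vertexLabel_face Φ σ j (by omega)]
  -- The cocycle identity integrated over ρ; j = a + 1 is the term that Stokes' theorem contributes
  -- from its face 0.
  have hfront : ∑ j ∈ Finset.range (a + 2), (-1 : ℂ) ^ j * integrate (η j) ρ =
      (-1 : ℂ) ^ (k + 1) * dhIntegral n h Φ hab2 τ σ := by
    rw [dhIntegral, ← integrate_const_smul,
      ← integrate_sum_smul (hG.map (back hab2)) _ _ fun j => isSmoothForm_hSum hP _]
    congr 1
    funext m
    ext v
    rw [Finset.sum_apply, ContinuousAlternatingMap.sum_apply]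
    exact sum_hSum_glue hP hab1 hab2 hτ L m v
  have hI : dhIntegral n h Φ hab1 τ σ = integrate (η (a + 1)) ρ +
      ∑ l ∈ Finset.range (b + 1), (-1 : ℂ) ^ (l + 1) *
        if hl : a + 1 + l < k + 2 then hIntegral n h Φ hab τ (σ ∘ face ⟨a + 1 + l, hl⟩) else 0 := by
    rw [dhIntegral, ← extd_hSum hP, integrate_extd (hG.map (back hab1)) (isSmoothForm_hSum hP _),
      Fin.sum_univ_succ, ← Fin.sum_univ_eq_sum_range (fun l => (-1 : ℂ) ^ (l + 1) *
        if hl : a + 1 + l < k + 2 then hIntegral n h Φ hab τ (σ ∘ face ⟨a + 1 + l, hl⟩) else 0)]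
    congr 1
    · rw [comp_map_comp_face, back_comp_succAbove_zero, hη0 _ le_rfl, Fin.val_zero, pow_zero,
        one_mul]
    · refine Finset.sum_congr rfl fun l _ => ?_
      have hl : a + 1 + (l : ℕ) < k + 2 := by have := l.2; omega
      rw [dif_pos hl, hJ, comp_map_comp_face, hη0 _ (by simp only; omega),
        succAbove_comp_back_of_eq (l := l.succ) hab
          (by simp only [Fin.val_succ]; omega), Fin.val_succ]
  -- Omitting a vertex v_j with j ≤ a leaves ρ as the back face and deletes a label; omitting a
  -- later vertex takes a face of the larger back face and keeps the labels.
  have hcob : coboundary (hIntegral n h Φ hab τ) σ =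
      (∑ j ∈ Finset.range (a + 1), (-1 : ℂ) ^ j * integrate (η j) ρ) +
      ∑ l ∈ Finset.range (b + 1), (-1 : ℂ) ^ (a + 1 + l) *
        if hl : a + 1 + l < k + 2 then hIntegral n h Φ hab τ (σ ∘ face ⟨a + 1 + l, hl⟩) else 0 := by
    rw [coboundary, sum_fin_eq_sum_range_dite (show a + 1 + (b + 1) = k + 2 by omega),
      Finset.sum_range_add]
    congr 1
    · refine Finset.sum_congr rfl fun j hj => ?_
      rw [Finset.mem_range] at hj
      rw [dif_pos (by omega), hJ, succAbove_comp_back_of_le hab (by simp only; omega)]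
    · refine Finset.sum_congr rfl fun l hl => ?_
      rw [Finset.mem_range] at hl
      rw [dif_pos (by omega), dif_pos (by omega)]
  rw [Finset.sum_range_succ] at hfront
  have hs : (-1 : ℂ) ^ a * (-1) ^ a = 1 := by rw [← mul_pow]; simp
  have hk : (-1 : ℂ) ^ (k + 1) = (-1) ^ a * (-1) ^ b * (-1) := by rw [← hab]; ring
  have hpull : ∑ l ∈ Finset.range (b + 1), (-1 : ℂ) ^ (a + 1 + l) *
      (if hl : a + 1 + l < k + 2 then hIntegral n h Φ hab τ (σ ∘ face ⟨a + 1 + l, hl⟩) else 0) =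
      (-1 : ℂ) ^ a * ∑ l ∈ Finset.range (b + 1), (-1 : ℂ) ^ (l + 1) *
        if hl : a + 1 + l < k + 2 then hIntegral n h Φ hab τ (σ ∘ face ⟨a + 1 + l, hl⟩) else 0 := by
    rw [Finset.mul_sum]
    refine Finset.sum_congr rfl fun l _ => ?_
    ring
  rw [hpull] at hcob
  rw [hcob, hI, eq_sub_of_add_eq hfront, hk]
  linear_combination (-(∑ l ∈ Finset.range (b + 1), (-1 : ℂ) ^ (l + 1) *
        if hl : a + 1 + l < k + 2 then hIntegral n h Φ hab τ (σ ∘ face ⟨a + 1 + l, hl⟩) else 0) -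
        integrate (η (a + 1)) ρ + (-1) ^ b * dhIntegral n h Φ hab2 τ σ) * hs

end BackFaces

/-! ### Comparison with group cohomology -/

section Comparison

variable {Γ : Type*} [Group Γ] {n : ℕ} {M' : Type*} [TopologicalSpace M']
  [ChartedSpace (EuclideanSpace ℝ (Fin n)) M'] [MulAction Γ M'] {h : M' → ℝ}

/-- The volume on the one-point space of maps from `Fin 0` is a Dirac mass. -/
theorem integrate_simplex_zero (α : DForm n M' 0) (σ : Simplex 0 → M') :
    integrate α σ = α (simplexCoord σ 0) Fin.elim0 := by
  have hc : ({t : Fin 0 → ℝ | (∀ i, 0 ≤ t i) ∧ ∑ i, t i ≤ 1}) = Set.univ := by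
    ext t; simp
  rw [integrate, hc, MeasureTheory.Measure.restrict_univ, MeasureTheory.volume_pi,
    MeasureTheory.Measure.pi_of_empty _ 0, MeasureTheory.integral_dirac]
  congr 1
  funext i
  exact i.elim0

theorem dhIntegral_zero (hP : IsPartition Γ n h) (Φ : M' → Γ) {a k : ℕ} (hab : a + 0 = k)
    (τ : Chain Γ ℂ k) (σ : Simplex k → M') :
    dhIntegral n h Φ hab τ σ = τ fun i => Φ (σ (vertex i)) := by
  rw [dhIntegral, integrate_simplex_zero]
  obtain ⟨A, -, hA⟩ := hP.exists_at (simplexCoord (σ ∘ stdSimplex.map (back hab)) 0)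
  rw [dhSum_apply hA, Finset.sum_eq_single (Fin.elim0 : Fin 0 → Γ)
    (fun y _ hy => absurd (Subsingleton.elim _ _) hy)
    (fun hy => absurd (mem_tuples.2 fun i => i.elim0) hy)]
  have h1 : dhForm (n := n) h (Fin.elim0 : Fin 0 → Γ)
    (simplexCoord (σ ∘ stdSimplex.map (back hab)) 0) Fin.elim0 = 1 := rfl
  rw [h1, mul_one]
  congr 1
  funext i
  rw [glue_of_le _ _ _ (by have := i.2; omega), vertexLabel, dif_pos i.2]

theorem coboundary_add_mul {X : Type*} {k : ℕ} (c d : ℂ) (β β' : (Simplex k → X) → ℂ)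
    (σ : Simplex (k + 1) → X) :
    coboundary (fun ρ => c * β ρ + d * β' ρ) σ = c * coboundary β σ + d * coboundary β' σ := by
  simp only [coboundary, Finset.mul_sum, ← Finset.sum_add_distrib]
  exact Finset.sum_congr rfl fun i _ => by ring

variable [IsManifold (𝓡 n) ∞ M']

/-- Iteration of `dhIntegral_eq` down to b = 0, where `dhIntegral_zero` leaves only the labels; each
step contributes one sign. The invariance of β is recorded since it is what lets β come from M. -/
theorem exists_dhIntegral_eq_coboundary
    (hL : ∀ g : Γ, ContMDiff (𝓡 n) (𝓡 n) ∞ fun m : M' => g • m)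
    (hP : IsPartition Γ n h) {Φ : M' → Γ} (hΦ : ∀ (g : Γ) m, Φ (g • m) = Φ m * g⁻¹) {k : ℕ}
    {τ : Chain Γ ℂ (k + 1)} (hτ : IsCocycle 1 τ) (b : ℕ) : ∀ {a : ℕ} (hab : a + b = k + 1),
    ∃ β : (Simplex k → M') → ℂ,
      (∀ (g : Γ) σ G, IsParam n σ G → β ((fun m => g • m) ∘ σ) = β σ) ∧
      ∀ σ G, IsParam n σ G → dhIntegral n h Φ hab τ σ =
        coboundary β σ + (∏ i ∈ Finset.range b, (-1 : ℂ) ^ i) * τ fun i => Φ (σ (vertex i)) := by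
  induction b with
  | zero =>
    intro a hab
    refine ⟨fun _ => 0, fun _ _ _ _ => rfl, fun σ G _ => ?_⟩
    rw [dhIntegral_zero hP]
    simp [coboundary]
  | succ b ih =>
    intro a hab
    obtain ⟨β, hβ, heq⟩ := ih (show a + 1 + b = k + 1 by omega)
    have hab' : a + b = k := by omega
    refine ⟨fun ρ => (-1 : ℂ) ^ a * hIntegral n h Φ hab' τ ρ + (-1 : ℂ) ^ b * β ρ,
      fun g σ G hG => ?_, fun σ G hG => ?_⟩
    · simp only [hIntegral_smul hL hP hΦ hab' hτ hG g, hβ g σ G hG]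
    · rw [dhIntegral_eq hP Φ hab' hτ hG, heq σ G hG, coboundary_add_mul, Finset.prod_range_succ]
      ring

/-- By `dhSum_cons` the first entry 1 may be replaced by the label of the vertex 0, which is the
start a = 0 of the zigzag. -/
theorem integrate_dhSum_cons (hP : IsPartition Γ n h) (Φ : M' → Γ) {k : ℕ} {τ : Chain Γ ℂ k}
    (hτ : IsCocycle 1 τ) (σ : Simplex k → M') :
    integrate (dhSum (n := n) h fun y => τ (Fin.cons 1 y)) σ =
      dhIntegral n h Φ (zero_add k) τ σ := by
  have h1 : σ ∘ stdSimplex.map (back (zero_add k)) = σ := by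
    have : back (zero_add k) = id := by funext i; ext; simp [back]
    funext t
    rw [this, Function.comp, stdSimplex.map_id_apply]
  rw [dhIntegral, h1, dhSum_cons hP hτ 1 (vertexLabel Φ σ 0)]
  congr 2
  funext y
  congr 1
  funext i
  refine Fin.cases ?_ (fun i => ?_) i
  · rw [Fin.cons_zero, glue_of_le _ _ _ (by simp)]; rfl
  · rw [Fin.cons_succ, glue_of_eq _ _ _ i (by simp only [Fin.val_succ]; omega)]

/-- The lift chosen in the definition is a translate of σ, and right invariance of τ makes the value
independent of the translate. -/
theorem groupCochain_comp {E B : Type*} [TopologicalSpace E] [TopologicalSpace B] [MulAction Γ E]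
    {pr : E → B} (hpr : IsNormalCovering Γ pr) {φ : E → Γ}
    (hφ : ∀ (g : Γ) (e : E), φ (g • e) = φ e * g⁻¹) {k : ℕ} {τ : Chain Γ ℂ k}
    (hτ : IsCocycle 1 τ) {σ : Simplex k → E} (hσ : Continuous σ) :
    groupCochain pr φ τ (pr ∘ σ) = τ fun i => φ (σ (vertex i)) := by
  have hex : ∃ σ' : Simplex k → E, Continuous σ' ∧ pr ∘ σ' = pr ∘ σ := ⟨σ, hσ, rfl⟩
  obtain ⟨g, hg⟩ := hpr.exists_smul_eq hσ hex.choose_spec.1 hex.choose_spec.2.symm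
  rw [groupCochain, dif_pos hex]
  simp only [← hg, hφ]
  exact hτ.right_invariant g⁻¹ (by simp) _

variable {M : Type*} [TopologicalSpace M] [ChartedSpace (EuclideanSpace ℝ (Fin n)) M]
  [IsManifold (𝓡 n) ∞ M] {π : M' → M}

/-- A cochain on `M'` which is invariant under `Γ` on smooth simplices comes from `M`. -/
theorem exists_cochain (hπ : IsNormalCovering Γ π) {k : ℕ} {β : (Simplex k → M') → ℂ}
    (hβ : ∀ (g : Γ) σ G, IsParam n σ G → β ((fun m => g • m) ∘ σ) = β σ) :
    ∃ β' : (Simplex k → M) → ℂ, ∀ σ G, IsParam n σ G → β' (π ∘ σ) = β σ := by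
  classical
  refine ⟨fun ρ => if hρ : ∃ (σ : Simplex k → M') (G : (Fin k → ℝ) → M'), IsParam n σ G ∧
    π ∘ σ = ρ then β hρ.choose else 0, fun σ G hG => ?_⟩
  have hex : ∃ (σ' : Simplex k → M') (G' : (Fin k → ℝ) → M'), IsParam n σ' G' ∧
    π ∘ σ' = π ∘ σ := ⟨σ, G, hG, rfl⟩
  obtain ⟨G', hG', he⟩ := hex.choose_spec
  obtain ⟨g, hg⟩ := hπ.exists_smul_eq hG.continuous hG'.continuous he.symm
  simp only [dif_pos hex]
  rw [← hβ g σ G hG]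
  congr 1
  funext t
  exact (hg t).symm

/-- Every smooth simplex lifts to M', where the form is zero, so all its integrals vanish and the
zero cochain serves as primitive. -/
theorem sameClass_zero (hπ : IsNormalCovering Γ π) (hd : IsLocalDiffeomorph (𝓡 n) (𝓡 n) ∞ π) :
    ∀ {p : ℕ} {P : DForm n M p}, pullBack π P = 0 → SameClass n (integrate P) 0 := by
  have key : ∀ {p : ℕ} {P : DForm n M p}, pullBack π P = 0 → ∀ σ, IsSmoothSimplex n σ →
      integrate P σ = 0 := by
    intro p P hP σ hσ
    obtain ⟨σ', G', hG', rfl⟩ := hσ.exists_lift hπ hd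
    rw [integrate_comp hG' hd.contMDiff, hP, integrate_zero]
  intro p P hP
  match p with
  | 0 => exact fun σ hσ => key hP σ hσ
  | p + 1 =>
    refine ⟨fun _ => 0, fun σ hσ => ?_⟩
    rw [key hP σ hσ]
    simp [coboundary]

/-- All is computed on lifts σ' to M'. The map ν' carries σ' to a lift of ν ∘ π ∘ σ', so the vertex
labels φ ∘ ν' used in the zigzag are those that the group cochain reads off. -/
theorem sameClass_groupCochain (hπ : IsNormalCovering Γ π)
    (hd : IsLocalDiffeomorph (𝓡 n) (𝓡 n) ∞ π) (hP : IsPartition Γ n h) {E B : Type*}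
    [TopologicalSpace E] [TopologicalSpace B] [MulAction Γ E] {pr : E → B}
    (hpr : IsNormalCovering Γ pr) {ν : M → B} {ν' : M' → E} (hν' : Continuous ν')
    (hequiv : ∀ (g : Γ) (m : M'), ν' (g • m) = g • ν' m) (hcomm : ∀ m, pr (ν' m) = ν (π m))
    {φ : E → Γ} (hφ : ∀ (g : Γ) (e : E), φ (g • e) = φ e * g⁻¹) (c : ℂ) :
    ∀ {k : ℕ} {τ : Chain Γ ℂ k}, IsCocycle 1 τ → ∀ {P : DForm n M k},
      pullBack π P = c • dhSum h (fun y => τ (Fin.cons 1 y)) →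
      SameClass n (integrate P) fun σ =>
        c * (∏ i ∈ Finset.range k, (-1 : ℂ) ^ i) * groupCochain pr φ τ (ν ∘ σ) := by
  have hΦ : ∀ (g : Γ) m, φ (ν' (g • m)) = φ (ν' m) * g⁻¹ := fun g m => by rw [hequiv, hφ]
  have hint : ∀ {k : ℕ} {τ : Chain Γ ℂ k}, IsCocycle 1 τ → ∀ {P : DForm n M k},
      pullBack π P = c • dhSum h (fun y => τ (Fin.cons 1 y)) → ∀ σ G, IsParam n σ G →
      integrate P (π ∘ σ) = c * dhIntegral n h (fun m => φ (ν' m)) (zero_add k) τ σ := by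
    intro k τ hτ P hPe σ G hG
    rw [integrate_comp hG hd.contMDiff, hPe, integrate_const_smul, integrate_dhSum_cons hP _ hτ]
  have hgrp : ∀ {k : ℕ} {τ : Chain Γ ℂ k}, IsCocycle 1 τ → ∀ (σ : Simplex k → M') G,
      IsParam n σ G → groupCochain pr φ τ (ν ∘ π ∘ σ) = τ fun i => φ (ν' (σ (vertex i))) := by
    intro k τ hτ σ G hG
    have : ν ∘ π ∘ σ = pr ∘ ν' ∘ σ := by funext t; exact (hcomm _).symm
    rw [this]
    exact groupCochain_comp hpr hφ hτ (hν'.comp hG.continuous)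
  intro k τ hτ P hPe
  match k with
  | 0 =>
    intro σ hσ
    obtain ⟨σ', G', hG', rfl⟩ := hσ.exists_lift hπ hd
    simp only [hgrp hτ σ' G' hG']
    rw [hint hτ hPe σ' G' hG', dhIntegral_zero hP]
    simp
  | k + 1 =>
    obtain ⟨β, hβ, heq⟩ := exists_dhIntegral_eq_coboundary (Φ := fun m => φ (ν' m))
      (hπ.contMDiff_smul hd) hP hΦ hτ (k + 1) (zero_add (k + 1))
    obtain ⟨β', hβ'⟩ := exists_cochain hπ hβ
    refine ⟨fun ρ => c * β' ρ, fun σ hσ => ?_⟩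
    obtain ⟨σ', G', hG', rfl⟩ := hσ.exists_lift hπ hd
    have hc : coboundary (fun ρ => c * β' ρ) (π ∘ σ') = c * coboundary β σ' := by
      rw [coboundary, coboundary, Finset.mul_sum]
      refine Finset.sum_congr rfl fun i _ => ?_
      rw [← hβ' _ _ (hG'.face i), Function.comp_assoc]
      ring
    simp only [hgrp hτ σ' G' hG']
    rw [hint hτ hPe σ' G' hG', heq σ' G' hG', hc]
    ring

/-- The pairing of a cocycle with the Chern character is a closed form on the base. -/
theorem exists_pairing_form (hπ : IsNormalCovering Γ π) (hd : IsLocalDiffeomorph (𝓡 n) (𝓡 n) ∞ π)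
    (hP : IsPartition Γ n h) (hh : ∀ m, ∑ᶠ g : Γ, h (g • m) = 1) {x : Γ} {k : ℕ}
    {τ : Chain Γ ℂ k} (hτ : IsCocycle x τ) (p : ℕ) :
    ∃ P : DForm n M p, IsSmoothForm P ∧ extd P = 0 ∧
      ∀ (m : M') (v : Fin p → EuclideanSpace ℝ (Fin n)),
        pullBack π P m v = evalCochain (cyclicCocycle x τ) (chernAt h p k m v) := by
  have hzero : ∀ m : M', pullBack π (0 : DForm n M p) m = 0 := fun m => by ext v; rfl
  by_cases hx : x = 1
  · subst hx
    by_cases hpk : p = k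
    · subst hpk
      set α : DForm n M' p := ((-1 : ℂ) ^ p / p.factorial) •
        dhSum (n := n) h (fun y : Fin p → Γ => τ (Fin.cons 1 y)) with hα
      -- Pulling back replaces τ(1, y) by τ(1, y g⁻¹) = τ(g, y), and the first entry does not matter
      -- by `dhSum_cons`.
      have hinv : ∀ g : Γ, pullBack (fun m : M' => g • m) α = α := by
        intro g
        have h1 : pullBack (fun m : M' => g • m)
            (dhSum (n := n) h (fun y : Fin p → Γ => τ (Fin.cons 1 y))) =
            dhSum (n := n) h (fun y : Fin p → Γ => τ (Fin.cons 1 y)) := by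
          rw [pullBack_dhSum (hπ.contMDiff_smul hd) hP, dhSum_cons hP hτ 1 g]
          congr 1
          funext y
          rw [← hτ.right_invariant g (by simp)]
          congr 1
          funext i
          refine Fin.cases ?_ (fun i => ?_) i <;> simp
        funext m
        ext v
        have h2 := congrArg (fun z => z v) (congrFun h1 m)
        exact congrArg (fun z : ℂ => ((-1 : ℂ) ^ p / p.factorial) * z) h2
      obtain ⟨P, hPα⟩ := exists_pullBack_eq hπ hd hinv
      have hs : IsSmoothForm (pullBack π P) := hPα ▸ (isSmoothForm_dhSum hP _).const_smul _
      have h0 : extd (pullBack π P) = 0 := by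
        rw [hPα, hα, extd_const_smul _ (isSmoothForm_dhSum hP _), extd_dhSum hP]
        funext m; ext v; exact mul_zero _
      refine ⟨P, isSmoothForm_of_pullBack hd hπ.surjective hs,
        extd_eq_zero_of_pullBack hd hπ.surjective hs h0, fun m v => ?_⟩
      obtain ⟨A, h1, hA⟩ := hP.exists_at m
      rw [hPα, evalCochain_one_self hP.smooth hh hA h1 v hτ, ← dhSum_apply hA]
      rfl
    · refine ⟨0, isSmoothForm_zero, extd_zero, fun m v => ?_⟩
      obtain ⟨A, h1, hA⟩ := hP.exists_at m
      rw [evalCochain_one_of_ne hP.smooth hh hA h1 hpk v hτ, hzero]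
      rfl
  · refine ⟨0, isSmoothForm_zero, extd_zero, fun m v => ?_⟩
    obtain ⟨A, h1, hA⟩ := hP.exists_at m
    rw [evalCochain_of_ne_one hP.smooth hh hA h1 hx v τ, hzero]
    rfl

end Comparison

end NCChern

theorem mainTheorem6 :
    ∃ c : ℕ → ℂ, (∀ k, c k ≠ 0) ∧
    ∀ (Γ : Type*) [Group Γ] (S : Finset Γ), Subgroup.closure (S : Set Γ) = ⊤ →
    ∀ (n : ℕ) (M M' : Type*)
      [TopologicalSpace M] [ChartedSpace (EuclideanSpace ℝ (Fin n)) M] [IsManifold (𝓡 n) ∞ M]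
      [T2Space M] [CompactSpace M] [ConnectedSpace M]
      [TopologicalSpace M'] [ChartedSpace (EuclideanSpace ℝ (Fin n)) M'] [IsManifold (𝓡 n) ∞ M']
      [T2Space M'] [ConnectedSpace M'] [MulAction Γ M']
      (π : M' → M), IsNormalCovering Γ π → IsLocalDiffeomorph (𝓡 n) (𝓡 n) ∞ π →
    ∀ h : M' → ℝ, ContMDiff (𝓡 n) 𝓘(ℝ, ℝ) ∞ h → HasCompactSupport h →
      (∀ m, ∑ᶠ g : Γ, h (g • m) = 1) →
    ∀ (x : Γ) (k : ℕ) (τ : Chain Γ ℂ k), IsCocycle x τ →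
      (∃ C D : ℝ, 0 < C ∧ 0 < D ∧ ∀ γ : Fin (k + 1) → Γ,
        ‖cyclicCocycle x τ γ‖ ≤ C * Real.exp (D * totalLength (S : Set Γ) γ)) →
    ∃ (hZ : Descends (S : Set Γ) (cyclicCocycle x τ))
      (hch : ∀ p m (v : Fin p → EuclideanSpace ℝ (Fin n)),
        IsForm (S : Set Γ) (chernAt (Γ := Γ) h p k m v))
      (P : ∀ p, DForm n M p),
      (∀ p, IsSmoothForm (P p) ∧ extd (P p) = 0 ∧
        ∀ (m : M') (v : Fin p → EuclideanSpace ℝ (Fin n)),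
          P p (π m) (fun i => mfderiv (𝓡 n) (𝓡 n) π m (v i)) =
            pair hZ (Quot.mk _ ⟨chernAt h p k m v, hch p m v⟩)) ∧
      (x ≠ 1 → ∀ p, SameClass n (integrate (P p)) 0) ∧
      (x = 1 →
        (∀ p, p ≠ k → SameClass n (integrate (P p)) 0) ∧
        ∀ (E B : Type*) [TopologicalSpace E] [ContractibleSpace E] [TopologicalSpace B]
          [MulAction Γ E] (pr : E → B), IsNormalCovering Γ pr →
        ∀ (ν : M → B) (ν' : M' → E), Continuous ν → Continuous ν' →
          (∀ (g : Γ) (m : M'), ν' (g • m) = g • ν' m) → (∀ m, pr (ν' m) = ν (π m)) →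
        ∀ φ : E → Γ, (∀ (g : Γ) (e : E), φ (g • e) = φ e * g⁻¹) →
          SameClass n (integrate (P k))
            (fun σ => c k * groupCochain pr φ τ (ν ∘ σ))) := by
  -- The first factor is the k-th coefficient of exp(-t); the product of signs, (-1)^(k (k - 1) /
  -- 2), is collected along the zigzag.
  refine ⟨fun k => (-1 : ℂ) ^ k / k.factorial * ∏ i ∈ Finset.range k, (-1 : ℂ) ^ i, fun k => ?_, ?_⟩
  · refine mul_ne_zero (div_ne_zero (pow_ne_zero _ (by norm_num)) ?_)
      (Finset.prod_ne_zero_iff.2 fun i _ => pow_ne_zero _ (by norm_num))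
    exact_mod_cast k.factorial_ne_zero
  intro Γ _ S hS n M M' _ _ _ _ _ _ _ _ _ _ _ _ π hπ hd h hsm hK hh x k τ hτ hgrowth
  have hP : IsPartition Γ n h :=
    ⟨fun g => hsm.comp (hπ.contMDiff_smul hd g), hπ.exists_partition hd hsm hK hh⟩
  have hZ : Descends (S : Set Γ) (cyclicCocycle x τ) := descends_cyclicCocycle hS hτ hgrowth
  have hch : ∀ p m (v : Fin p → EuclideanSpace ℝ (Fin n)),
      IsForm (S : Set Γ) (chernAt (Γ := Γ) h p k m v) := by
    intro p m v
    obtain ⟨A, h1, hA⟩ := hP.exists_at m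
    exact isForm_chernAt _ hP.smooth hh hA h1 p k v
  choose P hsmooth hclosed hpair using exists_pairing_form hπ hd hP hh hτ
  refine ⟨hZ, hch, P, fun p => ⟨hsmooth p, hclosed p, fun m v => hpair p m v⟩, ?_, ?_⟩
  · intro hx p
    refine sameClass_zero hπ hd ?_
    funext m
    ext v
    obtain ⟨A, h1, hA⟩ := hP.exists_at m
    rw [hpair, evalCochain_of_ne_one hP.smooth hh hA h1 hx v τ]
    rfl
  · rintro rfl
    refine ⟨fun p hp => sameClass_zero hπ hd ?_, ?_⟩
    · funext m
      ext v
      obtain ⟨A, h1, hA⟩ := hP.exists_at m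
      rw [hpair, evalCochain_one_of_ne hP.smooth hh hA h1 hp v hτ]
      rfl
    · intro E B _ _ _ _ pr hpr ν ν' _ hν' hequiv hcomm φ hφ
      refine sameClass_groupCochain hπ hd hP hpr hν' hequiv hcomm hφ _ hτ ?_
      funext m
      ext v
      obtain ⟨A, h1, hA⟩ := hP.exists_at m
      rw [hpair, evalCochain_one_self hP.smooth hh hA h1 v hτ, ← dhSum_apply hA]
      rfl
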